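/- Let $(\widetilde M^{4n},Q,\widetilde g)$ be a para-quaternionic Kähler manifold, i.e. a pseudo-Riemannian manifold with a rank-$3$ subbundle $Q\subset\operatorname{End}(T\widetilde M)$ of $\widetilde g$-skew-symmetric endomorphisms which is locally generated by $I,J,K$ with $-I^2=J^2=K^2=\mathrm{Id}$, $IJ=-JI=K$, and is preserved by the Levi-Civita connection of $\widetilde g$. When the dimension is $4$, one requires in addition that the curvature tensor is $R=\nu R_0+W$ at every point, with $\nu\in\mathbb R$, $W$ a trace-free $Q$-invariant algebraic curvature tensor ($Q$ acting by derivations), and $$R_0(X,Y)=\tfrac12\sum_\alpha\epsilon_\alpha\,\widetilde g(J_\alpha X,Y)J_\alpha+\tfrac14\Big(X\wedge Y-\sum_\alpha\epsilon_\alpha J_\alpha X\wedge J_\alpha Y\Big),$$ where $(J_1,J_2,J_3)=(I,J,K)$, $(\epsilon_1,\epsilon_2,\epsilon_3)=(-1,1,1)$ and $(X\wedge Y)Z=\widetilde g(Y,Z)X-\widetilde g(X,Z)Y$. Let $\epsilon\in\{1,-1\}$ and let $(M^{4k},\mathcal J,g)$ be an almost $\epsilon$-Hermitian submanifold of $\widetilde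 M$: an (immersed) submanifold of dimension $4k$ whose induced metric $g=\widetilde g|_M$ is non-degenerate, together with a smooth section $J$ of $Q|_M$ such that $J^2=\epsilon\,\mathrm{Id}$ and $J(TM)=TM$; put $\mathcal J=J|_{TM}$. Let $$N(X,Y)=[\mathcal JX,\mathcal JY]-\mathcal J[\mathcal JX,Y]-\mathcal J[X,\mathcal JY]+\epsilon[X,Y]$$ be the Nijenhuis tensor of $\mathcal J$, and for $x\in M$ let $\overline{T_xM}$ be the maximal $Q$-invariant subspace of $T_xM$. Assume that there is an open dense set $U\subset M$ such that, for every $x\in U$, $N_x\neq0$ and $\widetilde g$ is non-degenerate on $\overline{T_xM}$. Then $M$ is a totally geodesic para-quaternionic Kähler submanifold: $T_xM$ is $Q$-invariant for every $x\in M$, the second fundamental form of $M$ vanishes identically, and $(M,Q|_{TM},g)$ is a para-quaternionic Kähler manifold. -/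

import Mathlib

open Bundle Topology Filter
open scoped Manifold ContDiff

noncomputable section

namespace ParaQuat

/-! ### Linear algebra of para-quaternionic structures -/

section LinearAlgebra

variable {V : Type*} [AddCommGroup V] [Module ℝ V]

/-- The para-quaternionic relations `-I² = J² = K² = Id`, `IJ = -JI = K`
(the relation `K² = Id` follows from the others). -/
structure IsStandardTriple (I J K : V →ₗ[ℝ] V) : Prop where
  sq_I : ∀ v, I (I v) = -v
  sq_J : ∀ v, J (J v) = v
  anticomm : ∀ v, I (J v) = -J (I v)
  mul_eq : ∀ v, K v = I (J v)

/-- The subspace `W` is invariant under all the endomorphisms in `Q`. -/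
def IsInvariantUnder (Q : Set (V → V)) (W : Submodule ℝ V) : Prop :=
  ∀ A ∈ Q, ∀ w ∈ W, A w ∈ W

/-- The maximal `Q`-invariant subspace of a subspace `T`
(a sum of `Q`-invariant subspaces is `Q`-invariant). -/
def maximalInvariant (Q : Set (V → V)) (T : Submodule ℝ V) : Submodule ℝ V :=
  sSup {W | W ≤ T ∧ IsInvariantUnder Q W}

/-- The form `g` restricts to a non-degenerate form on the subspace `W`. -/
def IsNondegenerateOn (g : V → V → ℝ) (W : Submodule ℝ V) : Prop :=
  ∀ u ∈ W, (∀ v ∈ W, g u v = 0) → u = 0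

/-- The endomorphism `(u ∧ v) w = g(v, w) u - g(u, w) v`. -/
def wedgeEnd (g : V → V → ℝ) (u v w : V) : V := g v w • u - g u w • v

/-- The curvature tensor of the para-quaternionic projective space,
`R₀(u, v) = ½ ∑ ε_α g(J_α u, v) J_α + ¼ (u ∧ v - ∑ ε_α J_α u ∧ J_α v)`,
for a standard triple `(J₁, J₂, J₃) = (I, J, K)` with signs `(ε₁, ε₂, ε₃) = (-1, 1, 1)`. -/
def modelCurvature (g : V → V → ℝ) (I J K : V →ₗ[ℝ] V) (u v w : V) : V :=
  (1 / 2 : ℝ) • (-(g (I u) v • I w) + g (J u) v • J w + g (K u) v • K w)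
    + (1 / 4 : ℝ) • (wedgeEnd g u v w
        - (-wedgeEnd g (I u) (I v) w + wedgeEnd g (J u) (J v) w + wedgeEnd g (K u) (K v) w))

/-- Algebraic curvature tensors `W(u, v) w` of a scalar product `g`. -/
structure IsAlgebraicCurvature (g : V → V → ℝ) (W : V →ₗ[ℝ] V →ₗ[ℝ] V →ₗ[ℝ] V) : Prop where
  antisymm : ∀ u v w, W u v w = -W v u w
  skew : ∀ u v w z, g (W u v w) z = -g w (W u v z)
  bianchi : ∀ u v w, W u v w + W v w u + W w u v = 0

/-- The Ricci contraction `(v, w) ↦ tr (u ↦ W(u, v) w)` vanishes. -/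
def IsTraceFree (W : V →ₗ[ℝ] V →ₗ[ℝ] V →ₗ[ℝ] V) : Prop :=
  ∀ v w, LinearMap.trace ℝ V ((W.flip v).flip w) = 0

/-- `W` is annihilated by the endomorphisms in `Q`, acting as derivations on tensors. -/
def IsDerivationInvariant (Q : Set (V → V)) (W : V →ₗ[ℝ] V →ₗ[ℝ] V →ₗ[ℝ] V) : Prop :=
  ∀ A ∈ Q, ∀ u v w, A (W u v w) - W (A u) v w - W u (A v) w - W u v (A w) = 0

end LinearAlgebra

/-! ### Tensor fields, the Levi-Civita connection and curvature -/

section Manifold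

variable {E : Type*} [NormedAddCommGroup E] [NormedSpace ℝ E]
  {M : Type*} [TopologicalSpace M] [ChartedSpace E M] [IsManifold 𝓘(ℝ, E) ∞ M]

variable (E M) in
/-- Fields of bilinear forms on the tangent spaces (no regularity). -/
abbrev FormField : Type _ :=
  ∀ x : M, TangentSpace 𝓘(ℝ, E) x →L[ℝ] TangentSpace 𝓘(ℝ, E) x →L[ℝ] ℝ

variable (E M) in
/-- Fields of endomorphisms of the tangent spaces (no regularity). -/
abbrev EndField : Type _ :=
  ∀ x : M, TangentSpace 𝓘(ℝ, E) x →L[ℝ] TangentSpace 𝓘(ℝ, E) x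

variable (E M) in
/-- Fields of linear subspaces of the endomorphism spaces (no regularity). -/
abbrev EndSubspaceField : Type _ :=
  ∀ x : M, Submodule ℝ (TangentSpace 𝓘(ℝ, E) x →L[ℝ] TangentSpace 𝓘(ℝ, E) x)

/-- The vector field `X` is smooth at `x`. -/
def SmoothVectorFieldAt (X : ∀ x : M, TangentSpace 𝓘(ℝ, E) x) (x : M) : Prop :=
  ContMDiffAt 𝓘(ℝ, E) (𝓘(ℝ, E).prod 𝓘(ℝ, E)) ∞
    (fun y ↦ (⟨y, X y⟩ : TotalSpace E (fun z : M ↦ TangentSpace 𝓘(ℝ, E) z))) x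

/-- The vector field `X` is differentiable at `x`. -/
def DiffVectorFieldAt (X : ∀ x : M, TangentSpace 𝓘(ℝ, E) x) (x : M) : Prop :=
  MDifferentiableAt 𝓘(ℝ, E) (𝓘(ℝ, E).prod 𝓘(ℝ, E))
    (fun y ↦ (⟨y, X y⟩ : TotalSpace E (fun z : M ↦ TangentSpace 𝓘(ℝ, E) z))) x

/-- The field of endomorphisms `A` is smooth at `x`. -/
def SmoothEndFieldAt (A : EndField E M) (x : M) : Prop :=
  ContMDiffAt 𝓘(ℝ, E) (𝓘(ℝ, E).prod 𝓘(ℝ, E →L[ℝ] E)) ∞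
    (fun y ↦ (⟨y, A y⟩ : TotalSpace (E →L[ℝ] E)
      (fun z : M ↦ TangentSpace 𝓘(ℝ, E) z →L[ℝ] TangentSpace 𝓘(ℝ, E) z))) x

/-- `g` is a smooth pseudo-Riemannian metric. -/
structure IsPseudoRiemannianMetric (g : FormField E M) : Prop where
  smooth : ContMDiff 𝓘(ℝ, E) (𝓘(ℝ, E).prod 𝓘(ℝ, E →L[ℝ] E →L[ℝ] ℝ)) ∞
    (fun y ↦ (⟨y, g y⟩ : TotalSpace (E →L[ℝ] E →L[ℝ] ℝ)
      (fun z : M ↦ TangentSpace 𝓘(ℝ, E) z →L[ℝ] TangentSpace 𝓘(ℝ, E) z →L[ℝ] ℝ)))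
  symm : ∀ x u v, g x u v = g x v u
  nondegenerate : ∀ x u, (∀ v, g x u v = 0) → u = 0

/-- The endomorphisms belonging to `Q` at `x`, as plain maps. -/
def fiberMaps (Q : EndSubspaceField E M) (x : M) :
    Set (TangentSpace 𝓘(ℝ, E) x → TangentSpace 𝓘(ℝ, E) x) :=
  {A | ∃ B ∈ Q x, A = B}

/-- `Q` is an almost para-quaternionic structure: a rank `3` subbundle of the bundle of
endomorphisms, locally generated by a smooth standard triple. -/
def IsAlmostParaQuaternionic (Q : EndSubspaceField E M) : Prop :=
  ∀ x₀ : M, ∃ U : Set M, IsOpen U ∧ x₀ ∈ U ∧ ∃ J₁ J₂ J₃ : EndField E M, ∀ x ∈ U,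
    SmoothEndFieldAt J₁ x ∧ SmoothEndFieldAt J₂ x ∧ SmoothEndFieldAt J₃ x ∧
    IsStandardTriple (J₁ x).toLinearMap (J₂ x).toLinearMap (J₃ x).toLinearMap ∧
    LinearIndependent ℝ ![J₁ x, J₂ x, J₃ x] ∧
    Submodule.span ℝ {J₁ x, J₂ x, J₃ x} = Q x

variable [FiniteDimensional ℝ E]

/-- Covariant derivatives (linear connections) on the tangent bundle;
`D Y x v` is the derivative `∇_v Y` at `x`. -/
abbrev Connection (E M : Type*) [NormedAddCommGroup E] [NormedSpace ℝ E]
    [TopologicalSpace M] [ChartedSpace E M] [IsManifold 𝓘(ℝ, E) ∞ M] : Type _ :=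
  CovariantDerivative 𝓘(ℝ, E) E (fun x : M ↦ TangentSpace 𝓘(ℝ, E) x)

/-- `D` is the Levi-Civita connection of `g`: torsion-free and metric. These two properties
determine `D` on differentiable vector fields, and force it to be smooth. -/
structure IsLeviCivita (g : FormField E M) (D : Connection E M) : Prop where
  torsion_free : ∀ (X Y : ∀ x : M, TangentSpace 𝓘(ℝ, E) x) (x : M),
    DiffVectorFieldAt X x → DiffVectorFieldAt Y x →
    D Y x (X x) - D X x (Y x) = VectorField.mlieBracket 𝓘(ℝ, E) X Y x
  metric : ∀ (Y Z : ∀ x : M, TangentSpace 𝓘(ℝ, E) x) (x : M) (v : TangentSpace 𝓘(ℝ, E) x),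
    DiffVectorFieldAt Y x → DiffVectorFieldAt Z x →
    (mfderiv 𝓘(ℝ, E) 𝓘(ℝ, ℝ) (fun y ↦ g y (Y y) (Z y)) x v : ℝ)
      = g x (D Y x v) (Z x) + g x (Y x) (D Z x v)

/-- `D` preserves `Q`: the covariant derivative `(∇_v A) Y = ∇_v (A Y) - A (∇_v Y)` of every local
section `A` of `Q` belongs to `Q`. -/
def PreservesEnd (D : Connection E M) (Q : EndSubspaceField E M) : Prop :=
  ∀ (A : EndField E M) (x : M), SmoothEndFieldAt A x → (∀ᶠ y in 𝓝 x, A y ∈ Q y) →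
    ∀ v : TangentSpace 𝓘(ℝ, E) x, ∃ B ∈ Q x,
      ∀ Y : ∀ y : M, TangentSpace 𝓘(ℝ, E) y, DiffVectorFieldAt Y x →
        D (fun y ↦ A y (Y y)) x v - A x (D Y x v) = B (Y x)

/-- The curvature `R(X, Y) Z = ∇_X ∇_Y Z - ∇_Y ∇_X Z - ∇_[X, Y] Z` at `x`. -/
def curvatureOn (D : Connection E M) (X Y Z : ∀ x : M, TangentSpace 𝓘(ℝ, E) x) (x : M) :
    TangentSpace 𝓘(ℝ, E) x :=
  D (fun y ↦ D Z y (Y y)) x (X x) - D (fun y ↦ D Z y (X y)) x (Y x)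
    - D Z x (VectorField.mlieBracket 𝓘(ℝ, E) X Y x)

/-- At the point `x` the curvature tensor of `D` is `R = ν R₀ + W` with `W` a trace-free
`Q`-invariant algebraic curvature tensor. (As `W` is trace-free, in dimension `4 n` the scalar
curvature is `4 n (n + 2) ν`, so that `ν` is the reduced scalar curvature; `R₀` does not depend on
the choice of the standard triple of `Q` at `x`.) -/
def HasParaQuaternionicCurvatureAt (g : FormField E M) (Q : EndSubspaceField E M)
    (D : Connection E M) (x : M) : Prop :=
  ∃ (ν : ℝ) (J₁ J₂ J₃ : TangentSpace 𝓘(ℝ, E) x →L[ℝ] TangentSpace 𝓘(ℝ, E) x)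
    (W : TangentSpace 𝓘(ℝ, E) x →ₗ[ℝ] TangentSpace 𝓘(ℝ, E) x →ₗ[ℝ]
      TangentSpace 𝓘(ℝ, E) x →ₗ[ℝ] TangentSpace 𝓘(ℝ, E) x),
    IsStandardTriple J₁.toLinearMap J₂.toLinearMap J₃.toLinearMap ∧
    Submodule.span ℝ {J₁, J₂, J₃} = Q x ∧
    IsAlgebraicCurvature (fun u v ↦ g x u v) W ∧ IsTraceFree W ∧
    IsDerivationInvariant (fiberMaps Q x) W ∧
    ∀ X Y Z : ∀ y : M, TangentSpace 𝓘(ℝ, E) y,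
      SmoothVectorFieldAt X x → SmoothVectorFieldAt Y x → SmoothVectorFieldAt Z x →
      curvatureOn D X Y Z x
        = ν • modelCurvature (fun u v ↦ g x u v) J₁.toLinearMap J₂.toLinearMap
            J₃.toLinearMap (X x) (Y x) (Z x)
          + W (X x) (Y x) (Z x)

/-- `(M, Q, g)` is a para-quaternionic Kähler manifold: `Q` is an almost para-quaternionic
structure of `g`-skew-symmetric endomorphisms which is preserved by the Levi-Civita connection;
in dimension `4` the decomposition `R = ν R₀ + W` of the curvature is part of the definition. -/
structure IsParaQuaternionicKahler (g : FormField E M) (Q : EndSubspaceField E M) : Prop where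
  metric : IsPseudoRiemannianMetric g
  almost : IsAlmostParaQuaternionic Q
  skew : ∀ x, ∀ A ∈ Q x, ∀ u v, g x (A u) v = -g x u (A v)
  parallel : ∃ D : Connection E M, IsLeviCivita g D ∧ PreservesEnd D Q ∧
    (Module.finrank ℝ E = 4 → ∀ x, HasParaQuaternionicCurvatureAt g Q D x)

/-- The Nijenhuis tensor
`N(X, Y) = [JX, JY] - J[JX, Y] - J[X, JY] + ε [X, Y]` of a field of endomorphisms with
`J² = ε Id`, evaluated on vector fields. -/
def nijenhuis (ε : ℝ) (J : EndField E M) (X Y : ∀ x : M, TangentSpace 𝓘(ℝ, E) x) (x : M) :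
    TangentSpace 𝓘(ℝ, E) x :=
  VectorField.mlieBracket 𝓘(ℝ, E) (fun y ↦ J y (X y)) (fun y ↦ J y (Y y)) x
    - J x (VectorField.mlieBracket 𝓘(ℝ, E) (fun y ↦ J y (X y)) Y x)
    - J x (VectorField.mlieBracket 𝓘(ℝ, E) X (fun y ↦ J y (Y y)) x)
    + ε • VectorField.mlieBracket 𝓘(ℝ, E) X Y x

/-- The Nijenhuis tensor of `J` does not vanish at `x`. -/
def NijenhuisNeZeroAt (ε : ℝ) (J : EndField E M) (x : M) : Prop :=
  ∃ X Y : ∀ x : M, TangentSpace 𝓘(ℝ, E) x, SmoothVectorFieldAt X x ∧ SmoothVectorFieldAt Y x ∧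
    nijenhuis ε J X Y x ≠ 0

end Manifold

/-! ### Submanifolds, given by immersions `f : M → N` -/

section Submanifold

variable {E : Type*} [NormedAddCommGroup E] [NormedSpace ℝ E]
  {M : Type*} [TopologicalSpace M] [ChartedSpace E M] [IsManifold 𝓘(ℝ, E) ∞ M]
  {F : Type*} [NormedAddCommGroup F] [NormedSpace ℝ F]
  {N : Type*} [TopologicalSpace N] [ChartedSpace F N] [IsManifold 𝓘(ℝ, F) ∞ N]

variable (E F) in
/-- The tangent space of the submanifold at `x`, as a subspace of the ambient tangent space. -/
def tangentImage (f : M → N) (x : M) : Submodule ℝ (TangentSpace 𝓘(ℝ, F) (f x)) :=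
  LinearMap.range (mfderiv 𝓘(ℝ, E) 𝓘(ℝ, F) f x).toLinearMap

/-- The induced metric `f^* g`. -/
def inducedMetric (f : M → N) (g : FormField F N) : FormField E M := fun x ↦
  (ContinuousLinearMap.precomp ℝ (mfderiv 𝓘(ℝ, E) 𝓘(ℝ, F) f x)) ∘L
    (g (f x) ∘L mfderiv 𝓘(ℝ, E) 𝓘(ℝ, F) f x)

/-- The restriction `Q|_{TM}`: the endomorphisms of the tangent spaces of the submanifold which are
restrictions of endomorphisms belonging to `Q`. -/
def inducedStructure (f : M → N) (Q : EndSubspaceField F N) : EndSubspaceField E M := fun x ↦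
  { carrier := {B | ∃ A ∈ Q (f x), ∀ v,
      mfderiv 𝓘(ℝ, E) 𝓘(ℝ, F) f x (B v) = A (mfderiv 𝓘(ℝ, E) 𝓘(ℝ, F) f x v)}
    add_mem' := by
      rintro B B' ⟨A, hA, h⟩ ⟨A', hA', h'⟩
      exact ⟨A + A', add_mem hA hA', fun v ↦ by simp [h, h']⟩
    zero_mem' := ⟨0, zero_mem _, fun v ↦ by simp⟩
    smul_mem' := by
      rintro c B ⟨A, hA, h⟩
      exact ⟨c • A, Submodule.smul_mem _ c hA, fun v ↦ by simp [h]⟩ }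

/-- An immersed submanifold `f : M → N` is an almost `ε`-Hermitian submanifold of `(N, Q, g)`, with
respect to the section `J` of `Q` along `f`: the induced metric is non-degenerate, `J² = ε Id`, and
`J` maps tangent spaces of `M` to themselves. The induced field of endomorphisms of the tangent
spaces of `M` is `𝓙`, which `tangent` determines. -/
structure IsAlmostEpsHermitian (ε : ℝ) (g : FormField F N) (Q : EndSubspaceField F N) (f : M → N)
    (J : ∀ x : M, TangentSpace 𝓘(ℝ, F) (f x) →L[ℝ] TangentSpace 𝓘(ℝ, F) (f x))
    (𝓙 : EndField E M) : Prop where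
  immersion : Manifold.IsImmersion 𝓘(ℝ, E) 𝓘(ℝ, F) ∞ f
  nondegenerate : ∀ x, IsNondegenerateOn (fun u v ↦ g (f x) u v) (tangentImage E F f x)
  smooth : ContMDiff 𝓘(ℝ, E) (𝓘(ℝ, F).prod 𝓘(ℝ, F →L[ℝ] F)) ∞
    (fun x ↦ (⟨f x, J x⟩ : TotalSpace (F →L[ℝ] F)
      (fun z : N ↦ TangentSpace 𝓘(ℝ, F) z →L[ℝ] TangentSpace 𝓘(ℝ, F) z)))
  mem : ∀ x, J x ∈ Q (f x)
  sq : ∀ x v, J x (J x v) = ε • v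
  tangent : ∀ x v, mfderiv 𝓘(ℝ, E) 𝓘(ℝ, F) f x (𝓙 x v) = J x (mfderiv 𝓘(ℝ, E) 𝓘(ℝ, F) f x v)

variable [FiniteDimensional ℝ F]

/-- The submanifold is totally geodesic, i.e. its second fundamental form vanishes:
the ambient Levi-Civita derivative, in tangent directions, of vector fields that are tangent to
the submanifold is tangent to the submanifold. -/
def IsTotallyGeodesic (g : FormField F N) (f : M → N) : Prop :=
  ∃ D : Connection F N, IsLeviCivita g D ∧
    ∀ (x : M) (Y : ∀ p : N, TangentSpace 𝓘(ℝ, F) p), SmoothVectorFieldAt Y (f x) →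
      (∀ᶠ y in 𝓝 x, Y (f y) ∈ tangentImage E F f y) →
      ∀ v ∈ tangentImage E F f x, D Y (f x) v ∈ tangentImage E F f x

/-- A totally geodesic para-quaternionic Kähler submanifold: the tangent spaces are `Q`-invariant,
the second fundamental form vanishes, and the submanifold with the restrictions of `g` and `Q` is a
para-quaternionic Kähler manifold. -/
structure IsTotallyGeodesicParaQuaternionicKahler [FiniteDimensional ℝ E]
    (g : FormField F N) (Q : EndSubspaceField F N) (f : M → N) : Prop where
  invariant : ∀ x, IsInvariantUnder (fiberMaps Q (f x)) (tangentImage E F f x)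
  totallyGeodesic : IsTotallyGeodesic (E := E) g f
  kahler : IsParaQuaternionicKahler (inducedMetric (E := E) f g) (inducedStructure f Q)

end Submanifold

end ParaQuat

end

/-! Since the Levi-Civita connection preserves `Q`, the derivative of `J` in a tangent direction `X`
lies in `Q`, and differentiating `J² = ε` shows that it anticommutes with `J`. Torsion-freeness
gives `N(X, Y) = C_X Y - C_Y X` with `C_X = ∇_{JX} J - J ∘ ∇_X J` (`mfderiv_nijenhuis`). Choose `J₂`
in `Q` anticommuting with `J` and with `J₂²` a positive scalar; then `C_X = p J₂ + q J J₂`. For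
tangent `X`, `Y` the vector `N(X, Y)` is `J₂` applied to a combination of `X`, `JX`, `Y`, `JY`, and
it is tangent; as the combination is tangent too, it lies in the maximal `Q`-invariant subspace.

If `N ≠ 0`, some `C_X` is nonzero, and solving for `Y` shows that this subspace has codimension at
most 2 in the tangent space (for `ε = 1` one argues in an eigenspace of `J`, where the codimension
is at most 1). A non-degenerate `Q`-invariant space has dimension divisible by 4, and so has the
tangent space; hence the two coincide (`invariant_of_nijenhuis_ne_zero`). Invariance is a closed
condition, so it passes from the dense set to all of `M` (`invariant_of_dense`).

A submanifold with `Q`-invariant tangent spaces is totally geodesic: modulo tangent vectors its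
second fundamental form `s` is symmetric and commutes with `Q` in each argument, so `I J s = J I s =
-I J s` and `s = 0` (`mem_of_symmetric_mod`, `alongDeriv_map_mem`). The tangential connection is
then the Levi-Civita connection of the induced metric and preserves the induced structure.

When `dim M = 4` the decomposition `R = ν R₀ + W` has to be proved as well. If the ambient dimension
is also 4, it is carried over by the isomorphism `df`. If the ambient dimension is larger, it comes
from algebra: curvature operators normalize `Q`, and in dimension above 4 this forces their
`Q`-components to be one common multiple of the fundamental forms
(`exists_reduced_scalar_curvature`). By the Gauss equation the submanifold inherits these
commutators with the same constant. Subtracting the multiple of `R₀` with the same commutators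
leaves a tensor commuting with `Q`, which is automatically trace-free and `Q`-invariant
(`exists_curvature_decomposition`).

Vector fields along `f` are handled by extending them to the ambient manifold through a smooth local
left inverse of `f` (`exists_localRetraction`). -/

namespace ParaQuat

/-! ### Algebra of standard triples -/

section StandardTriple

variable {V : Type*} [AddCommGroup V] [Module ℝ V]

namespace IsStandardTriple

variable {I J K : V →ₗ[ℝ] V} (h : IsStandardTriple I J K)
include h

lemma J_I (v : V) : J (I v) = -I (J v) := by rw [h.anticomm]; simp

lemma I_K (v : V) : I (K v) = -J v := by simp [h.mul_eq, h.sq_I]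

lemma J_K (v : V) : J (K v) = -I v := by simp [h.mul_eq, h.J_I, h.sq_J]

lemma K_I (v : V) : K (I v) = J v := by simp [h.mul_eq, h.J_I, h.sq_I]

lemma K_J (v : V) : K (J v) = I v := by simp [h.mul_eq, h.sq_J]

lemma sq_K (v : V) : K (K v) = v := by simp [h.mul_eq, h.J_I, h.sq_I, h.sq_J]

/-- The anticommutator of `a I + b J + c K` with `I`, `J`, `K` is the scalar `-2a`, `2b`, `2c`, so
one nonzero vector suffices to detect the coefficients. -/
lemma coeff_eq_zero {a b c : ℝ} {v : V} (hv : v ≠ 0)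
    (h0 : ∀ w, a • I w + b • J w + c • K w = 0) : a = 0 ∧ b = 0 ∧ c = 0 := by
  have key : ∀ A : V →ₗ[ℝ] V, A (a • I v + b • J v + c • K v)
      + (a • I (A v) + b • J (A v) + c • K (A v)) = 0 := fun A ↦ by
    rw [h0 v, h0 (A v)]; simp
  have aux : ∀ t : ℝ, (2 * t) • v = 0 → t = 0 := fun t ht ↦ by
    rcases smul_eq_zero.1 ht with h | h
    · linarith
    · exact absurd h hv
  refine ⟨aux a ?_, aux b ?_, aux c ?_⟩
  · have := key I
    simp only [map_add, map_smul, h.sq_I, h.J_I, h.I_K, h.K_I] at this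
    rw [← neg_eq_zero, ← this]; module
  · have := key J
    simp only [map_add, map_smul, h.sq_J, h.J_I, h.J_K, h.K_J] at this
    rw [← this]; module
  · have := key K
    simp only [map_add, map_smul, h.sq_K, h.I_K, h.J_K, h.K_I, h.K_J] at this
    rw [← this]; module

lemma linearIndependent [Nontrivial V] : LinearIndependent ℝ ![I, J, K] := by
  obtain ⟨v, hv⟩ := exists_ne (0 : V)
  rw [Fintype.linearIndependent_iff]
  intro t ht
  have := h.coeff_eq_zero (a := t 0) (b := t 1) (c := t 2) hv fun w ↦ by
    simpa [Fin.sum_univ_three] using congr($ht w)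
  intro i
  fin_cases i
  exacts [this.1, this.2.1, this.2.2]

end IsStandardTriple

/-- `B` is a linear combination of `I`, `J` and `K`, as a map. -/
def IsComb (I J K : V →ₗ[ℝ] V) (B : V → V) : Prop :=
  ∃ a b c : ℝ, ∀ v, B v = a • I v + b • J v + c • K v

/-- Squares in the span of `I, J, K` are scalars, given by the quadratic form `-a² + b² + c²`, and
orthogonal elements anticommute. The form has signature (2,1), so the orthogonal complement of `J₀`
contains a positive vector `J₂` whatever the sign `ε`; it is left unnormalized to avoid square
roots. The elements `J₀`, `J₂`, `J₀ J₂` are orthogonal and span. -/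
lemma IsStandardTriple.exists_adapted [Nontrivial V] {I J K : V →ₗ[ℝ] V}
    (h : IsStandardTriple I J K) {J₀ : V →ₗ[ℝ] V} (hJ₀ : IsComb I J K J₀) {ε : ℝ}
    (hε : ε = 1 ∨ ε = -1) (hsq : ∀ v, J₀ (J₀ v) = ε • v) :
    ∃ (J₂ : V →ₗ[ℝ] V) (l : ℝ), IsComb I J K J₂ ∧ 0 < l ∧ (∀ v, J₂ (J₂ v) = l • v) ∧
      (∀ v, J₂ (J₀ v) = -J₀ (J₂ v)) ∧
      ∀ B : V → V, IsComb I J K B → IsComb J₀ J₂ (J₀ ∘ₗ J₂) B := by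
  obtain ⟨a, b, c, habc⟩ := hJ₀
  obtain ⟨v, hv⟩ := exists_ne (0 : V)
  have hn : -a ^ 2 + b ^ 2 + c ^ 2 = ε := by
    have := hsq v
    simp only [habc, map_add, map_smul, h.sq_I, h.sq_J, h.sq_K, h.J_I, h.I_K, h.J_K, h.K_I, h.K_J,
      ← h.mul_eq] at this
    have h2 : (-a ^ 2 + b ^ 2 + c ^ 2 - ε) • v = 0 := by
      rw [sub_smul, ← this]; module
    rcases smul_eq_zero.1 h2 with h | h
    · linarith
    · exact absurd h hv
  have hw : ∀ w, J₀ w = a • I w + b • J w + c • K w := habc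
  rcases hε with rfl | rfl
  · have hl : 0 < b ^ 2 + c ^ 2 := by nlinarith
    -- The vector `(0, -c, b)` is orthogonal to `(a, b, c)`, and its square `b² + c² = 1 + a²` is
    -- positive.
    refine ⟨(-c) • J + b • K, b ^ 2 + c ^ 2, ⟨0, -c, b, fun v ↦ by simp⟩, hl, fun v ↦ ?_,
      fun v ↦ ?_, ?_⟩
    · simp only [LinearMap.add_apply, LinearMap.smul_apply, map_add, map_smul, h.sq_J, h.sq_K,
        h.J_K, h.K_J]
      module
    · simp only [hw, LinearMap.add_apply, LinearMap.smul_apply, map_add, map_smul, h.sq_J, h.sq_K,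
        h.J_K, h.K_J, h.J_I, h.K_I, h.I_K, ← h.mul_eq]
      module
    · rintro B ⟨p, q, r, hB⟩
      refine ⟨-p * a + q * b + r * c, (-q * c + r * b) / (b ^ 2 + c ^ 2),
        (p * (b ^ 2 + c ^ 2) - q * a * b - r * a * c) / (-(b ^ 2 + c ^ 2)), fun v ↦ ?_⟩
      simp only [hB, hw, LinearMap.comp_apply, LinearMap.add_apply, LinearMap.smul_apply, map_add,
        map_smul, h.sq_J, h.sq_K, h.J_K, h.K_J, h.I_K, ← h.mul_eq, smul_neg]
      match_scalars <;> field_simp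
      · linear_combination (-p * (b ^ 2 + c ^ 2)) * hn
      · linear_combination (-(q * b ^ 2 + r * b * c)) * hn
      · linear_combination (-(r * c ^ 2 + q * b * c)) * hn
      · ring
  · have hl : 0 < a ^ 2 - b ^ 2 := by nlinarith
    -- Here `(b, a, 0)` is orthogonal to `(a, b, c)`, with square `a² - b² = 1 + c²`.
    refine ⟨b • I + a • J, a ^ 2 - b ^ 2, ⟨b, a, 0, fun v ↦ by simp⟩, hl, fun v ↦ ?_,
      fun v ↦ ?_, ?_⟩
    · simp only [LinearMap.add_apply, LinearMap.smul_apply, map_add, map_smul, h.sq_J, h.sq_I,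
        h.J_I]
      module
    · simp only [hw, LinearMap.add_apply, LinearMap.smul_apply, map_add, map_smul, h.sq_J, h.sq_I,
        h.J_K, h.K_J, h.J_I, h.K_I, h.I_K, ← h.mul_eq]
      module
    · rintro B ⟨p, q, r, hB⟩
      refine ⟨p * a - q * b - r * c, (-p * b + q * a) / (a ^ 2 - b ^ 2),
        (-p * c * a + q * c * b + r * (a ^ 2 - b ^ 2)) / (a ^ 2 - b ^ 2), fun v ↦ ?_⟩
      simp only [hB, hw, LinearMap.comp_apply, LinearMap.add_apply, LinearMap.smul_apply, map_add,
        map_smul, h.sq_J, h.sq_I, h.J_I, h.K_I, h.K_J, ← h.mul_eq, smul_neg]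
      match_scalars <;> field_simp
      · linear_combination (p * a ^ 2 - a * q * b) * hn
      · linear_combination (p * a * b - q * b ^ 2) * hn
      · linear_combination (r * (a ^ 2 - b ^ 2)) * hn
      · ring

end StandardTriple

/-! ### Dimensions of invariant non-degenerate subspaces -/

section Dimension

variable {V : Type*} [AddCommGroup V] [Module ℝ V] [FiniteDimensional ℝ V]

/-- A vector space with a nondegenerate alternating form is even dimensional. -/
lemma even_finrank_of_alternating (s : V →ₗ[ℝ] V →ₗ[ℝ] ℝ) (hs : ∀ u v, s u v = -s v u)
    (hnd : ∀ u, (∀ v, s u v = 0) → u = 0) : Even (Module.finrank ℝ V) := by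
  classical
  let b := Module.finBasis ℝ V
  let A := LinearMap.toMatrix₂ b b s
  have hA : A.transpose = -A := by
    ext i j
    simp [A, LinearMap.toMatrix₂_apply, hs (b j) (b i)]
  have hdet : A.det ≠ 0 := by
    rw [← LinearMap.separatingLeft_iff_det_ne_zero b]
    exact hnd
  have h1 : A.det = (-1) ^ (Module.finrank ℝ V) * A.det := by
    conv_lhs => rw [← Matrix.det_transpose, hA, Matrix.det_neg, Fintype.card_fin]
  by_contra hodd
  rw [Nat.not_even_iff_odd] at hodd
  rw [hodd.neg_one_pow] at h1
  apply hdet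
  linarith

/-- The subspaces `{w ∈ W | A w = t w}`. -/
def eigenIn (A : V →ₗ[ℝ] V) (t : ℝ) (W : Submodule ℝ V) : Submodule ℝ V :=
  W ⊓ LinearMap.ker (A - t • LinearMap.id)

omit [FiniteDimensional ℝ V] in
lemma mem_eigenIn {A : V →ₗ[ℝ] V} {t : ℝ} {W : Submodule ℝ V} {w : V} :
    w ∈ eigenIn A t W ↔ w ∈ W ∧ A w = t • w := by
  simp [eigenIn, sub_eq_zero]

/-- The pairing embeds `W₁` into the dual of `W₂`. -/
lemma finrank_le_of_pairing (g : V →ₗ[ℝ] V →ₗ[ℝ] ℝ) (W₁ W₂ : Submodule ℝ V)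
    (h : ∀ u ∈ W₁, (∀ v ∈ W₂, g u v = 0) → u = 0) :
    Module.finrank ℝ W₁ ≤ Module.finrank ℝ W₂ := by
  rw [← Subspace.dual_finrank_eq (V := W₂)]
  let φ : W₁ →ₗ[ℝ] Module.Dual ℝ W₂ :=
    (LinearMap.lcomp ℝ ℝ W₂.subtype) ∘ₗ g ∘ₗ W₁.subtype
  apply LinearMap.finrank_le_finrank_of_injective (f := φ)
  rw [injective_iff_map_eq_zero]
  intro u hu
  apply Subtype.ext
  exact h u u.2 fun v hv ↦ by simpa [φ] using congr($hu ⟨v, hv⟩)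

/-- The `±1`-eigenspaces of a skew involution of a space with a scalar product both have half the
dimension. -/
lemma finrank_eq_two_mul_eigenIn (g : V →ₗ[ℝ] V →ₗ[ℝ] ℝ)
    (A : V →ₗ[ℝ] V) (hA : ∀ v, A (A v) = v) (hskew : ∀ u v, g (A u) v = -g u (A v))
    (W : Submodule ℝ V) (hW : ∀ w ∈ W, A w ∈ W)
    (hnd : IsNondegenerateOn (fun u v ↦ g u v) W) {t : ℝ} (ht : t * t = 1) :
    Module.finrank ℝ W = 2 * Module.finrank ℝ (eigenIn A t W) := by
  -- Skewness makes each eigenspace totally null, so non-degeneracy has to come from pairing it with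
  -- the opposite one.
  have hiso : ∀ s : ℝ, s * s = 1 → ∀ u ∈ eigenIn A s W, ∀ v ∈ eigenIn A s W, g u v = 0 := by
    intro s hs u hu v hv
    rw [mem_eigenIn] at hu hv
    have := hskew u v
    rw [hu.2, hv.2] at this
    simp only [map_smul, LinearMap.smul_apply, smul_eq_mul] at this
    have h2 : s * (s * g u v) = 0 := by
      rw [show s * g u v = 0 by linarith]; simp
    rw [← mul_assoc, hs] at h2
    linarith
  have hdec : ∀ s : ℝ, s * s = 1 → ∀ w ∈ W, ∃ p ∈ eigenIn A s W, ∃ q ∈ eigenIn A (-s) W,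
      w = p + q := by
    intro s hs w hw
    refine ⟨(1 / 2 : ℝ) • (w + s • A w), ?_, (1 / 2 : ℝ) • (w - s • A w), ?_, by module⟩
    · refine mem_eigenIn.2 ⟨W.smul_mem _ (W.add_mem hw (W.smul_mem _ (hW w hw))), ?_⟩
      simp only [map_smul, map_add, hA]
      match_scalars <;> first | ring1 | linear_combination (1 / 2 : ℝ) * (-hs)
    · refine mem_eigenIn.2 ⟨W.smul_mem _ (W.sub_mem hw (W.smul_mem _ (hW w hw))), ?_⟩
      simp only [map_smul, map_sub, hA]
      match_scalars <;> first | ring1 | linear_combination (1 / 2 : ℝ) * (-hs)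
  have hle : ∀ s : ℝ, s * s = 1 →
      Module.finrank ℝ (eigenIn A s W) ≤ Module.finrank ℝ (eigenIn A (-s) W) := by
    intro s hs
    refine finrank_le_of_pairing g _ _ fun u hu h ↦ hnd u (mem_eigenIn.1 hu).1 fun v hv ↦ ?_
    obtain ⟨p, hp, q, hq, rfl⟩ := hdec s hs v hv
    simp [hiso s hs u hu p hp, h q hq]
  have heq : Module.finrank ℝ (eigenIn A t W) = Module.finrank ℝ (eigenIn A (-t) W) :=
    le_antisymm (hle t ht) (by
      have := hle (-t) (by linarith)
      rwa [neg_neg] at this)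
  have hsup : eigenIn A t W ⊔ eigenIn A (-t) W = W := by
    apply le_antisymm
    · exact sup_le inf_le_left inf_le_left
    · intro w hw
      obtain ⟨p, hp, q, hq, rfl⟩ := hdec t ht w hw
      exact Submodule.add_mem_sup hp hq
  have hinf : eigenIn A t W ⊓ eigenIn A (-t) W = ⊥ := by
    rw [eq_bot_iff]
    intro w hw
    have h1 := (mem_eigenIn.1 hw.1).2
    have h2 := (mem_eigenIn.1 hw.2).2
    rw [h1] at h2
    have h3 : (t * t) • w = 0 := by
      have : (2 : ℝ) • t • w = 0 := by
        calc (2 : ℝ) • t • w = t • w - (-t) • w := by module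
          _ = 0 := by rw [← h2]; simp
      rw [mul_smul, (smul_eq_zero.1 this).resolve_left (by norm_num), smul_zero]
    rw [ht, one_smul] at h3
    exact h3
  have := Submodule.finrank_sup_add_finrank_inf_eq (eigenIn A t W) (eigenIn A (-t) W)
  rw [hsup, hinf, finrank_bot] at this
  omega

/-- Nondegenerate invariant subspaces have dimension divisible by `4`. -/
lemma four_dvd_finrank (g : V →ₗ[ℝ] V →ₗ[ℝ] ℝ) (hsymm : ∀ u v, g u v = g v u)
    {I J K : V →ₗ[ℝ] V} (h : IsStandardTriple I J K)
    (hI : ∀ u v, g (I u) v = -g u (I v)) (hJ : ∀ u v, g (J u) v = -g u (J v))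
    (W : Submodule ℝ V) (hWI : ∀ w ∈ W, I w ∈ W) (hWJ : ∀ w ∈ W, J w ∈ W)
    (hnd : IsNondegenerateOn (fun u v ↦ g u v) W) : 4 ∣ Module.finrank ℝ W := by
  have h2 := finrank_eq_two_mul_eigenIn g J h.sq_J hJ W hWJ hnd (t := 1) (by norm_num)
  have h3 : Even (Module.finrank ℝ (eigenIn J 1 W)) := by
    let P := eigenIn J 1 W
    -- The map `I` anticommutes with `J`, so it exchanges the eigenspaces of `J`, which are dual
    -- under `g`; hence `g(u, I v)` is non-degenerate on `P`. It is alternating because `I` is skew.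
    -- Thus `P`, of half the dimension of `W`, is even dimensional.
    let s : P →ₗ[ℝ] P →ₗ[ℝ] ℝ :=
      (LinearMap.lcomp ℝ ℝ (I ∘ₗ P.subtype)) ∘ₗ g ∘ₗ P.subtype
    have hs : ∀ u v : P, s u v = g u (I v) := fun u v ↦ rfl
    refine even_finrank_of_alternating s (fun u v ↦ ?_) (fun u hu ↦ ?_)
    · rw [hs, hs, hsymm, hI]
    · apply Subtype.ext
      have hu' := mem_eigenIn.1 u.2
      refine hnd u hu'.1 fun v hv ↦ ?_
      have key : ∀ w ∈ W, g u (I (w + J w)) = 0 := fun w hw ↦ by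
        have hm : w + J w ∈ P := mem_eigenIn.2 ⟨W.add_mem hw (hWJ w hw), by
          simp [h.sq_J, add_comm]⟩
        exact hu ⟨_, hm⟩
      have h4 := key _ (hWI _ hv)
      have h5 : g u (J v) = -g u v := by
        have := hJ u v
        rw [hu'.2, one_smul] at this
        linarith
      simp only [map_add, h.sq_I, h.J_I, map_neg] at h4
      rw [h5] at h4
      simp only
      linarith
  obtain ⟨m, hm⟩ := h3
  exact ⟨m, by rw [h2, hm]; ring⟩

end Dimension

/-! ### Pointwise algebra of the Nijenhuis tensor -/

section NijenhuisAlgebra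

variable {V : Type*} [AddCommGroup V] [Module ℝ V]

lemma maximalInvariant_le (Q : Set (V → V)) (T : Submodule ℝ V) : maximalInvariant Q T ≤ T :=
  sSup_le fun _ hW ↦ hW.1

lemma le_maximalInvariant {Q : Set (V → V)} {T W : Submodule ℝ V} (hWT : W ≤ T)
    (hW : IsInvariantUnder Q W) : W ≤ maximalInvariant Q T :=
  le_sSup ⟨hWT, hW⟩

lemma map_mem_maximalInvariant {Q : Set (V → V)} {T : Submodule ℝ V} (A : V →ₗ[ℝ] V)
    (hA : (A : V → V) ∈ Q) {w : V} (hw : w ∈ maximalInvariant Q T) :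
    A w ∈ maximalInvariant Q T := by
  have : maximalInvariant Q T ≤ (maximalInvariant Q T).comap A :=
    sSup_le fun W hW x hx ↦ (le_sSup hW : W ≤ maximalInvariant Q T) (hW.2 _ hA x hx)
  exact this hw

variable [FiniteDimensional ℝ V]

/-- An almost `ε`-Hermitian subspace of dimension divisible by four on which the algebraic
expression of the Nijenhuis tensor is nonzero and tangential is para-quaternionic. -/
theorem invariant_of_nijenhuis_ne_zero (g : V →ₗ[ℝ] V →ₗ[ℝ] ℝ) (hsymm : ∀ u v, g u v = g v u)
    {I J K : V →ₗ[ℝ] V} (h : IsStandardTriple I J K)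
    (hskew : ∀ A : V →ₗ[ℝ] V, IsComb I J K A → ∀ u v, g (A u) v = -g u (A v))
    {J₀ : V →ₗ[ℝ] V} (hJ₀ : IsComb I J K J₀) {ε : ℝ} (hε : ε = 1 ∨ ε = -1)
    (hsq : ∀ v, J₀ (J₀ v) = ε • v) (T : Submodule ℝ V) (hT : ∀ w ∈ T, J₀ w ∈ T)
    (hTnd : IsNondegenerateOn (fun u v ↦ g u v) T) (h4 : 4 ∣ Module.finrank ℝ T)
    (hTbar : IsNondegenerateOn (fun u v ↦ g u v) (maximalInvariant {B | IsComb I J K B} T))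
    (B : V → V → V) (hBadd : ∀ u v w, B (u + v) w = B u w + B v w)
    (hBsmul : ∀ (c : ℝ) u w, B (c • u) w = c • B u w)
    (hB : ∀ v ∈ T, IsComb I J K (B v)) (hBanti : ∀ v ∈ T, ∀ w, B v (J₀ w) = -J₀ (B v w))
    (hN : ∀ X ∈ T, ∀ Y ∈ T, (B (J₀ X) Y - J₀ (B X Y)) - (B (J₀ Y) X - J₀ (B Y X)) ∈ T)
    (hne : ∃ X ∈ T, ∃ Y ∈ T, (B (J₀ X) Y - J₀ (B X Y)) - (B (J₀ Y) X - J₀ (B Y X)) ≠ 0) :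
    ∀ A : V → V, IsComb I J K A → ∀ w ∈ T, A w ∈ T := by
  have hnt : Nontrivial V := by
    obtain ⟨X, -, Y, -, hXY⟩ := hne
    exact ⟨_, _, hXY⟩
  obtain ⟨J₂, l, hJ₂, hl, hJ₂sq, hanti, hspan⟩ := h.exists_adapted hJ₀ hε hsq
  set Tb := maximalInvariant {B | IsComb I J K B} T with hTb
  have hTbT : Tb ≤ T := maximalInvariant_le _ _
  have hTbQ : ∀ A : V →ₗ[ℝ] V, IsComb I J K A → ∀ w ∈ Tb, A w ∈ Tb := fun A hA w hw ↦
    map_mem_maximalInvariant A hA hw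
  have hTbI := hTbQ I ⟨1, 0, 0, by simp⟩
  have hTbJ := hTbQ J ⟨0, 1, 0, by simp⟩
  have hTbK := hTbQ K ⟨0, 0, 1, by simp⟩
  -- The space `T ⊓ J₂⁻¹ T` is stable under `J₂` and `J₀`, hence under all combinations of `J₀`,
  -- `J₂`, `J₀ J₂`, which exhaust `Q`.
  have hTbmem : ∀ w ∈ T, J₂ w ∈ T → w ∈ Tb := by
    intro w hw hw2
    refine le_maximalInvariant (W := T ⊓ T.comap J₂) inf_le_left ?_ ⟨hw, hw2⟩
    have hinv2 : ∀ w ∈ T ⊓ T.comap J₂, J₂ w ∈ T ⊓ T.comap J₂ := fun w hw ↦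
      ⟨hw.2, by
        change J₂ (J₂ w) ∈ T
        rw [hJ₂sq]
        exact T.smul_mem _ hw.1⟩
    have hinv0 : ∀ w ∈ T ⊓ T.comap J₂, J₀ w ∈ T ⊓ T.comap J₂ := fun w hw ↦
      ⟨hT _ hw.1, by
        change J₂ (J₀ w) ∈ T
        rw [hanti]
        exact T.neg_mem (hT _ hw.2)⟩
    intro A hA w hw
    obtain ⟨a, b, c, habc⟩ := hspan A hA
    rw [habc]
    exact add_mem (add_mem (Submodule.smul_mem _ _ (hinv0 w hw))
      (Submodule.smul_mem _ _ (hinv2 w hw))) (Submodule.smul_mem _ _ (hinv0 _ (hinv2 w hw)))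
  have h4b : 4 ∣ Module.finrank ℝ Tb :=
    four_dvd_finrank g hsymm h (hskew I ⟨1, 0, 0, by simp⟩) (hskew J ⟨0, 1, 0, by simp⟩) Tb hTbI
      hTbJ hTbar
  -- Both dimensions are multiples of 4, so a gap smaller than 4 is no gap.
  suffices hfin : Module.finrank ℝ T < Module.finrank ℝ Tb + 4 by
    have hle := Submodule.finrank_mono hTbT
    have heq : Tb = T := Submodule.eq_of_le_of_finrank_le hTbT (by omega)
    rintro A ⟨a, b, c, habc⟩ w hw
    rw [habc]
    rw [← heq] at hw ⊢
    exact add_mem (add_mem (Tb.smul_mem _ (hTbI w hw)) (Tb.smul_mem _ (hTbJ w hw)))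
      (Tb.smul_mem _ (hTbK w hw))
  set C : V → V → V := fun X Y ↦ B (J₀ X) Y - J₀ (B X Y) with hCdef
  obtain ⟨v₁, hv₁⟩ := exists_ne (0 : V)
  have hJ₂inj : ∀ w, J₂ w = 0 → w = 0 := fun w hw ↦ by
    have := hJ₂sq w
    rw [hw, map_zero] at this
    exact (smul_eq_zero.1 this.symm).resolve_left hl.ne'
  -- Anticommuting with `J₀` kills the `J₀`-component, because `J₀² = ε ≠ 0`.
  have hB2 : ∀ v ∈ T, ∃ p q : ℝ, ∀ w, B v w = p • J₂ w + q • J₀ (J₂ w) := by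
    intro v hv
    obtain ⟨a, p, q, habc⟩ := hspan _ (hB v hv)
    have ha : a = 0 := by
      have h1 := hBanti v hv v₁
      simp only [habc, LinearMap.comp_apply, hsq, hanti, map_add, map_smul, map_neg] at h1
      have h2 : (2 * a * ε) • v₁ = 0 := by
        rw [eq_comm, ← sub_eq_zero] at h1
        rw [← neg_eq_zero, ← h1]; module
      have h3 := (smul_eq_zero.1 h2).resolve_right hv₁
      rcases hε with rfl | rfl <;> linarith
    exact ⟨p, q, fun w ↦ by rw [habc, ha]; simp⟩
  have hC : ∀ v ∈ T, ∃ p q : ℝ, ∀ w, C v w = p • J₂ w + q • J₀ (J₂ w) := by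
    intro v hv
    obtain ⟨p, q, hpq⟩ := hB2 v hv
    obtain ⟨p', q', hpq'⟩ := hB2 _ (hT v hv)
    refine ⟨p' - ε * q, q' - p, fun w ↦ ?_⟩
    simp only [hCdef, hpq, hpq', map_add, map_smul, hsq]
    module
  have hCne : ∃ X ∈ T, ∃ w, C X w ≠ 0 := by
    by_contra! hcon
    obtain ⟨X, hX, Y, hY, hXY⟩ := hne
    apply hXY
    change C X Y - C Y X = 0
    rw [hcon X hX, hcon Y hY, sub_zero]
  -- Pulling `J₂` to the left of `C X Y - C Y X` exhibits this tangential vector as `J₂` of a vector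
  -- of `T`, so `hTbmem` applies.
  have key : ∀ X ∈ T, ∀ Y ∈ T, ∀ p q p' q' : ℝ, (∀ w, C X w = p • J₂ w + q • J₀ (J₂ w)) →
      (∀ w, C Y w = p' • J₂ w + q' • J₀ (J₂ w)) →
      p • Y - q • J₀ Y - p' • X + q' • J₀ X ∈ Tb := by
    intro X hX Y hY p q p' q' hXC hYC
    refine hTbmem _ ?_ ?_
    · exact add_mem (sub_mem (sub_mem (T.smul_mem _ hY) (T.smul_mem _ (hT Y hY)))
        (T.smul_mem _ hX)) (T.smul_mem _ (hT X hX))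
    · have h1 : C X Y - C Y X ∈ T := hN X hX Y hY
      rw [hXC, hYC] at h1
      convert h1 using 1
      simp only [map_add, map_sub, map_smul, hanti]
      module
  rcases hε with rfl | rfl
  -- For `ε = 1` the form `p² - q²` can vanish, so `Y` cannot be isolated directly. The tangent
  -- space is split into eigenspaces of `J₀` instead, on one of which `C` is nonzero.
  · have hCadd : ∀ u v w, C (u + v) w = C u w + C v w := fun u v w ↦ by
      simp only [hCdef, map_add, hBadd]; abel
    have hCsmul : ∀ (c : ℝ) u w, C (c • u) w = c • C u w := fun c u w ↦ by
      simp only [hCdef, map_smul, hBsmul]; module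
    have hCJ : ∀ X w, C (J₀ X) w = -J₀ (C X w) := fun X w ↦ by
      simp only [hCdef, hsq, one_smul, map_sub]; abel
    obtain ⟨t, ht, X, hX, w₀, hXw⟩ : ∃ t : ℝ, t * t = 1 ∧ ∃ X ∈ eigenIn J₀ t T, ∃ w, C X w ≠ 0 := by
      by_contra! hcon
      obtain ⟨X, hX, w, hw⟩ := hCne
      apply hw
      have h1 := hcon 1 (by norm_num) (X + J₀ X) (mem_eigenIn.2 ⟨add_mem hX (hT X hX), by
        rw [map_add, hsq]; module⟩) w
      have h2 := hcon (-1) (by norm_num) (X - J₀ X) (mem_eigenIn.2 ⟨sub_mem hX (hT X hX), by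
        rw [map_sub, hsq]; module⟩) w
      have h3 : X = (1 / 2 : ℝ) • ((X + J₀ X) + (X - J₀ X)) := by module
      rw [h3, hCsmul, hCadd, h1, h2]; simp
    have hJ₀ne : ∃ w, J₂ w + t • J₀ (J₂ w) ≠ 0 := by
      by_contra! hcon
      have hall : ∀ w, J₀ w = -(t • w) := fun w ↦ by
        have h1 := hcon (J₂ w)
        rw [hJ₂sq, map_smul, smul_comm, ← smul_add] at h1
        have h2 := (smul_eq_zero.1 h1).resolve_left hl.ne'
        have h3 : t • (w + t • J₀ w) = 0 := by rw [h2, smul_zero]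
        rw [smul_add, smul_smul, ht, one_smul] at h3
        rw [← sub_eq_zero, sub_neg_eq_add, add_comm]; exact h3
      have h1 := hanti v₁
      rw [hall, hall, map_neg, map_smul] at h1
      have h2 : (2 * t) • J₂ v₁ = 0 := by
        rw [← sub_eq_zero] at h1
        rw [← neg_eq_zero, ← h1]; module
      have h3 : t ≠ 0 := by rintro rfl; norm_num at ht
      exact hv₁ (hJ₂inj _ ((smul_eq_zero.1 h2).resolve_left (by simpa using h3)))
    -- On this eigenspace `C (J₀ Y) = -J₀ (C Y)` reads `t C Y = -J₀ (C Y)`, which ties `q` to `p`; a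
    -- single scalar parameter then costs only one dimension.
    have hCt : ∀ Y ∈ eigenIn J₀ t T, ∃ p : ℝ, ∀ w, C Y w = p • J₂ w + (-(t * p)) • J₀ (J₂ w) := by
      intro Y hY
      rw [mem_eigenIn] at hY
      obtain ⟨p, q, hpq⟩ := hC Y hY.1
      obtain ⟨w, hw⟩ := hJ₀ne
      have h1 := hCJ Y w
      rw [hY.2, hCsmul, hpq, map_add, map_smul, map_smul, hsq] at h1
      have h2 : (t * p + q) • (J₂ w + t • J₀ (J₂ w)) = 0 := by
        rw [← sub_eq_zero] at h1
        rw [← h1]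
        match_scalars
        · ring
        · linear_combination p * ht
      have h3 := (smul_eq_zero.1 h2).resolve_right hw
      exact ⟨p, fun w ↦ by rw [hpq, show q = -(t * p) by linarith]⟩
    obtain ⟨p, hp⟩ := hCt X hX
    have hpne : p ≠ 0 := by
      rintro rfl
      apply hXw
      simp [hp]
    have hle : eigenIn J₀ t T ≤ eigenIn J₀ t Tb ⊔ Submodule.span ℝ {X} := by
      intro Y hY
      obtain ⟨p', hp'⟩ := hCt Y hY
      have hX' := mem_eigenIn.1 hX
      have hY' := mem_eigenIn.1 hY
      have hm := key X hX'.1 Y hY'.1 _ _ _ _ hp hp'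
      rw [hX'.2, hY'.2] at hm
      have hm2 : (2 * p) • Y - (2 * p') • X ∈ Tb := by
        convert hm using 1
        match_scalars
        · linear_combination (-p) * ht
        · linear_combination p' * ht
      have hm3 : Y - (p' / p) • X ∈ Tb := by
        have := Tb.smul_mem (1 / (2 * p)) hm2
        convert this using 1
        match_scalars <;> field_simp
      have : Y = (Y - (p' / p) • X) + (p' / p) • X := by abel
      rw [this]
      refine Submodule.add_mem_sup (mem_eigenIn.2 ⟨hm3, ?_⟩)
        (Submodule.smul_mem _ _ (Submodule.mem_span_singleton_self X))
      rw [map_sub, map_smul, hX'.2, hY'.2]; module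
    have hle1 := (Submodule.finrank_mono hle).trans (Submodule.finrank_add_le_finrank_add_finrank _ _)
    have hle2 : Module.finrank ℝ (Submodule.span ℝ {X}) ≤ 1 :=
      (finrank_span_le_card (R := ℝ) ({X} : Set V)).trans (by simp)
    -- Eigenspaces have half the dimension, so a defect of at most 1 there is a defect of at most 2
    -- in `T`.
    have h5 := finrank_eq_two_mul_eigenIn g J₀ (by simpa using hsq) (hskew J₀ hJ₀) T hT hTnd ht
    have h6 := finrank_eq_two_mul_eigenIn g J₀ (by simpa using hsq) (hskew J₀ hJ₀) Tb
      (hTbQ J₀ hJ₀) hTbar ht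
    omega
  · obtain ⟨X, hX, w₀, hXw⟩ := hCne
    obtain ⟨p, q, hp⟩ := hC X hX
    have hpq : p ^ 2 + q ^ 2 ≠ 0 := by
      intro h0
      have h1 : p = 0 := by nlinarith [sq_nonneg p, sq_nonneg q]
      have h2 : q = 0 := by nlinarith [sq_nonneg p, sq_nonneg q]
      apply hXw
      simp [hp, h1, h2]
    have hle : T ≤ Tb ⊔ Submodule.span ℝ {X, J₀ X} := by
      intro Y hY
      obtain ⟨p', q', hp'⟩ := hC Y hY
      have hm := key X hX Y hY _ _ _ _ hp hp'
      -- With `J₀² = -1` one has `(p + q J₀)(p - q J₀) = p² + q²`, so applying `p + q J₀` to the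
      -- relation `hm` isolates `Y` modulo `X` and `J₀ X`.
      have hm2 := Tb.smul_mem (1 / (p ^ 2 + q ^ 2))
        (Tb.add_mem (Tb.smul_mem p hm) (Tb.smul_mem q (hTbQ J₀ hJ₀ _ hm)))
      have hY2 : Y = (1 / (p ^ 2 + q ^ 2)) • (p • (p • Y - q • J₀ Y - p' • X + q' • J₀ X)
          + q • J₀ (p • Y - q • J₀ Y - p' • X + q' • J₀ X))
          + (((p * p' + q * q') / (p ^ 2 + q ^ 2)) • X
            + ((q * p' - p * q') / (p ^ 2 + q ^ 2)) • J₀ X) := by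
        simp only [map_add, map_sub, map_smul, hsq]
        match_scalars <;> field_simp <;> ring
      rw [hY2]
      exact Submodule.add_mem_sup hm2 (add_mem
        (Submodule.smul_mem _ _ (Submodule.subset_span (by simp)))
        (Submodule.smul_mem _ _ (Submodule.subset_span (by simp))))
    have hle1 := (Submodule.finrank_mono hle).trans (Submodule.finrank_add_le_finrank_add_finrank _ _)
    have hle2 : Module.finrank ℝ (Submodule.span ℝ {X, J₀ X}) ≤ 2 := by
      classical
      have := finrank_span_finset_le_card (R := ℝ) ({X, J₀ X} : Finset V)
      simp only [Finset.coe_insert, Finset.coe_singleton] at this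
      exact this.trans Finset.card_le_two
    omega

end NijenhuisAlgebra

/-! ### Algebraic curvature tensors whose operators normalize `Q` -/

section CurvatureAlgebra

variable {V : Type*} [AddCommGroup V] [Module ℝ V]

lemma IsComb.map {I J K : V →ₗ[ℝ] V} {B : V → V} (hB : IsComb I J K B) :
    ∃ A : V →ₗ[ℝ] V, B = A := by
  obtain ⟨a, b, c, h⟩ := hB
  exact ⟨a • I + b • J + c • K, funext fun v ↦ by simp [h]⟩

lemma isComb_I (I J K : V →ₗ[ℝ] V) : IsComb I J K I := ⟨1, 0, 0, by simp⟩
lemma isComb_J (I J K : V →ₗ[ℝ] V) : IsComb I J K J := ⟨0, 1, 0, by simp⟩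
lemma isComb_K (I J K : V →ₗ[ℝ] V) : IsComb I J K K := ⟨0, 0, 1, by simp⟩

lemma IsStandardTriple.comb_sq {I J K : V →ₗ[ℝ] V} (h : IsStandardTriple I J K) {A : V → V}
    (hA : IsComb I J K A) : ∃ s : ℝ, ∀ v, A (A v) = s • v := by
  obtain ⟨a, b, c, habc⟩ := hA
  refine ⟨-a ^ 2 + b ^ 2 + c ^ 2, fun v ↦ ?_⟩
  simp only [habc, map_add, map_smul, h.sq_I, h.sq_J, h.sq_K, h.J_I, h.I_K, h.J_K, h.K_I, h.K_J,
      ← h.mul_eq]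
  module

/-- The usual sum of four Bianchi identities. No linearity is assumed, so that it also applies to
vector fields before the curvature is known to be a tensor. -/
lemma pair_symm_of_symmetries {S : Type*} {ρ : S → S → S → S → ℝ}
    (b : ∀ x y z w, ρ x y z w + ρ y z x w + ρ z x y w = 0)
    (a : ∀ x y z w, ρ x y z w = -ρ y x z w) (s : ∀ x y z w, ρ x y z w = -ρ x y w z)
    (x y z w : S) : ρ x y z w = ρ z w x y := by
  have b1 := b x y z w
  have b2 := b y z w x
  have b3 := b z w x y
  have b4 := b w x y z
  linarith [s x y z w, s y z x w, s z x y w, s z w x y, s w y z x, s y z w x, s w x y z, s x z w y,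
    s x y w z, s y w x z, s w x z y, a x y z w, a z w x y, a y z x w, a z x y w, a w y z x,
    a w x z y, a x z w y, a y w x z, a x z y w, a z x w y]

lemma IsAlgebraicCurvature.pair_symm {g : V →ₗ[ℝ] V →ₗ[ℝ] ℝ} (hsymm : ∀ u v, g u v = g v u)
    {R : V →ₗ[ℝ] V →ₗ[ℝ] V →ₗ[ℝ] V} (hR : IsAlgebraicCurvature (fun u v ↦ g u v) R)
    (x y z w : V) : g (R x y z) w = g (R z w x) y := by
  refine pair_symm_of_symmetries (ρ := fun x y z w ↦ g (R x y z) w) (fun x y z w ↦ ?_)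
    (fun x y z w ↦ ?_) (fun x y z w ↦ ?_) x y z w
  · rw [← LinearMap.add_apply, ← LinearMap.add_apply, ← map_add, ← map_add, hR.bianchi]; simp
  · rw [hR.antisymm x y z]; simp
  · rw [hsymm (R x y w) z]; exact hR.skew x y z w

/-- `Z` is orthogonal to the para-quaternionic line through `X`. -/
def LineOrthogonal (g : V →ₗ[ℝ] V →ₗ[ℝ] ℝ) (I J K : V →ₗ[ℝ] V) (X Z : V) : Prop :=
  g X Z = 0 ∧ g (I X) Z = 0 ∧ g (J X) Z = 0 ∧ g (K X) Z = 0

lemma LineOrthogonal.comb {g : V →ₗ[ℝ] V →ₗ[ℝ] ℝ} {I J K : V →ₗ[ℝ] V} {X Z : V}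
    (h : LineOrthogonal g I J K X Z) {B : V → V} (hB : IsComb I J K B) : g (B X) Z = 0 := by
  obtain ⟨a, b, c, habc⟩ := hB
  simp [habc, h.2.1, h.2.2.1, h.2.2.2]

/-- A scalar product with a standard triple of skew-symmetric endomorphisms. -/
structure IsHermitianTriple (g : V →ₗ[ℝ] V →ₗ[ℝ] ℝ) (I J K : V →ₗ[ℝ] V) : Prop
    extends IsStandardTriple I J K where
  symm : ∀ u v, g u v = g v u
  nondeg : ∀ u, (∀ v, g u v = 0) → u = 0
  skew : ∀ B : V → V, IsComb I J K B → ∀ u v, g (B u) v = -g u (B v)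

namespace IsHermitianTriple

variable {g : V →ₗ[ℝ] V →ₗ[ℝ] ℝ} {I J K : V →ₗ[ℝ] V} (h : IsHermitianTriple g I J K)
include h

lemma comb_self {B : V → V} (hB : IsComb I J K B) (u : V) : g (B u) u = 0 := by
  have := h.skew B hB u u
  rw [h.symm u] at this
  linarith

lemma skew_I (u v : V) : g (I u) v = -g u (I v) := h.skew I (isComb_I I J K) u v
lemma skew_J (u v : V) : g (J u) v = -g u (J v) := h.skew J (isComb_J I J K) u v
lemma skew_K (u v : V) : g (K u) v = -g u (K v) := h.skew K (isComb_K I J K) u v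

lemma lineOrthogonal_map {X Z : V} (hZ : LineOrthogonal g I J K X Z) {B : V → V}
    (hB : IsComb I J K B) : LineOrthogonal g I J K X (B Z) := by
  obtain ⟨h1, h2, h3, h4⟩ := hZ
  obtain ⟨a, b, c, habc⟩ := hB
  have e1 : g X (I Z) = 0 := by have := h.skew_I X Z; linarith
  have e2 : g X (J Z) = 0 := by have := h.skew_J X Z; linarith
  have e3 : g X (K Z) = 0 := by have := h.skew_K X Z; linarith
  refine ⟨?_, ?_, ?_, ?_⟩ <;>
  simp only [habc, map_add, map_smul, h.skew_I, h.skew_J, h.skew_K, h.sq_I, h.sq_J, h.sq_K,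
    h.I_K, h.J_K, h.K_I, h.K_J, h.J_I, ← h.mul_eq, map_neg, h1, e1, e2, e3] <;> simp

/-- For non-null `X` the vectors `X, I X, J X, K X` are orthogonal with squares `q, q, -q, -q`,
where `q = g X X`; this is where the signs in the projection come from. -/
lemma lineOrthogonal_of_forall {X v : V} (hX : g X X ≠ 0) :
    ∃ p : V, p ∈ Submodule.span ℝ {X, I X, J X, K X} ∧ LineOrthogonal g I J K X (v - p) := by
  refine ⟨(g X v / g X X) • X + (g (I X) v / g X X) • I X - (g (J X) v / g X X) • J X
    - (g (K X) v / g X X) • K X, ?_, ?_⟩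
  · refine sub_mem (sub_mem (add_mem ?_ ?_) ?_) ?_ <;>
    exact Submodule.smul_mem _ _ (Submodule.subset_span (by simp))
  · have eI : g (I X) X = 0 := h.comb_self (isComb_I I J K) X
    have eJ : g (J X) X = 0 := h.comb_self (isComb_J I J K) X
    have eK : g (K X) X = 0 := h.comb_self (isComb_K I J K) X
    have eI' : g X (I X) = 0 := by rw [h.symm]; exact eI
    have eJ' : g X (J X) = 0 := by rw [h.symm]; exact eJ
    have eK' : g X (K X) = 0 := by rw [h.symm]; exact eK
    refine ⟨?_, ?_, ?_, ?_⟩ <;>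
    simp only [map_add, map_sub, map_smul, h.skew_I X, h.skew_J X, h.skew_K X, h.sq_I, h.sq_J,
      h.sq_K, h.I_K, h.J_K, h.K_I, h.K_J, h.J_I, ← h.mul_eq, map_neg, eI', eJ', eK', smul_eq_mul] <;>
    field_simp <;> ring

lemma eq_zero_of_orthogonal {X Y : V} (hX : g X X ≠ 0) (hY : LineOrthogonal g I J K X Y)
    (hYZ : ∀ Z, LineOrthogonal g I J K X Z → g Y Z = 0) : Y = 0 := by
  refine h.nondeg Y fun v ↦ ?_
  obtain ⟨p, hp, hv⟩ := h.lineOrthogonal_of_forall (v := v) hX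
  have hp0 : g Y p = 0 := by
    have : Submodule.span ℝ {X, I X, J X, K X} ≤ LinearMap.ker (g Y) := by
      rw [Submodule.span_le]
      rintro w (rfl | rfl | rfl | rfl) <;> simp only [SetLike.mem_coe, LinearMap.mem_ker]
      · rw [h.symm]; exact hY.1
      · rw [h.symm]; exact hY.2.1
      · rw [h.symm]; exact hY.2.2.1
      · rw [h.symm]; exact hY.2.2.2
    exact this hp
  have := hYZ _ hv
  rw [map_sub, hp0] at this
  linarith

/-- If the orthogonal complement of the line were totally null it would vanish by non-degeneracy,
and the line, of dimension at most 4, would be everything. -/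
lemma exists_nonnull_lineOrthogonal [FiniteDimensional ℝ V] (hd : 4 < Module.finrank ℝ V) {X : V}
    (hX : g X X ≠ 0) : ∃ Z, LineOrthogonal g I J K X Z ∧ g Z Z ≠ 0 := by
  by_contra! hcon
  have hadd : ∀ Z Z', LineOrthogonal g I J K X Z → LineOrthogonal g I J K X Z' →
      LineOrthogonal g I J K X (Z + Z') := fun Z Z' hZ hZ' ↦
    ⟨by simp [hZ.1, hZ'.1], by simp [hZ.2.1, hZ'.2.1], by simp [hZ.2.2.1, hZ'.2.2.1],
      by simp [hZ.2.2.2, hZ'.2.2.2]⟩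
  have hzero : ∀ Z, LineOrthogonal g I J K X Z → Z = 0 := fun Z hZ ↦ by
    refine h.eq_zero_of_orthogonal hX hZ fun Z' hZ' ↦ ?_
    have h1 := hcon _ (hadd Z Z' hZ hZ')
    simp only [map_add, LinearMap.add_apply, hcon Z hZ, hcon Z' hZ', h.symm Z' Z] at h1
    linarith
  have htop : (⊤ : Submodule ℝ V) ≤ Submodule.span ℝ {X, I X, J X, K X} := fun v _ ↦ by
    obtain ⟨p, hp, hv⟩ := h.lineOrthogonal_of_forall (v := v) hX
    rwa [sub_eq_zero.1 (hzero _ hv)]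
  have h1 := Submodule.finrank_mono htop
  classical
  have h2 := finrank_span_le_card (R := ℝ) ({X, I X, J X, K X} : Set V)
  have h3 : ({X, I X, J X, K X} : Set V).toFinset.card ≤ 4 := by
    simpa using Finset.card_le_four (a := X) (b := I X) (c := J X) (d := K X)
  rw [finrank_top] at h1
  omega

lemma exists_nonnull [Nontrivial V] : ∃ Z, g Z Z ≠ 0 := by
  by_contra! hcon
  obtain ⟨v, hv⟩ := exists_ne (0 : V)
  refine hv (h.nondeg v fun w ↦ ?_)
  have h1 := hcon (v + w)
  simp only [map_add, LinearMap.add_apply, hcon v, hcon w, h.symm w v] at h1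
  linarith

/-- Pairing `B Z` with `I Z`, `J Z`, `K Z` reads off the coefficients up to the factor `± g Z Z`.
Elements of `Q` can have null vectors in their kernel, hence the condition on `Z`. -/
lemma comb_eq_zero {B : V → V} (hB : IsComb I J K B) {Z : V} (hZ : g Z Z ≠ 0) (h0 : B Z = 0)
    (v : V) : B v = 0 := by
  obtain ⟨a, b, c, habc⟩ := hB
  have e1 : g Z (I Z) = 0 := by rw [h.symm]; exact h.comb_self (isComb_I I J K) Z
  have e2 : g Z (J Z) = 0 := by rw [h.symm]; exact h.comb_self (isComb_J I J K) Z
  have e3 : g Z (K Z) = 0 := by rw [h.symm]; exact h.comb_self (isComb_K I J K) Z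
  rw [habc] at h0
  have k : ∀ w, g (a • I Z + b • J Z + c • K Z) w = 0 := fun w ↦ by rw [h0]; simp
  have k1 := k (I Z)
  have k2 := k (J Z)
  have k3 := k (K Z)
  simp only [map_add, map_smul, LinearMap.add_apply, LinearMap.smul_apply, smul_eq_mul, h.skew_I,
    h.skew_J, h.skew_K, h.sq_I, h.sq_J, h.sq_K, h.I_K, h.J_K, h.K_I, h.K_J, h.J_I, ← h.mul_eq,
    map_neg, e1, e2, e3] at k1 k2 k3
  have ha : a = 0 := by simpa [hZ] using k1
  have hb : b = 0 := by simpa [hZ] using k2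
  have hc : c = 0 := by simpa [hZ] using k3
  simp [habc, ha, hb, hc]

variable {R : V →ₗ[ℝ] V →ₗ[ℝ] V →ₗ[ℝ] V} (hR : IsAlgebraicCurvature (fun u v ↦ g u v) R)
  (hRQ : ∀ A : V →ₗ[ℝ] V, IsComb I J K A → ∀ X Y,
    IsComb I J K (fun Z ↦ R X Y (A Z) - A (R X Y Z)))
include hR hRQ

/-- The commutator of `A` with `R U Y` lies in `Q`, so it sends `X` to a vector orthogonal to `Z`;
pair symmetry moves this to the first two slots. -/
lemma curvature_swap {X Z : V} (hZ : LineOrthogonal g I J K X Z) {A : V →ₗ[ℝ] V}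
    (hA : IsComb I J K A) (U : V) : R (A X) Z U = -R X (A Z) U := by
  rw [eq_neg_iff_add_eq_zero]
  refine h.nondeg _ fun Y ↦ ?_
  have h1 := hZ.comb (hRQ A hA U Y)
  simp only [map_sub, LinearMap.sub_apply, h.skew A hA] at h1
  rw [map_add, LinearMap.add_apply, hR.pair_symm h.symm, hR.pair_symm h.symm X]
  linarith

/-- Bianchi's identity for `X, A X, Z`, with `curvature_swap` for the term `R (A X) Z` and the
commutator of `A` with `R X Z`, whose value on `X` is orthogonal to `Z'`. -/
lemma curvature_line {X Z Z' : V} (hZ : LineOrthogonal g I J K X Z)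
    (hZ' : LineOrthogonal g I J K X Z') {A : V →ₗ[ℝ] V} (hA : IsComb I J K A) :
    g (R X (A X) Z) Z' = g (R X (A Z) X) Z' + g (A (R X Z X)) Z' := by
  have h1 := hZ'.comb (hRQ A hA X Z)
  have h2 := congr(g $(hR.bianchi X (A X) Z) Z')
  rw [h.curvature_swap hR hRQ hZ hA, hR.antisymm Z X] at h2
  simp only [map_sub, map_add, map_neg, LinearMap.sub_apply, LinearMap.add_apply,
    LinearMap.neg_apply, map_zero, LinearMap.zero_apply] at h1 h2
  linarith

/-- The commutator is in `Q`, so it suffices that it kills one non-null vector `Z₀` orthogonal to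
the line of `X`; such a vector exists because the dimension exceeds 4. Tested against `Z'`
orthogonal to the line, both of its terms expand by `curvature_line` and `A² = s` to `s g(R(X, Z₀)
X, Z') + g(A R(X, A Z₀) X, Z')`, and cancel. -/
lemma curvature_commutes_of_nonnull [FiniteDimensional ℝ V] (hd : 4 < Module.finrank ℝ V) {X : V}
    (hX : g X X ≠ 0) {A : V →ₗ[ℝ] V} (hA : IsComb I J K A) (Z : V) :
    R X (A X) (A Z) - A (R X (A X) Z) = 0 := by
  obtain ⟨Z₀, hZ₀, hZ₀n⟩ := h.exists_nonnull_lineOrthogonal hd hX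
  refine h.comb_eq_zero (hRQ A hA X (A X)) hZ₀n ?_ Z
  refine h.eq_zero_of_orthogonal hX (h.lineOrthogonal_map hZ₀ (hRQ A hA X (A X))) fun Z' hZ' ↦ ?_
  obtain ⟨s, hs⟩ := h.comb_sq hA
  have h1 := h.curvature_line hR hRQ (h.lineOrthogonal_map hZ₀ hA) hZ' hA
  have h2 := h.curvature_line hR hRQ hZ₀ (h.lineOrthogonal_map hZ' hA) hA
  rw [map_sub, LinearMap.sub_apply, h1, h.skew A hA (R X (A X) Z₀), h2, hs,
    ← neg_eq_iff_eq_neg.2 (h.skew A hA (R X (A Z₀) X) Z'),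
    ← neg_eq_iff_eq_neg.2 (h.skew A hA (A (R X Z₀ X)) Z'), hs]
  simp only [map_smul, LinearMap.smul_apply]
  ring

/-- The expression is quadratic in `X` and vanishes at non-null vectors, which are found on a line
`X + t Y` through a null `X`. -/
lemma curvature_commutes [FiniteDimensional ℝ V] (hd : 4 < Module.finrank ℝ V) (X : V)
    {A : V →ₗ[ℝ] V} (hA : IsComb I J K A) (Z : V) :
    R X (A X) (A Z) = A (R X (A X) Z) := by
  have : Nontrivial V := Module.nontrivial_of_finrank_pos (R := ℝ) (by omega)
  rw [← sub_eq_zero]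
  by_cases hX : g X X = 0
  swap
  · exact h.curvature_commutes_of_nonnull hR hRQ hd hX hA Z
  obtain ⟨Y, hY⟩ := h.exists_nonnull
  set b := g X Y
  set c := g Y Y with hc
  have hnn : ∀ t : ℝ, t ≠ 0 → 2 * b + t * c ≠ 0 → g (X + t • Y) (X + t • Y) ≠ 0 := by
    intro t ht htb
    have : g (X + t • Y) (X + t • Y) = t * (2 * b + t * c) := by
      simp only [map_add, map_smul, LinearMap.add_apply, LinearMap.smul_apply, smul_eq_mul, hX,
        h.symm Y X]
      ring
    rw [this]
    exact mul_ne_zero ht htb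
  obtain ⟨t, ht, h1, h2⟩ : ∃ t : ℝ, t ≠ 0 ∧ 2 * b + t * c ≠ 0 ∧ 2 * b + (2 * t) * c ≠ 0 := by
    obtain ⟨d, hd⟩ : ∃ d, 2 * b = d * c := ⟨2 * b / c, by field_simp⟩
    have habs := neg_abs_le d
    have habs' := abs_nonneg d
    -- With `2b = d c` the two quantities are `(d + t) c` and `(d + 2t) c`, nonzero as soon as `t >
    -- |d|`.
    refine ⟨1 + |d|, by positivity, ?_, ?_⟩
    · rw [hd, ← add_mul]; exact mul_ne_zero (by linarith) hY
    · rw [hd, ← add_mul]; exact mul_ne_zero (by linarith) hY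
  have e0 := h.curvature_commutes_of_nonnull hR hRQ hd hY hA Z
  have e1 := h.curvature_commutes_of_nonnull hR hRQ hd (hnn t ht h1) hA Z
  have e2 := h.curvature_commutes_of_nonnull hR hRQ hd (hnn (2 * t) (by simpa using ht) h2) hA Z
  -- For a quadratic polynomial, `P(0) = 2 P(t) - P(2t) + 2 t² P₂`, where the leading coefficient
  -- `P₂` is the value at `Y`.
  have key : R X (A X) (A Z) - A (R X (A X) Z)
      = (2 : ℝ) • (R (X + t • Y) (A (X + t • Y)) (A Z) - A (R (X + t • Y) (A (X + t • Y)) Z))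
        - (R (X + (2 * t) • Y) (A (X + (2 * t) • Y)) (A Z)
            - A (R (X + (2 * t) • Y) (A (X + (2 * t) • Y)) Z))
        + (2 * t ^ 2) • (R Y (A Y) (A Z) - A (R Y (A Y) Z)) := by
    simp only [map_add, map_smul, LinearMap.add_apply, LinearMap.smul_apply]
    module
  rw [key, e0, e1, e2]; simp

end IsHermitianTriple

end CurvatureAlgebra

/-! ### The `Q`-components of the curvature -/

section CurvatureDecomposition

variable {V : Type*} [AddCommGroup V] [Module ℝ V]

section Trace

variable [FiniteDimensional ℝ V] {I J K : V →ₗ[ℝ] V}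
  (h : IsStandardTriple I J K) {B : V →ₗ[ℝ] V}
include h

/-- Conjugation by `J` preserves the trace and changes the sign of `I B`. The next two lemmas use
conjugation by `I` in the same way. -/
lemma IsStandardTriple.trace_I_comp (hJ : ∀ v, B (J v) = J (B v)) :
    LinearMap.trace ℝ V (I ∘ₗ B) = 0 := by
  have h1 : I ∘ₗ B = (I ∘ₗ B ∘ₗ J) ∘ₗ J := by ext v; simp [h.sq_J]
  have h2 : J ∘ₗ (I ∘ₗ B ∘ₗ J) = -(I ∘ₗ B) := by ext v; simp [h.J_I, hJ, h.sq_J]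
  have h3 := LinearMap.trace_comp_comm' (I ∘ₗ B ∘ₗ J) J
  rw [h2, ← h1, map_neg] at h3
  linarith

lemma IsStandardTriple.trace_J_comp (hI : ∀ v, B (I v) = I (B v)) :
    LinearMap.trace ℝ V (J ∘ₗ B) = 0 := by
  have h1 : J ∘ₗ B = -((J ∘ₗ B ∘ₗ I) ∘ₗ I) := by ext v; simp [h.sq_I]
  have h2 : I ∘ₗ (J ∘ₗ B ∘ₗ I) = J ∘ₗ B := by ext v; simp [h.anticomm, hI, h.sq_I]
  have h3 := LinearMap.trace_comp_comm' (J ∘ₗ B ∘ₗ I) I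
  rw [h2, eq_neg_iff_add_eq_zero.1 h1 |> eq_neg_of_add_eq_zero_right, map_neg] at h3
  linarith

lemma IsStandardTriple.trace_K_comp (hI : ∀ v, B (I v) = I (B v)) :
    LinearMap.trace ℝ V (K ∘ₗ B) = 0 := by
  have h1 : K ∘ₗ B = -((K ∘ₗ B ∘ₗ I) ∘ₗ I) := by ext v; simp [h.sq_I]
  have h2 : I ∘ₗ (K ∘ₗ B ∘ₗ I) = K ∘ₗ B := by
    ext v; simp [h.I_K, hI, h.J_I, ← h.mul_eq]
  have h3 := LinearMap.trace_comp_comm' (K ∘ₗ B ∘ₗ I) I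
  rw [h2, eq_neg_iff_add_eq_zero.1 h1 |> eq_neg_of_add_eq_zero_right, map_neg] at h3
  linarith

end Trace

namespace IsHermitianTriple

variable {g : V →ₗ[ℝ] V →ₗ[ℝ] ℝ} {I J K : V →ₗ[ℝ] V} (h : IsHermitianTriple g I J K)
include h

/-- The commutator with `E` is a derivation of the algebra generated by `Q`, and it acts on `Q`, a
copy of `so(1,2)`, as an inner derivation: it is bracketing with `x I + y J + z K`. -/
lemma exists_adjoint_component [Nontrivial V] (E : V →ₗ[ℝ] V)
    (hE : ∀ A : V →ₗ[ℝ] V, IsComb I J K A → IsComb I J K (fun v ↦ E (A v) - A (E v))) :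
    ∃ x y z : ℝ, (∀ v, E (I v) - I (E v) = (-2 * y) • K v + (2 * z) • J v) ∧
      ∀ v, E (J v) - J (E v) = (2 * x) • K v + (2 * z) • I v := by
  obtain ⟨a₁, b₁, c₁, h₁⟩ := hE I (isComb_I I J K)
  obtain ⟨a₂, b₂, c₂, h₂⟩ := hE J (isComb_J I J K)
  obtain ⟨a₃, b₃, c₃, h₃⟩ := hE K (isComb_K I J K)
  obtain ⟨v, hv⟩ := h.exists_nonnull
  have hv0 : v ≠ 0 := by rintro rfl; simp at hv
  -- Since `I²` is a scalar, the commutator of `E` with `I` anticommutes with `I`, hence has no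
  -- `I`-component; likewise for `J` below.
  have ha : a₁ = 0 := by
    have e1 := h₁ (I v)
    have e2 := congr(I $(h₁ v))
    simp only [map_add, map_sub, map_smul, h.sq_I, h.J_I, h.K_I, h.I_K, map_neg, ← h.mul_eq]
      at e1 e2
    have e3 : (2 * a₁) • v = 0 := by
      have := congr($e1 + $e2)
      rw [← neg_eq_zero]
      trans -E v - I (E (I v)) + (I (E (I v)) - -E v)
      · rw [this]; module
      · abel
    have := (smul_eq_zero.1 e3).resolve_right hv0
    linarith
  have hb : b₂ = 0 := by
    have e1 := h₂ (J v)
    have e2 := congr(J $(h₂ v))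
    simp only [map_add, map_sub, map_smul, h.sq_J, h.J_I, h.K_J, h.J_K, ← h.mul_eq]
      at e1 e2
    have e3 : (2 * b₂) • v = 0 := by
      have := congr($e1 + $e2)
      trans E v - J (E (J v)) + (J (E (J v)) - E v)
      · rw [this]; module
      · abel
    have := (smul_eq_zero.1 e3).resolve_right hv0
    linarith
  subst ha hb
  -- The coefficient `b₁ - a₂` is the identity component of the commutator with `K = I J`, which
  -- must lie in `Q`; skewness of `Q` detects it on a non-null vector.
  have hab : b₁ = a₂ := by
    have e1 := h₁ (J v)
    have e2 := congr(I $(h₂ v))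
    have e3 := h₃ v
    simp only [map_add, map_sub, map_smul, h.sq_J, h.sq_I, h.K_J, h.I_K, ← h.mul_eq]
      at e1 e2 e3
    have e4 : (b₁ - a₂) • v = (a₃ - c₁) • I v + (b₃ + c₂) • J v + c₃ • K v := by
      have h5 : E (K v) - K (E v) = (E (K v) - I (E (J v))) + (I (E (J v)) - K (E v)) := by abel
      rw [e3, e1, e2] at h5
      rw [← sub_eq_zero] at h5 ⊢
      rw [← neg_eq_zero, ← h5]; module
    have e5 : g ((b₁ - a₂) • v) v = 0 := by
      rw [e4]
      exact h.comb_self (B := fun w ↦ (a₃ - c₁) • I w + (b₃ + c₂) • J w + c₃ • K w)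
        ⟨_, _, _, fun _ ↦ rfl⟩ v
    simp only [map_smul, LinearMap.smul_apply, smul_eq_mul] at e5
    have := (mul_eq_zero.1 e5).resolve_right hv
    linarith
  refine ⟨c₂ / 2, -c₁ / 2, b₁ / 2, fun v ↦ ?_, fun v ↦ ?_⟩
  · refine (h₁ v).trans ?_
    module
  · refine (h₂ v).trans ?_
    rw [hab]; module

variable {R : V →ₗ[ℝ] V →ₗ[ℝ] V →ₗ[ℝ] V} (hR : IsAlgebraicCurvature (fun u v ↦ g u v) R)
  (hRQ : ∀ A : V →ₗ[ℝ] V, IsComb I J K A → ∀ X Y,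
    IsComb I J K (fun Z ↦ R X Y (A Z) - A (R X Y Z)))
include hRQ

/-- The components are normalized traces of `I R(X,Y)`, `J R(X,Y)`, `K R(X,Y)`, which makes their
bilinearity in `X, Y` evident. -/
lemma exists_adjoint_forms [FiniteDimensional ℝ V] [Nontrivial V] :
    ∃ x y z : V →ₗ[ℝ] V →ₗ[ℝ] ℝ, ∀ X Y,
      (∀ v, R X Y (I v) - I (R X Y v) = (-2 * y X Y) • K v + (2 * z X Y) • J v) ∧
      ∀ v, R X Y (J v) - J (R X Y v) = (2 * x X Y) • K v + (2 * z X Y) • I v := by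
  set d : ℝ := (Module.finrank ℝ V : ℝ) with hd
  have hd0 : d ≠ 0 := by
    simpa [hd] using (Module.finrank_pos (R := ℝ) (M := V)).ne'
  let tr (A : V →ₗ[ℝ] V) : V →ₗ[ℝ] V →ₗ[ℝ] ℝ :=
    R.compr₂ (LinearMap.trace ℝ V ∘ₗ LinearMap.mulLeft ℝ (A : Module.End ℝ V))
  have htr : ∀ A X Y, tr A X Y = LinearMap.trace ℝ V (A ∘ₗ R X Y) := fun A X Y ↦ rfl
  refine ⟨(-(1 / d)) • tr I, (1 / d) • tr J, (1 / d) • tr K, fun X Y ↦ ?_⟩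
  obtain ⟨x, y, z, h1, h2⟩ := h.exists_adjoint_component (R X Y) fun A hA ↦ hRQ A hA X Y
  -- The part of `R X Y` that commutes with `Q`; it contributes nothing to the three traces.
  set E' : V →ₗ[ℝ] V := R X Y - (x • I + y • J + z • K) with hE'
  have hE'I : ∀ v, E' (I v) = I (E' v) := fun v ↦ by
    rw [← sub_eq_zero]
    simp only [hE', LinearMap.sub_apply, LinearMap.add_apply, LinearMap.smul_apply, map_sub,
      map_add, map_smul, h.sq_I, h.J_I, h.K_I, h.I_K, ← h.mul_eq]
    trans (R X Y (I v) - I (R X Y v)) - ((-2 * y) • K v + (2 * z) • J v)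
    · module
    · rw [h1, sub_self]
  have hE'J : ∀ v, E' (J v) = J (E' v) := fun v ↦ by
    rw [← sub_eq_zero]
    simp only [hE', LinearMap.sub_apply, LinearMap.add_apply, LinearMap.smul_apply, map_sub,
      map_add, map_smul, h.sq_J, h.J_I, h.K_J, h.J_K, ← h.mul_eq]
    trans (R X Y (J v) - J (R X Y v)) - ((2 * x) • K v + (2 * z) • I v)
    · module
    · rw [h2, sub_self]
  have hRE : R X Y = E' + (x • I + y • J + z • K) := by rw [hE']; abel
  have tI : LinearMap.trace ℝ V I = 0 := by
    simpa using h.trace_I_comp (B := LinearMap.id) (fun _ ↦ rfl)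
  have tJ : LinearMap.trace ℝ V J = 0 := by
    simpa using h.trace_J_comp (B := LinearMap.id) (fun _ ↦ rfl)
  have tK : LinearMap.trace ℝ V K = 0 := by
    simpa using h.trace_K_comp (B := LinearMap.id) (fun _ ↦ rfl)
  have hx : tr I X Y = -(d * x) := by
    have e : I ∘ₗ R X Y = I ∘ₗ E' + ((-x) • LinearMap.id + y • K - z • J) := by
      rw [hRE]; ext v
      simp only [LinearMap.comp_apply, LinearMap.add_apply, LinearMap.smul_apply, map_add, map_smul,
        h.sq_I, h.I_K, ← h.mul_eq, LinearMap.sub_apply, LinearMap.id_apply]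
      module
    rw [htr, e]
    simp only [map_add, map_sub, map_smul, h.trace_I_comp hE'J, tJ, tK, LinearMap.trace_id,
      smul_eq_mul, ← hd]
    ring
  have hy : tr J X Y = d * y := by
    have e : J ∘ₗ R X Y = J ∘ₗ E' + (y • LinearMap.id - x • K - z • I) := by
      rw [hRE]; ext v
      simp only [LinearMap.comp_apply, LinearMap.add_apply, LinearMap.smul_apply, map_add, map_smul,
        h.sq_J, h.J_K, h.J_I, ← h.mul_eq, LinearMap.sub_apply, LinearMap.id_apply]
      module
    rw [htr, e]
    simp only [map_add, map_sub, map_smul, h.trace_J_comp hE'I, tI, tK, LinearMap.trace_id,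
      smul_eq_mul, ← hd]
    ring
  have hz : tr K X Y = d * z := by
    have e : K ∘ₗ R X Y = K ∘ₗ E' + (z • LinearMap.id + x • J + y • I) := by
      rw [hRE]; ext v
      simp only [LinearMap.comp_apply, LinearMap.add_apply, LinearMap.smul_apply, map_add, map_smul,
        h.sq_K, h.K_I, h.K_J, LinearMap.id_apply]
      module
    rw [htr, e]
    simp only [map_add, map_smul, h.trace_K_comp hE'I, tI, tJ, LinearMap.trace_id,
      smul_eq_mul, ← hd]
    ring
  have ex : ((-(1 / d)) • tr I) X Y = x := by
    rw [LinearMap.smul_apply, LinearMap.smul_apply, hx, smul_eq_mul]; field_simp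
  have ey : ((1 / d) • tr J) X Y = y := by
    rw [LinearMap.smul_apply, LinearMap.smul_apply, hy, smul_eq_mul]; field_simp
  have ez : ((1 / d) • tr K) X Y = z := by
    rw [LinearMap.smul_apply, LinearMap.smul_apply, hz, smul_eq_mul]; field_simp
  rw [ex, ey, ez]
  exact ⟨h1, h2⟩

include hR

/-- The curvature of a para-quaternionic Kähler manifold of dimension greater than four:
the `Q`-components of the curvature are multiples of the fundamental forms. -/
theorem exists_reduced_scalar_curvature [FiniteDimensional ℝ V] (hd : 4 < Module.finrank ℝ V) :
    ∃ b : ℝ, ∀ X Y,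
      (∀ v, R X Y (I v) - I (R X Y v) = (2 * b * g (J X) Y) • K v - (2 * b * g (K X) Y) • J v) ∧
      ∀ v, R X Y (J v) - J (R X Y v) = (2 * b * g (I X) Y) • K v - (2 * b * g (K X) Y) • I v := by
  have hnt : Nontrivial V := Module.nontrivial_of_finrank_pos (R := ℝ) (by omega)
  obtain ⟨x, y, z, hxyz⟩ := h.exists_adjoint_forms hRQ
  obtain ⟨Z, hZ⟩ := h.exists_nonnull
  have hZ0 : Z ≠ 0 := by rintro rfl; simp at hZ
  -- the commutator with a general element
  have hcomm : ∀ (p q r : ℝ) X Y v, R X Y (p • I v + q • J v + r • K v)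
      - (p • I (R X Y v) + q • J (R X Y v) + r • K (R X Y v))
      = (2 * q * z X Y - 2 * r * y X Y) • I v + (2 * p * z X Y - 2 * r * x X Y) • J v
        + (2 * q * x X Y - 2 * p * y X Y) • K v := by
    intro p q r X Y v
    have e1 := (hxyz X Y).1
    have e2 := (hxyz X Y).2
    have e3 : R X Y (K v) - K (R X Y v) = (-2 * x X Y) • J v + (-2 * y X Y) • I v := by
      have e4 := e1 (J v)
      have e5 := congr(I $(e2 v))
      simp only [map_add, map_sub, map_smul, h.sq_I, h.sq_J, h.K_J, h.I_K, ← h.mul_eq] at e4 e5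
      trans (R X Y (K v) - I (R X Y (J v))) + (I (R X Y (J v)) - K (R X Y v))
      · abel
      · rw [e4, e5]; module
    simp only [map_add, map_smul]
    trans p • (R X Y (I v) - I (R X Y v)) + q • (R X Y (J v) - J (R X Y v))
      + r • (R X Y (K v) - K (R X Y v))
    · module
    · rw [e1, e2, e3]; module
  -- These are the coefficients of the commutator of `A` with `R(X, A X)`, zero by
  -- `curvature_commutes`, for `A = p I + q J + r K`. Taking `A` among `I, J, K, I + J, I + K` and
  -- polarizing in `X` gives all relations between the three forms.
  have hquad : ∀ (p q r : ℝ) X, q * z X (p • I X + q • J X + r • K X)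
        = r * y X (p • I X + q • J X + r • K X) ∧
      p * z X (p • I X + q • J X + r • K X) = r * x X (p • I X + q • J X + r • K X) ∧
      q * x X (p • I X + q • J X + r • K X) = p * y X (p • I X + q • J X + r • K X) := by
    intro p q r X
    have hA : IsComb I J K (p • I + q • J + r • K : V →ₗ[ℝ] V) := ⟨p, q, r, fun v ↦ by simp⟩
    have := h.coeff_eq_zero hZ0 fun w ↦ by
      rw [← hcomm p q r X (p • I X + q • J X + r • K X) w, sub_eq_zero]
      simpa using h.curvature_commutes hR hRQ hd X hA w
    obtain ⟨h1, h2, h3⟩ := this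
    refine ⟨by linarith, by linarith, by linarith⟩
  have qI : ∀ X, z X (I X) = 0 ∧ y X (I X) = 0 := fun X ↦ by
    have := hquad 1 0 0 X
    simp only [one_smul, zero_smul, add_zero, one_mul, zero_mul, true_and] at this
    exact ⟨this.1, this.2.symm⟩
  have qJ : ∀ X, z X (J X) = 0 ∧ x X (J X) = 0 := fun X ↦ by
    have := hquad 0 1 0 X
    simpa only [one_smul, zero_smul, add_zero, zero_add, one_mul, zero_mul, true_and] using this
  have qK : ∀ X, y X (K X) = 0 ∧ x X (K X) = 0 := fun X ↦ by
    have := hquad 0 0 1 X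
    simp only [one_smul, zero_smul, add_zero, zero_add, one_mul, zero_mul, and_true] at this
    exact ⟨this.1.symm, this.2.symm⟩
  have qIJ : ∀ X, x X (I X) = y X (J X) := fun X ↦ by
    have := hquad 1 1 0 X
    simp only [one_smul, zero_smul, add_zero, one_mul, zero_mul, map_add, qI, qJ, zero_add] at this
    exact this.2.2
  have qIK : ∀ X, x X (I X) = z X (K X) := fun X ↦ by
    have := hquad 1 0 1 X
    simp only [one_smul, zero_smul, add_zero, one_mul, zero_mul, map_add, qI, qK, zero_add] at this
    exact this.2.1.symm
  have polar : ∀ s t : V →ₗ[ℝ] V →ₗ[ℝ] ℝ, ∀ A B : V →ₗ[ℝ] V, (∀ X, s X (A X) = t X (B X)) →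
      ∀ X Y, s X (A Y) + s Y (A X) = t X (B Y) + t Y (B X) := by
    intro s t A B hst X Y
    have := hst (X + Y)
    simp only [map_add, LinearMap.add_apply, hst X, hst Y] at this
    linarith
  have anti : ∀ X Y, x X Y = -x Y X ∧ y X Y = -y Y X ∧ z X Y = -z Y X := by
    intro X Y
    have := h.coeff_eq_zero (a := 2 * (z X Y + z Y X)) (b := 0) (c := 2 * (x X Y + x Y X)) hZ0
      fun w ↦ by
        have e1 := (hxyz X Y).2 w
        have e2 := (hxyz Y X).2 w
        have e3 : R X Y (J w) - J (R X Y w) + (R Y X (J w) - J (R Y X w)) = 0 := by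
          rw [hR.antisymm X Y, hR.antisymm X Y, map_neg]; abel
        rw [e1, e2] at e3
        rw [← e3]; module
    have h2 := h.coeff_eq_zero (a := 0) (b := 2 * (z X Y + z Y X)) (c := -2 * (y X Y + y Y X)) hZ0
      fun w ↦ by
        have e1 := (hxyz X Y).1 w
        have e2 := (hxyz Y X).1 w
        have e3 : R X Y (I w) - I (R X Y w) + (R Y X (I w) - I (R Y X w)) = 0 := by
          rw [hR.antisymm X Y, hR.antisymm X Y, map_neg]; abel
        rw [e1, e2] at e3
        rw [← e3]; module
    refine ⟨by linarith [this.2.2], by linarith [h2.2.2], by linarith [h2.2.1]⟩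
  have pol0 : ∀ s : V →ₗ[ℝ] V →ₗ[ℝ] ℝ, ∀ A : V →ₗ[ℝ] V, (∀ X, s X (A X) = 0) →
      (∀ X Y, s X Y = -s Y X) → ∀ X Y, s (A X) Y = s X (A Y) := by
    intro s A hs ha X Y
    have := polar s 0 A A (by simpa using hs) X Y
    simp only [LinearMap.zero_apply, add_zero] at this
    rw [ha (A X)]; linarith
  have xJ := pol0 x J (fun X ↦ (qJ X).2) (fun X Y ↦ (anti X Y).1)
  have xK := pol0 x K (fun X ↦ (qK X).2) (fun X Y ↦ (anti X Y).1)
  have yI := pol0 y I (fun X ↦ (qI X).2) (fun X Y ↦ (anti X Y).2.1)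
  have yK := pol0 y K (fun X ↦ (qK X).1) (fun X Y ↦ (anti X Y).2.1)
  have zI := pol0 z I (fun X ↦ (qI X).1) (fun X Y ↦ (anti X Y).2.2)
  have zJ := pol0 z J (fun X ↦ (qJ X).1) (fun X Y ↦ (anti X Y).2.2)
  -- The form `x` is symmetric under moving `J` and `K` across; moving their product, which is `-I`,
  -- reverses the order of the factors and hence the sign.
  have xI : ∀ X Y, x (I X) Y = -x X (I Y) := fun X Y ↦ by
    have e1 := xJ (K X) Y
    rw [xK, h.J_K, h.K_J, map_neg, LinearMap.neg_apply] at e1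
    linarith
  have yJ : ∀ X Y, y (J X) Y = -y X (J Y) := fun X Y ↦ by
    have e1 := yI (K X) Y
    rw [yK, h.I_K, h.K_I, map_neg, LinearMap.neg_apply] at e1
    linarith
  have zK : ∀ X Y, z (K X) Y = -z X (K Y) := fun X Y ↦ by
    have e1 := zI (J X) Y
    rw [zJ, ← h.mul_eq, h.J_I, map_neg, ← h.mul_eq] at e1
    exact e1
  have xy : ∀ X Y, x X (I Y) = y X (J Y) := fun X Y ↦ by
    have := polar x y I J qIJ X Y
    rw [(anti Y (I X)).1, (anti Y (J X)).2.1, xI, yJ] at this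
    linarith
  have xz : ∀ X Y, x X (I Y) = z X (K Y) := fun X Y ↦ by
    have := polar x z I K qIK X Y
    rw [(anti Y (I X)).1, (anti Y (K X)).2.2, xI, zK] at this
    linarith
  -- `z` is represented by an endomorphism in the image of the curvature operator
  set S : V →ₗ[ℝ] V := (-(1 / (2 * g Z Z))) • (R (I Z) (J Z) + R Z (K Z)) with hS
  have hSz : ∀ X Y, g (S X) Y = z X Y := by
    intro X Y
    simp only [hS, LinearMap.smul_apply, LinearMap.add_apply, map_smul, map_add, smul_eq_mul]
    rw [hR.pair_symm h.symm, hR.pair_symm h.symm Z]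
    have e1 := congr(g $((hxyz X Y).1 Z) (J Z))
    have e2 : g (K Z) (J Z) = 0 := by
      rw [h.skew_K, h.K_J, h.symm, h.comb_self (isComb_I I J K), neg_zero]
    have e3 : g (J Z) (J Z) = -g Z Z := by rw [h.skew_J, h.sq_J]
    have e4 : g (I (R X Y Z)) (J Z) = -g (R X Y Z) (K Z) := by rw [h.skew_I, h.mul_eq]
    simp only [map_sub, map_add, map_smul, LinearMap.sub_apply, LinearMap.add_apply,
      LinearMap.smul_apply, smul_eq_mul, e2, e3, e4] at e1
    have e5 : g (R X Y (I Z)) (J Z) + g (R X Y Z) (K Z) = -(2 * z X Y * g Z Z) := by linarith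
    rw [e5]
    field_simp
  -- Pair symmetry has made `S` a combination of two curvature operators, so its commutator with `I`
  -- lies in `Q`.
  have hSQ : IsComb I J K (fun v ↦ S (I v) - I (S v)) := by
    obtain ⟨a, b, c, h1⟩ := hRQ I (isComb_I I J K) (I Z) (J Z)
    obtain ⟨a', b', c', h2⟩ := hRQ I (isComb_I I J K) Z (K Z)
    refine ⟨(-(1 / (2 * g Z Z))) * (a + a'), (-(1 / (2 * g Z Z))) * (b + b'),
      (-(1 / (2 * g Z Z))) * (c + c'), fun v ↦ ?_⟩
    have h1' := h1 v
    have h2' := h2 v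
    simp only at h1' h2'
    simp only [hS, LinearMap.smul_apply, LinearMap.add_apply, map_smul, map_add]
    trans (-(1 / (2 * g Z Z))) • ((R (I Z) (J Z) (I v) - I (R (I Z) (J Z) v))
      + (R Z (K Z) (I v) - I (R Z (K Z) v)))
    · module
    · rw [h1', h2']; module
  have hSI : ∀ v, S (I v) = -I (S v) := fun v ↦ by
    rw [eq_neg_iff_add_eq_zero]
    refine h.nondeg _ fun w ↦ ?_
    rw [map_add, LinearMap.add_apply, hSz, h.skew_I, hSz, zI]; ring
  have hSJ : ∀ v, S (J v) = -J (S v) := fun v ↦ by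
    rw [eq_neg_iff_add_eq_zero]
    refine h.nondeg _ fun w ↦ ?_
    rw [map_add, LinearMap.add_apply, hSz, h.skew_J, hSz, zJ]; ring
  -- As `S` anticommutes with `I`, its commutator with `I` is `-2 I S`, so `S` is a combination of
  -- `1`, `J`, `K`. Anticommuting with `I` excludes `1`, and anticommuting with `J` excludes `J`.
  obtain ⟨b, hb⟩ : ∃ b : ℝ, ∀ v, S v = b • K v := by
    obtain ⟨a, b, c, habc⟩ := hSQ
    have hS2 : ∀ v, S v = (-a / 2) • v + (b / 2) • K v - (c / 2) • J v := fun v ↦ by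
      have e1 := congr(I $(habc v))
      simp only [hSI, map_sub, map_add, map_neg, map_smul, h.sq_I, h.I_K, ← h.mul_eq, neg_neg]
        at e1
      have e2 : (2 : ℝ) • S v = -(a • v) + b • K v - c • J v := by
        trans S v + S v
        · module
        · rw [← sub_neg_eq_add, e1]; module
      have e3 := congr((1 / 2 : ℝ) • $e2)
      rw [smul_smul] at e3
      norm_num at e3
      rw [e3]; module
    have ha : a = 0 := by
      exact (h.coeff_eq_zero (a := a) (b := 0) (c := 0) hZ0 fun w ↦ by
        have e1 := hSI w
        rw [hS2, hS2] at e1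
        simp only [map_sub, map_add, map_smul, h.I_K, h.K_I, h.J_I, ← h.mul_eq] at e1
        rw [← sub_eq_zero] at e1
        rw [← neg_eq_zero, ← e1]; module).1
    have hc : c = 0 := by
      have e1 := hSJ Z
      rw [hS2, hS2, ha] at e1
      simp only [map_sub, map_add, map_smul, h.sq_J, h.J_K, h.K_J] at e1
      have e2 : c • Z = 0 := by
        rw [← sub_eq_zero] at e1
        rw [← neg_eq_zero, ← e1]; module
      exact (smul_eq_zero.1 e2).resolve_right hZ0
    exact ⟨b / 2, fun v ↦ by rw [hS2, ha, hc]; module⟩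
  have hz : ∀ X Y, z X Y = b * g (K X) Y := fun X Y ↦ by
    rw [← hSz, hb, map_smul, LinearMap.smul_apply, smul_eq_mul]
  have hx : ∀ X Y, x X Y = -(b * g (I X) Y) := fun X Y ↦ by
    have e1 := xz X (I Y)
    rw [h.sq_I, hz, h.K_I, map_neg, h.skew_K, h.K_J] at e1
    rw [h.skew_I]
    linarith
  have hy : ∀ X Y, y X Y = b * g (J X) Y := fun X Y ↦ by
    have e1 := xy X (J Y)
    rw [h.sq_J, hx, h.skew_I, h.sq_I, map_neg] at e1
    rw [← e1, h.skew_J]; ring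
  refine ⟨-b, fun X Y ↦ ⟨fun v ↦ ?_, fun v ↦ ?_⟩⟩
  · rw [(hxyz X Y).1, hy, hz]; module
  · rw [(hxyz X Y).2, hx, hz]; module

end IsHermitianTriple

end CurvatureDecomposition

/-! ### The model tensor `R₀` -/

section ModelCurvature

variable {V : Type*} [AddCommGroup V] [Module ℝ V]

/-- `modelCurvature` as a trilinear map. -/
noncomputable def modelCurvatureHom (g : V →ₗ[ℝ] V →ₗ[ℝ] ℝ) (I J K : V →ₗ[ℝ] V) :
    V →ₗ[ℝ] V →ₗ[ℝ] V →ₗ[ℝ] V :=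
  LinearMap.mk₂ ℝ (fun u v ↦
    { toFun := modelCurvature (fun u v ↦ g u v) I J K u v
      map_add' := fun w w' ↦ by simp only [modelCurvature, wedgeEnd, map_add]; module
      map_smul' := fun c w ↦ by
        simp only [modelCurvature, wedgeEnd, map_smul, smul_eq_mul, RingHom.id_apply]; module })
    (fun u u' v ↦ by
      ext w; simp only [modelCurvature, wedgeEnd, map_add, LinearMap.coe_mk, AddHom.coe_mk,
        LinearMap.add_apply]; module)
    (fun c u v ↦ by
      ext w; simp only [modelCurvature, wedgeEnd, map_smul, LinearMap.coe_mk, AddHom.coe_mk,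
        LinearMap.smul_apply, smul_eq_mul]; module)
    (fun u v v' ↦ by
      ext w; simp only [modelCurvature, wedgeEnd, map_add, LinearMap.coe_mk, AddHom.coe_mk,
        LinearMap.add_apply]; module)
    (fun c u v ↦ by
      ext w; simp only [modelCurvature, wedgeEnd, map_smul, LinearMap.coe_mk, AddHom.coe_mk,
        LinearMap.smul_apply, smul_eq_mul]; module)

lemma modelCurvatureHom_apply (g : V →ₗ[ℝ] V →ₗ[ℝ] ℝ) (I J K : V →ₗ[ℝ] V) (u v w : V) :
    modelCurvatureHom g I J K u v w = modelCurvature (fun u v ↦ g u v) I J K u v w := rfl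

namespace IsHermitianTriple

variable {g : V →ₗ[ℝ] V →ₗ[ℝ] ℝ} {I J K : V →ₗ[ℝ] V} (h : IsHermitianTriple g I J K)
include h

lemma swap_I (u v : V) : g (I u) v = -g (I v) u := by rw [h.skew_I, h.symm]
lemma swap_J (u v : V) : g (J u) v = -g (J v) u := by rw [h.skew_J, h.symm]
lemma swap_K (u v : V) : g (K u) v = -g (K v) u := by rw [h.skew_K, h.symm]

lemma isAlgebraicCurvature_model :
    IsAlgebraicCurvature (fun u v ↦ g u v) (modelCurvatureHom g I J K) where
  antisymm u v w := by
    simp only [modelCurvatureHom_apply, modelCurvature, wedgeEnd, h.swap_I v u, h.swap_J v u,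
      h.swap_K v u]
    module
  skew u v w z := by
    simp only [modelCurvatureHom_apply, modelCurvature, wedgeEnd, map_add, map_sub, map_neg,
      map_smul, LinearMap.add_apply, LinearMap.sub_apply, LinearMap.neg_apply,
      LinearMap.smul_apply, smul_eq_mul, h.skew_I w z, h.skew_J w z, h.skew_K w z,
      h.symm w (I _), h.symm w (J _), h.symm w (K _), h.symm w u, h.symm w v, h.skew_I z w, h.skew_J z w, h.skew_K z w]
    ring
  bianchi u v w := by
    simp only [modelCurvatureHom_apply, modelCurvature, wedgeEnd, h.swap_I v u, h.swap_J v u,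
      h.swap_K v u, h.swap_I w u, h.swap_J w u, h.swap_K w u, h.swap_I w v, h.swap_J w v,
      h.swap_K w v, h.symm v u, h.symm w u, h.symm w v]
    module

/-- Only the sum of the terms `g(J_α X, Y) J_α` contributes: the wedge part of `R₀` commutes with
`Q`. -/
lemma model_commutator_I (X Y v : V) :
    modelCurvatureHom g I J K X Y (I v) - I (modelCurvatureHom g I J K X Y v)
      = -g (J X) Y • K v + g (K X) Y • J v := by
  simp only [modelCurvatureHom_apply, modelCurvature, wedgeEnd, map_add, map_sub, map_neg,
      map_smul, h.skew_I _ v, h.skew_J _ v, h.skew_K _ v, h.skew_I _ (I v), h.skew_J _ (I v),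
      h.skew_K _ (I v), h.sq_I, h.J_I, h.I_K, h.K_I, ← h.mul_eq]
  module

lemma model_commutator_J (X Y v : V) :
    modelCurvatureHom g I J K X Y (J v) - J (modelCurvatureHom g I J K X Y v)
      = -g (I X) Y • K v + g (K X) Y • I v := by
  simp only [modelCurvatureHom_apply, modelCurvature, wedgeEnd, map_add, map_sub, map_neg,
      map_smul, h.skew_I _ v, h.skew_J _ v, h.skew_K _ v, h.skew_I _ (J v), h.skew_J _ (J v),
      h.skew_K _ (J v), h.sq_J, h.J_I, h.J_K, h.K_J, ← h.mul_eq]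
  module

end IsHermitianTriple

end ModelCurvature

/-! ### Curvature tensors commuting with `Q` -/

section Commuting

variable {V : Type*} [AddCommGroup V] [Module ℝ V] {g : V →ₗ[ℝ] V →ₗ[ℝ] ℝ} {I J K : V →ₗ[ℝ] V}

/-- The identification of `V` with its dual by `g` conjugates `A` to the transpose of `-A`. -/
lemma IsHermitianTriple.trace_skew [FiniteDimensional ℝ V] (h : IsHermitianTriple g I J K)
    {A : V →ₗ[ℝ] V} (hA : ∀ u v, g (A u) v = -g u (A v)) : LinearMap.trace ℝ V A = 0 := by
  have hinj : Function.Injective g := by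
    rw [injective_iff_map_eq_zero]
    exact fun u hu ↦ h.nondeg u fun v ↦ by rw [hu]; rfl
  let e : V ≃ₗ[ℝ] Module.Dual ℝ V :=
    LinearEquiv.ofInjectiveOfFinrankEq g hinj Subspace.dual_finrank_eq.symm
  have he : ∀ u, e u = g u := fun u ↦ rfl
  have h1 : e.conj A = Module.Dual.transpose (R := ℝ) (-A) := by
    ext φ v
    obtain ⟨u, rfl⟩ := e.surjective φ
    have hs : e.symm (g u) = u := by rw [← he, e.symm_apply_apply]
    simp [LinearEquiv.conj_apply, he, hA, hs, Module.Dual.transpose_apply]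
  have h2 := LinearMap.trace_conj' A e
  rw [h1, LinearMap.trace_transpose', map_neg] at h2
  linarith

variable {W : V →ₗ[ℝ] V →ₗ[ℝ] V →ₗ[ℝ] V}

/-- Pair symmetry transfers commutation in the last slots to the first two. The terms of the
derivation action of `A` on `W` then cancel in pairs. -/
lemma IsHermitianTriple.curvature_skew_of_commutes (h : IsHermitianTriple g I J K)
    (hW : IsAlgebraicCurvature (fun u v ↦ g u v) W) {A : V →ₗ[ℝ] V} (hA : IsComb I J K A)
    (hWA : ∀ X Y v, W X Y (A v) = A (W X Y v)) (u v w : V) : W (A u) v w = -W u (A v) w := by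
  rw [eq_neg_iff_add_eq_zero]
  refine h.nondeg _ fun z ↦ ?_
  rw [map_add, LinearMap.add_apply, hW.pair_symm h.symm, hW.pair_symm h.symm u, hWA,
    h.skew A hA]
  ring

/-- The Ricci form is symmetric, because the operators `W w v` are skew and so traceless. Bianchi's
identity for `u, v, I w`, followed by `I`, shows that it is also antisymmetric, since `I ∘ W v (I
w)` is traceless. -/
lemma IsHermitianTriple.isTraceFree_of_commutes [FiniteDimensional ℝ V]
    (h : IsHermitianTriple g I J K) (hW : IsAlgebraicCurvature (fun u v ↦ g u v) W)
    (hI : ∀ X Y v, W X Y (I v) = I (W X Y v)) (hJ : ∀ X Y v, W X Y (J v) = J (W X Y v)) :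
    IsTraceFree W := by
  have hsk := h.curvature_skew_of_commutes hW (isComb_I I J K) hI
  intro v w
  have h1 : (W.flip v).flip w - (W.flip w).flip v = W w v := by
    ext u
    have := hW.bianchi u v w
    simp only [LinearMap.sub_apply, LinearMap.flip_apply]
    rw [hW.antisymm u w, hW.antisymm w v, sub_neg_eq_add, eq_neg_iff_add_eq_zero, ← this]
    abel
  have h2 : (W.flip v).flip w = (I ∘ₗ (W.flip w).flip v) ∘ₗ I + I ∘ₗ W v (I w) := by
    ext u
    have e1 := hW.bianchi u v (I w)
    have e2 : I (W u v (I w)) = -W u v w := by rw [hI, h.sq_I]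
    have e3 : W (I w) u v = W (I u) w v := by rw [hsk, hW.antisymm w, neg_neg]
    rw [e3] at e1
    have e4 := congr(I $e1)
    rw [map_add, map_add, e2, map_zero] at e4
    simp only [LinearMap.add_apply, LinearMap.flip_apply, LinearMap.comp_apply]
    rw [← sub_eq_zero, ← neg_eq_zero, ← e4]
    abel
  have h3 := congr(LinearMap.trace ℝ V $h1)
  have h4 := congr(LinearMap.trace ℝ V $h2)
  have h5 : I ∘ₗ (I ∘ₗ (W.flip w).flip v) = -(W.flip w).flip v := by ext u; simp [h.sq_I]
  rw [map_sub, h.trace_skew (hW.skew w v)] at h3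
  rw [map_add, LinearMap.trace_comp_comm', h5, map_neg,
    h.toIsStandardTriple.trace_I_comp (fun u ↦ hJ v (I w) u)] at h4
  linarith

/-- The value `ν = -2b` is the one for which `ν R₀` has the same commutators with `I` and `J` as
`R`, so that the remainder commutes with `Q`. -/
lemma IsHermitianTriple.exists_curvature_decomposition [FiniteDimensional ℝ V]
    (h : IsHermitianTriple g I J K) {R : V →ₗ[ℝ] V →ₗ[ℝ] V →ₗ[ℝ] V}
    (hR : IsAlgebraicCurvature (fun u v ↦ g u v) R) {b : ℝ}
    (hI : ∀ X Y v, R X Y (I v) - I (R X Y v) = (2 * b * g (J X) Y) • K v - (2 * b * g (K X) Y) • J v)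
    (hJ : ∀ X Y v, R X Y (J v) - J (R X Y v) = (2 * b * g (I X) Y) • K v - (2 * b * g (K X) Y) • I v)
    {Q : Set (V → V)} (hQ : ∀ A ∈ Q, IsComb I J K A) :
    ∃ (ν : ℝ) (W : V →ₗ[ℝ] V →ₗ[ℝ] V →ₗ[ℝ] V), IsAlgebraicCurvature (fun u v ↦ g u v) W ∧
      IsTraceFree W ∧ IsDerivationInvariant Q W ∧
      ∀ X Y Z, R X Y Z = ν • modelCurvature (fun u v ↦ g u v) I J K X Y Z + W X Y Z := by
  have hm := h.isAlgebraicCurvature_model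
  let W := R - (-2 * b) • modelCurvatureHom g I J K
  have hWa : ∀ X Y v, W X Y v = R X Y v + (2 * b) • modelCurvatureHom g I J K X Y v :=
    fun X Y v ↦ by simp [W]
  have hW : IsAlgebraicCurvature (fun u v ↦ g u v) W :=
    { antisymm := fun u v w ↦ by
        rw [hWa, hWa, hR.antisymm, hm.antisymm]; module
      skew := fun u v w z ↦ by
        have e1 := hR.skew u v w z
        have e2 := hm.skew u v w z
        simp only [hWa, map_add, map_smul, LinearMap.add_apply, LinearMap.smul_apply,
          smul_eq_mul] at e1 e2 ⊢
        rw [e1, e2]; ring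
      bianchi := fun u v w ↦ by
        have e1 := hR.bianchi u v w
        have e2 := congr((2 * b) • $(hm.bianchi u v w))
        simp only [hWa]
        rw [smul_zero] at e2
        calc _ = (R u v w + R v w u + R w u v) + (2 * b) • (modelCurvatureHom g I J K u v w
              + modelCurvatureHom g I J K v w u + modelCurvatureHom g I J K w u v) := by module
          _ = 0 := by rw [e1, e2, add_zero] }
  have hWI : ∀ X Y v, W X Y (I v) = I (W X Y v) := fun X Y v ↦ by
    have e1 := hI X Y v
    have e2 := h.model_commutator_I X Y v
    rw [sub_eq_iff_eq_add] at e1 e2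
    rw [hWa, hWa, e1, e2, map_add, map_smul]; module
  have hWJ : ∀ X Y v, W X Y (J v) = J (W X Y v) := fun X Y v ↦ by
    have e1 := hJ X Y v
    have e2 := h.model_commutator_J X Y v
    rw [sub_eq_iff_eq_add] at e1 e2
    rw [hWa, hWa, e1, e2, map_add, map_smul]; module
  refine ⟨-2 * b, W, hW, h.isTraceFree_of_commutes hW hWI hWJ, fun A hA u v w ↦ ?_,
    fun X Y Z ↦ ?_⟩
  · obtain ⟨A, rfl⟩ := (hQ A hA).map
    have hAW : ∀ X Y v, W X Y (A v) = A (W X Y v) := fun X Y v ↦ by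
      obtain ⟨a, b, c, habc⟩ := hQ _ hA
      simp only [habc, map_add, map_smul, h.mul_eq, hWI, hWJ]
    rw [h.curvature_skew_of_commutes hW (hQ _ hA) hAW, hAW]
    abel
  · rw [hWa, ← modelCurvatureHom_apply]; module

end Commuting

/-! ### Vector fields read in a preferred chart -/

section Coordinates

variable {E : Type*} [NormedAddCommGroup E] [NormedSpace ℝ E]
  {M : Type*} [TopologicalSpace M] [ChartedSpace E M]
  {F : Type*} [NormedAddCommGroup F] [NormedSpace ℝ F]

/-- The derivative at `q` of the preferred chart at `p`. -/
noncomputable def chartDeriv (p q : M) : TangentSpace 𝓘(ℝ, E) q →L[ℝ] E :=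
  mvfderiv 𝓘(ℝ, E) (extChartAt 𝓘(ℝ, E) p) q

variable [IsManifold 𝓘(ℝ, E) ∞ M]

/-- The tangent bundle trivialization is the derivative of the chart, so regularity of sections
becomes regularity of maps into the model space. -/
lemma trivializationAt_snd {p q : M} (hq : q ∈ (chartAt E p).source)
    (v : TangentSpace 𝓘(ℝ, E) q) :
    (trivializationAt E (TangentSpace 𝓘(ℝ, E)) p ⟨q, v⟩).2 = chartDeriv p q v := by
  have h1 : (trivializationAt E (TangentSpace 𝓘(ℝ, E)) p).continuousLinearMapAt ℝ q v
      = (trivializationAt E (TangentSpace 𝓘(ℝ, E)) p ⟨q, v⟩).2 := by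
    rw [Trivialization.continuousLinearMapAt_apply, Trivialization.linearMapAt_apply,
      if_pos (by simpa using hq)]
  rw [← h1]
  exact congr($(TangentBundle.continuousLinearMapAt_trivializationAt hq) v)

lemma chartDeriv_injective {p q : M} (hq : q ∈ (chartAt E p).source) :
    Function.Injective (chartDeriv (E := E) p q) := by
  intro v w hvw
  rw [← trivializationAt_snd hq, ← trivializationAt_snd hq] at hvw
  have h1 : trivializationAt E (TangentSpace 𝓘(ℝ, E)) p ⟨q, v⟩
      = trivializationAt E (TangentSpace 𝓘(ℝ, E)) p ⟨q, w⟩ := Prod.ext (by simp) hvw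
  have h2 := (trivializationAt E (TangentSpace 𝓘(ℝ, E)) p).injOn (by simp [hq]) (by simp [hq]) h1
  simpa using h2

omit [NormedSpace ℝ E] [IsManifold 𝓘(ℝ, E) ∞ M] in
lemma eventually_mem_chart (p : M) : ∀ᶠ q in 𝓝 p, q ∈ (chartAt E p).source :=
  chart_source_mem_nhds E p

lemma chartDeriv_symm {p q : M} (hq : q ∈ (chartAt E p).source) (w : E) :
    chartDeriv p q ((trivializationAt E (TangentSpace 𝓘(ℝ, E)) p).symm q w) = w := by
  rw [← trivializationAt_snd hq, Trivialization.apply_mk_symm _ (by simpa using hq)]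

lemma symm_chartDeriv {p q : M} (hq : q ∈ (chartAt E p).source) (v : TangentSpace 𝓘(ℝ, E) q) :
    (trivializationAt E (TangentSpace 𝓘(ℝ, E)) p).symm q (chartDeriv p q v) = v :=
  chartDeriv_injective hq (chartDeriv_symm hq _)

variable {n : ℕ∞ω}

lemma contMDiffAt_section_iff {X : ∀ x : M, TangentSpace 𝓘(ℝ, E) x} {x : M} :
    ContMDiffAt 𝓘(ℝ, E) (𝓘(ℝ, E).prod 𝓘(ℝ, E)) n
      (fun y ↦ (⟨y, X y⟩ : TotalSpace E (fun z : M ↦ TangentSpace 𝓘(ℝ, E) z))) x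
    ↔ ContMDiffAt 𝓘(ℝ, E) 𝓘(ℝ, E) n (fun y ↦ chartDeriv x y (X y)) x := by
  rw [contMDiffAt_section]
  exact Filter.EventuallyEq.contMDiffAt_iff
    ((eventually_mem_chart x).mono fun y hy ↦ trivializationAt_snd hy _)

lemma mdifferentiableAt_section_iff' {X : ∀ x : M, TangentSpace 𝓘(ℝ, E) x} {x : M} :
    DiffVectorFieldAt X x
    ↔ MDifferentiableAt 𝓘(ℝ, E) 𝓘(ℝ, E) (fun y ↦ chartDeriv x y (X y)) x := by
  rw [DiffVectorFieldAt, mdifferentiableAt_section]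
  exact Filter.EventuallyEq.mdifferentiableAt_iff
    ((eventually_mem_chart x).mono fun y hy ↦ trivializationAt_snd hy _)

lemma contMDiffAt_mvfderiv_apply {h : M → F} {x : M} {m : ℕ∞ω}
    (hh : ContMDiffAt 𝓘(ℝ, E) 𝓘(ℝ, F) m h x) (hnm : n + 1 ≤ m)
    {X : ∀ x : M, TangentSpace 𝓘(ℝ, E) x}
    (hX : ContMDiffAt 𝓘(ℝ, E) (𝓘(ℝ, E).prod 𝓘(ℝ, E)) n
      (fun y ↦ (⟨y, X y⟩ : TotalSpace E (fun z : M ↦ TangentSpace 𝓘(ℝ, E) z))) x) :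
    ContMDiffAt 𝓘(ℝ, E) 𝓘(ℝ, F) n (fun y ↦ mvfderiv 𝓘(ℝ, E) h y (X y)) x := by
  have h1 := hh.mfderiv_const hnm
  rw [contMDiffAt_section_iff] at hX
  have h2 := h1.clm_apply hX
  refine h2.congr_of_eventuallyEq ?_
  filter_upwards [eventually_mem_chart (E := E) x] with y hy
  have e1 : (trivializationAt E (TangentSpace 𝓘(ℝ, E)) x).symmL ℝ y (chartDeriv x y (X y))
      = X y := by
    rw [Trivialization.symmL_apply _ (by simpa using hy)]; exact symm_chartDeriv hy _
  simp only [inTangentCoordinates, ContinuousLinearMap.inCoordinates]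
  simp only [ContinuousLinearMap.comp_apply, id]
  erw [e1]
  simp
  rfl

end Coordinates

/-! ### Lie brackets and second derivatives -/

section Bracket

variable {E : Type*} [NormedAddCommGroup E] [NormedSpace ℝ E]
  {M : Type*} [TopologicalSpace M] [ChartedSpace E M]
  {F : Type*} [NormedAddCommGroup F] [NormedSpace ℝ F]

lemma differentiableAt_comp_extChartAt_symm {w : M → F} {x : M}
    (hw : MDifferentiableAt 𝓘(ℝ, E) 𝓘(ℝ, F) w x) :
    DifferentiableAt ℝ (w ∘ (extChartAt 𝓘(ℝ, E) x).symm) (extChartAt 𝓘(ℝ, E) x x) := by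
  have := (mdifferentiableAt_iff _ _).1 hw
  simpa [writtenInExtChartAt, Function.comp_def, chartAt_self_eq, differentiableWithinAt_univ] using this.2

lemma contDiffAt_comp_extChartAt_symm {w : M → F} {x : M} {n : ℕ∞ω}
    (hw : ContMDiffAt 𝓘(ℝ, E) 𝓘(ℝ, F) n w x) :
    ContDiffAt ℝ n (w ∘ (extChartAt 𝓘(ℝ, E) x).symm) (extChartAt 𝓘(ℝ, E) x x) := by
  have := contMDiffAt_iff.1 hw
  simpa [Function.comp_def, chartAt_self_eq, contDiffWithinAt_univ] using this.2

lemma mvfderiv_congr {w w' : M → F} {x : M} (h : w =ᶠ[𝓝 x] w') :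
    mvfderiv 𝓘(ℝ, E) w x = mvfderiv 𝓘(ℝ, E) w' x := by
  have h1 : mfderiv 𝓘(ℝ, E) 𝓘(ℝ, F) w x = mfderiv 𝓘(ℝ, E) 𝓘(ℝ, F) w' x := h.mfderiv_eq
  exact h1

lemma mvfderiv_comp_eq {G : Type*} [NormedAddCommGroup G] [NormedSpace ℝ G]
    {N : Type*} [TopologicalSpace N] [ChartedSpace G N] {w : N → F} {f : M → N} (x : M)
    (hw : MDifferentiableAt 𝓘(ℝ, G) 𝓘(ℝ, F) w (f x)) (hf : MDifferentiableAt 𝓘(ℝ, E) 𝓘(ℝ, G) f x)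
    (v : TangentSpace 𝓘(ℝ, E) x) :
    mvfderiv 𝓘(ℝ, E) (w ∘ f) x v = mvfderiv 𝓘(ℝ, G) w (f x) (mfderiv 𝓘(ℝ, E) 𝓘(ℝ, G) f x v) :=
  mfderiv_comp_apply x hw hf v

variable [IsManifold 𝓘(ℝ, E) ∞ M]

lemma chartDeriv_self (x : M) (v : TangentSpace 𝓘(ℝ, E) x) : chartDeriv x x v = v := by
  have := mfderiv_extChartAt_self (I := 𝓘(ℝ, E)) (x := x)
  exact congr($this v)

lemma mvfderiv_eq_fderiv {w : M → F} {x : M} (hw : MDifferentiableAt 𝓘(ℝ, E) 𝓘(ℝ, F) w x)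
    (v : TangentSpace 𝓘(ℝ, E) x) :
    mvfderiv 𝓘(ℝ, E) w x v
      = fderiv ℝ (w ∘ (extChartAt 𝓘(ℝ, E) x).symm) (extChartAt 𝓘(ℝ, E) x x) (chartDeriv x x v) := by
  have h2 : mvfderiv 𝓘(ℝ, E) w x v = fderivWithin ℝ (writtenInExtChartAt 𝓘(ℝ, E) 𝓘(ℝ, F) x w)
      (Set.range 𝓘(ℝ, E)) (extChartAt 𝓘(ℝ, E) x x) v := congr($(hw.mfderiv) v)
  have h3 : writtenInExtChartAt 𝓘(ℝ, E) 𝓘(ℝ, F) x w = w ∘ (extChartAt 𝓘(ℝ, E) x).symm := by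
    ext; simp [writtenInExtChartAt, chartAt_self_eq]
  rw [h2, h3, chartDeriv_self, modelWithCornersSelf_coe, Set.range_id, fderivWithin_univ]

lemma mdifferentiableAt_mvfderiv_apply {h : M → F} {x : M} 
    (hh : ContMDiffAt 𝓘(ℝ, E) 𝓘(ℝ, F) 2 h x) 
    {X : ∀ x : M, TangentSpace 𝓘(ℝ, E) x} (hX : DiffVectorFieldAt X x) :
    MDifferentiableAt 𝓘(ℝ, E) 𝓘(ℝ, F) (fun y ↦ mvfderiv 𝓘(ℝ, E) h y (X y)) x := by
  have h1 := (hh.mfderiv_const (m := 1) (by norm_num)).mdifferentiableAt one_ne_zero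
  rw [mdifferentiableAt_section_iff'] at hX
  have h2 := h1.clm_apply hX
  refine h2.congr_of_eventuallyEq ?_
  filter_upwards [eventually_mem_chart (E := E) x] with y hy
  have e1 : (trivializationAt E (TangentSpace 𝓘(ℝ, E)) x).symmL ℝ y (chartDeriv x y (X y))
      = X y := by
    rw [Trivialization.symmL_apply _ (by simpa using hy)]; exact symm_chartDeriv hy _
  simp only [inTangentCoordinates, ContinuousLinearMap.inCoordinates]
  simp only [ContinuousLinearMap.comp_apply, id]
  erw [e1]
  simp
  rfl

/-- The chain rule through one fixed chart, valid on a whole neighbourhood so that it can be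
differentiated once more. -/
lemma mvfderiv_chart_factor {h : M → F} {x : M} (hh : ContMDiffAt 𝓘(ℝ, E) 𝓘(ℝ, F) 2 h x) :
    ∀ᶠ y in 𝓝 x, ∀ v : TangentSpace 𝓘(ℝ, E) y, mvfderiv 𝓘(ℝ, E) h y v
      = fderiv ℝ (h ∘ (extChartAt 𝓘(ℝ, E) x).symm) (extChartAt 𝓘(ℝ, E) x y) (chartDeriv x y v) := by
  have h1 : ∀ᶠ z in 𝓝 (extChartAt 𝓘(ℝ, E) x x),
      ContDiffAt ℝ 2 (h ∘ (extChartAt 𝓘(ℝ, E) x).symm) z :=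
    (contDiffAt_comp_extChartAt_symm hh).eventually (by simp)
  have h2 := (continuousAt_extChartAt (I := 𝓘(ℝ, E)) x).eventually h1
  filter_upwards [h2, (eventually_mem_chart (E := E) x),
    (eventually_eventually_nhds.2 (eventually_mem_chart (E := E) x))] with y hy hys hyn v
  have e1 : h =ᶠ[𝓝 y] (h ∘ (extChartAt 𝓘(ℝ, E) x).symm) ∘ extChartAt 𝓘(ℝ, E) x :=
    hyn.mono fun z hz ↦ by
      simp only [Function.comp_apply]
      rw [(extChartAt 𝓘(ℝ, E) x).left_inv (by simpa using hz)]
  rw [mvfderiv_congr e1]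
  refine (mvfderiv_comp_eq y (hy.differentiableAt two_ne_zero).mdifferentiableAt
    (mdifferentiableAt_extChartAt hys) v).trans ?_
  have e2 : mvfderiv 𝓘(ℝ, E) (h ∘ (extChartAt 𝓘(ℝ, E) x).symm) (extChartAt 𝓘(ℝ, E) x y)
      = fderiv ℝ (h ∘ (extChartAt 𝓘(ℝ, E) x).symm) (extChartAt 𝓘(ℝ, E) x y) := mfderiv_eq_fderiv
  exact congr($e2 _)

omit [IsManifold 𝓘(ℝ, E) ∞ M] in
lemma lieBracketWithin_univ_congr {A A' B B' : E → E} {z : E} (hA : A' =ᶠ[𝓝 z] A)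
    (hB : B' =ᶠ[𝓝 z] B) : VectorField.lieBracketWithin ℝ A' B' Set.univ z
      = fderiv ℝ B z (A z) - fderiv ℝ A z (B z) := by
  simp only [VectorField.lieBracketWithin, fderivWithin_univ]
  rw [hA.fderiv_eq, hB.fderiv_eq, hA.self_of_nhds, hB.self_of_nhds]

lemma mlieBracket_eq {X Y : ∀ x : M, TangentSpace 𝓘(ℝ, E) x} {x : M}
    (hX : DiffVectorFieldAt X x) (hY : DiffVectorFieldAt Y x) :
    chartDeriv x x (VectorField.mlieBracket 𝓘(ℝ, E) X Y x)
      = mvfderiv 𝓘(ℝ, E) (fun y ↦ chartDeriv x y (Y y)) x (X x)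
        - mvfderiv 𝓘(ℝ, E) (fun y ↦ chartDeriv x y (X y)) x (Y x) := by
  rw [mdifferentiableAt_section_iff'] at hX hY
  rw [mvfderiv_eq_fderiv hX, mvfderiv_eq_fderiv hY]
  have key : ∀ Z : ∀ x : M, TangentSpace 𝓘(ℝ, E) x,
      VectorField.mpullbackWithin 𝓘(ℝ, E) 𝓘(ℝ, E) (extChartAt 𝓘(ℝ, E) x).symm Z Set.univ
      =ᶠ[𝓝 (extChartAt 𝓘(ℝ, E) x x)]
        (fun y ↦ chartDeriv x y (Z y)) ∘ (extChartAt 𝓘(ℝ, E) x).symm := by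
    intro Z
    filter_upwards [extChartAt_target_mem_nhds (I := 𝓘(ℝ, E)) x] with z hz
    have hz' : (extChartAt 𝓘(ℝ, E) x).symm z ∈ (chartAt E x).source := by
      simpa using (extChartAt 𝓘(ℝ, E) x).map_target hz
    have e1 := mfderiv_extChartAt_comp_mfderivWithin_extChartAt_symm (I := 𝓘(ℝ, E)) hz
    have e2 := mfderivWithin_extChartAt_symm_comp_mfderiv_extChartAt (I := 𝓘(ℝ, E)) hz
    simp only [modelWithCornersSelf_coe, Set.range_id] at e1 e2
    rw [VectorField.mpullbackWithin_apply, ContinuousLinearMap.inverse_eq e2 e1]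
    rfl
  have hid : (mfderiv 𝓘(ℝ, E) 𝓘(ℝ, E) (extChartAt 𝓘(ℝ, E) x) x).inverse
      = ContinuousLinearMap.id ℝ E := by
    rw [mfderiv_extChartAt_self]; exact ContinuousLinearMap.inverse_id
  rw [chartDeriv_self, ← VectorField.mlieBracketWithin_univ, VectorField.mlieBracketWithin_apply]
  refine (congr($hid _)).trans ?_
  simp only [modelWithCornersSelf_coe, Set.range_id, Set.preimage_univ, Set.univ_inter]
  refine (lieBracketWithin_univ_congr (key X) (key Y)).trans ?_
  simp only [Function.comp_apply]
  rw [extChartAt_to_inv]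

lemma mvfderiv_mvfderiv_apply {u : M → F} {x : M} (hu : ContMDiffAt 𝓘(ℝ, E) 𝓘(ℝ, F) 2 u x)
    {Z : ∀ x : M, TangentSpace 𝓘(ℝ, E) x} (hZ : DiffVectorFieldAt Z x)
    (v : TangentSpace 𝓘(ℝ, E) x) :
    mvfderiv 𝓘(ℝ, E) (fun y ↦ mvfderiv 𝓘(ℝ, E) u y (Z y)) x v
      = fderiv ℝ (fderiv ℝ (u ∘ (extChartAt 𝓘(ℝ, E) x).symm)) (extChartAt 𝓘(ℝ, E) x x)
          (chartDeriv x x v) (chartDeriv x x (Z x))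
        + fderiv ℝ (u ∘ (extChartAt 𝓘(ℝ, E) x).symm) (extChartAt 𝓘(ℝ, E) x x) (mvfderiv 𝓘(ℝ, E) (fun y ↦ chartDeriv x y (Z y)) x v) := by
  have hf := mvfderiv_chart_factor hu
  have hZ' := mdifferentiableAt_section_iff'.1 hZ
  rw [mvfderiv_eq_fderiv (mdifferentiableAt_mvfderiv_apply hu hZ), mvfderiv_eq_fderiv hZ']
  have h1 : (fun y ↦ mvfderiv 𝓘(ℝ, E) u y (Z y)) ∘ (extChartAt 𝓘(ℝ, E) x).symm
      =ᶠ[𝓝 (extChartAt 𝓘(ℝ, E) x x)] fun z ↦ fderiv ℝ (u ∘ (extChartAt 𝓘(ℝ, E) x).symm) z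
        (((fun y ↦ chartDeriv x y (Z y)) ∘ (extChartAt 𝓘(ℝ, E) x).symm) z) := by
    have h2 := (continuousAt_extChartAt_symm (I := 𝓘(ℝ, E)) x).eventually
      (by rw [extChartAt_to_inv]; exact hf)
    filter_upwards [extChartAt_target_mem_nhds (I := 𝓘(ℝ, E)) x, h2] with z hz h2
    simp only [Function.comp_apply, h2]
    rw [(extChartAt 𝓘(ℝ, E) x).right_inv hz]
  have h3 : DifferentiableAt ℝ (fderiv ℝ (u ∘ (extChartAt 𝓘(ℝ, E) x).symm))
      (extChartAt 𝓘(ℝ, E) x x) :=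
    ((contDiffAt_comp_extChartAt_symm hu).fderiv_right (m := 1) (by norm_num)).differentiableAt
      one_ne_zero
  rw [h1.fderiv_eq, fderiv_clm_apply h3 (differentiableAt_comp_extChartAt_symm hZ')]
  simp only [Function.comp_apply, _root_.add_apply, ContinuousLinearMap.comp_apply,
    ContinuousLinearMap.flip_apply]
  rw [extChartAt_to_inv, add_comm]

/-- The second derivatives of `u` cancel by symmetry and the first-order terms assemble to the
bracket. Both the torsion identity along `f` and the skewness of the curvature rest on this. -/
lemma mvfderiv_mlieBracket {u : M → F} {x : M} (hu : ContMDiffAt 𝓘(ℝ, E) 𝓘(ℝ, F) 2 u x)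
    {X Y : ∀ x : M, TangentSpace 𝓘(ℝ, E) x} (hX : DiffVectorFieldAt X x)
    (hY : DiffVectorFieldAt Y x) :
    mvfderiv 𝓘(ℝ, E) (fun y ↦ mvfderiv 𝓘(ℝ, E) u y (Y y)) x (X x)
      - mvfderiv 𝓘(ℝ, E) (fun y ↦ mvfderiv 𝓘(ℝ, E) u y (X y)) x (Y x)
      = mvfderiv 𝓘(ℝ, E) u x (VectorField.mlieBracket 𝓘(ℝ, E) X Y x) := by
  rw [mvfderiv_mvfderiv_apply hu hX, mvfderiv_mvfderiv_apply hu hY,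
    (mvfderiv_chart_factor hu).self_of_nhds, mlieBracket_eq hX hY, map_sub]
  have hs : IsSymmSndFDerivAt ℝ (u ∘ (extChartAt 𝓘(ℝ, E) x).symm) (extChartAt 𝓘(ℝ, E) x x) :=
    (contDiffAt_comp_extChartAt_symm hu).isSymmSndFDerivAt (by simp)
  rw [hs.eq (chartDeriv x x (X x))]
  abel

end Bracket

/-! ### Constructing vector fields from coordinates -/

section Fields

variable {E : Type*} [NormedAddCommGroup E] [NormedSpace ℝ E]
  {M : Type*} [TopologicalSpace M] [ChartedSpace E M] [IsManifold 𝓘(ℝ, E) ∞ M]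
  {F : Type*} [NormedAddCommGroup F] [NormedSpace ℝ F]
  {N : Type*} [TopologicalSpace N] [ChartedSpace F N] [IsManifold 𝓘(ℝ, F) ∞ N]

/-- The inverse of `chartDeriv`. -/
noncomputable def coordInv (p q : M) : E →L[ℝ] TangentSpace 𝓘(ℝ, E) q :=
  (trivializationAt E (TangentSpace 𝓘(ℝ, E)) p).symmL ℝ q

lemma chartDeriv_coordInv {p q : M} (hq : q ∈ (chartAt E p).source) (w : E) :
    chartDeriv p q (coordInv p q w) = w := by
  rw [coordInv, Trivialization.symmL_apply _ (by simpa using hq), chartDeriv_symm hq]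

lemma coordInv_chartDeriv {p q : M} (hq : q ∈ (chartAt E p).source) (v : TangentSpace 𝓘(ℝ, E) q) :
    coordInv p q (chartDeriv p q v) = v :=
  chartDeriv_injective hq (chartDeriv_coordInv hq _)

lemma coordInv_chartDeriv_self (p : M) (v : TangentSpace 𝓘(ℝ, E) p) :
    coordInv p p (chartDeriv p p v) = v :=
  coordInv_chartDeriv (mem_chart_source E p) v

/-- The vector field with constant coordinates in the preferred chart at `p`. -/
noncomputable def coordField (p : M) (w : E) (q : M) : TangentSpace 𝓘(ℝ, E) q := coordInv p q w

lemma smoothVectorFieldAt_iff_of_mem {X : ∀ x : M, TangentSpace 𝓘(ℝ, E) x} {p x : M}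
    (hx : x ∈ (chartAt E p).source) :
    SmoothVectorFieldAt X x
    ↔ ContMDiffAt 𝓘(ℝ, E) 𝓘(ℝ, E) ∞ (fun y ↦ chartDeriv p y (X y)) x := by
  rw [SmoothVectorFieldAt, (trivializationAt E (TangentSpace 𝓘(ℝ, E)) p).contMDiffAt_section_iff (by simpa using hx)]
  exact Filter.EventuallyEq.contMDiffAt_iff
    (Filter.eventually_of_mem ((chartAt E p).open_source.mem_nhds hx) fun y hy ↦ trivializationAt_snd hy _)

lemma SmoothVectorFieldAt.diff {X : ∀ x : M, TangentSpace 𝓘(ℝ, E) x} {x : M}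
    (hX : SmoothVectorFieldAt X x) : DiffVectorFieldAt X x :=
  hX.mdifferentiableAt (by simp)

lemma SmoothVectorFieldAt.eventually_diff {X : ∀ x : M, TangentSpace 𝓘(ℝ, E) x} {x : M}
    (hX : SmoothVectorFieldAt X x) : ∀ᶠ y in 𝓝 x, DiffVectorFieldAt X y :=
  ((contMDiffAt_iff_contMDiffAt_nhds (n := 1) (by simp)).1
    (hX.of_le (n := ∞) (m := 1) (by exact_mod_cast le_top))).mono fun y hy ↦
    hy.mdifferentiableAt one_ne_zero

/-- The vector field whose coordinates in the preferred chart at `p` are given by `c`. -/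
noncomputable def fieldOfCoord (p : M) (c : M → E) (q : M) : TangentSpace 𝓘(ℝ, E) q :=
  coordInv p q (c q)

lemma chartDeriv_fieldOfCoord (p : M) (c : M → E) :
    (fun q ↦ chartDeriv p q (fieldOfCoord p c q)) =ᶠ[𝓝 p] c :=
  (eventually_mem_chart p).mono fun _ hq ↦ chartDeriv_coordInv hq _

lemma smooth_fieldOfCoord {p : M} {c : M → E} (hc : ContMDiffAt 𝓘(ℝ, E) 𝓘(ℝ, E) ∞ c p) :
    SmoothVectorFieldAt (fieldOfCoord p c) p :=
  (smoothVectorFieldAt_iff_of_mem (mem_chart_source E p)).2 (hc.congr_of_eventuallyEq (chartDeriv_fieldOfCoord p c))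

lemma diff_fieldOfCoord {p : M} {c : M → E} (hc : MDifferentiableAt 𝓘(ℝ, E) 𝓘(ℝ, E) c p) :
    DiffVectorFieldAt (fieldOfCoord p c) p :=
  mdifferentiableAt_section_iff'.2 (hc.congr_of_eventuallyEq (chartDeriv_fieldOfCoord p c))

lemma smooth_coordField_of_mem {p q : M} (hq : q ∈ (chartAt E p).source) (w : E) :
    SmoothVectorFieldAt (coordField p w) q := by
  refine (smoothVectorFieldAt_iff_of_mem hq).2
    ((contMDiffAt_const (c := w)).congr_of_eventuallyEq ?_)
  exact Filter.eventually_of_mem ((chartAt E p).open_source.mem_nhds hq) fun y hy ↦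
    chartDeriv_coordInv hy _

lemma smooth_coordField (p : M) (w : E) : SmoothVectorFieldAt (coordField p w) p :=
  smooth_coordField_of_mem (mem_chart_source E p) w

lemma coordField_self (p : M) (v : TangentSpace 𝓘(ℝ, E) p) :
    coordField p (chartDeriv p p v) p = v := coordInv_chartDeriv_self p v

lemma SmoothVectorFieldAt.add {X Y : ∀ x : M, TangentSpace 𝓘(ℝ, E) x} {x : M}
    (hX : SmoothVectorFieldAt X x) (hY : SmoothVectorFieldAt Y x) :
    SmoothVectorFieldAt (X + Y) x :=
  ContMDiffAt.add_section hX hY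

lemma SmoothVectorFieldAt.smul {X : ∀ x : M, TangentSpace 𝓘(ℝ, E) x} {x : M} {h : M → ℝ}
    (hh : ContMDiffAt 𝓘(ℝ, E) 𝓘(ℝ, ℝ) ∞ h x)
    (hX : SmoothVectorFieldAt X x) : SmoothVectorFieldAt (h • X) x :=
  hh.smul_section hX

end Fields

/-! ### Locality and coordinate form of a connection -/

section Connection

variable {E : Type*} [NormedAddCommGroup E] [NormedSpace ℝ E]
  {M : Type*} [TopologicalSpace M] [ChartedSpace E M] [IsManifold 𝓘(ℝ, E) ∞ M]
  {F : Type*} [NormedAddCommGroup F] [NormedSpace ℝ F] [FiniteDimensional ℝ F]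
  {N : Type*} [TopologicalSpace N] [ChartedSpace F N] [IsManifold 𝓘(ℝ, F) ∞ N]

omit [FiniteDimensional ℝ F] in
lemma connection_congr (D : Connection F N) {Y Y' : ∀ p : N, TangentSpace 𝓘(ℝ, F) p} {p : N}
    (hY : DiffVectorFieldAt Y p) (h : ∀ᶠ q in 𝓝 p, Y q = Y' q) : D Y p = D Y' p := by
  have hY' : DiffVectorFieldAt Y' p :=
    hY.congr_of_eventuallyEq (h.mono fun q hq ↦ by simp [hq])
  exact (D.isCovariantDerivativeOnUniv).congr_of_eventuallyEq hY hY' Filter.univ_mem h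

omit [FiniteDimensional ℝ F] in
lemma connection_add (D : Connection F N) {Y Y' : ∀ p : N, TangentSpace 𝓘(ℝ, F) p} {p : N}
    (hY : DiffVectorFieldAt Y p) (hY' : DiffVectorFieldAt Y' p) :
    D (Y + Y') p = D Y p + D Y' p := D.isCovariantDerivativeOnUniv.add hY hY'

omit [FiniteDimensional ℝ F] in
lemma connection_smul (D : Connection F N) {Y : ∀ p : N, TangentSpace 𝓘(ℝ, F) p} {p : N}
    {h : N → ℝ} (hY : DiffVectorFieldAt Y p) (hh : MDifferentiableAt 𝓘(ℝ, F) 𝓘(ℝ, ℝ) h p)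
    (v : TangentSpace 𝓘(ℝ, F) p) :
    D (h • Y) p v = h p • D Y p v + mvfderiv 𝓘(ℝ, F) h p v • Y p := by
  rw [D.isCovariantDerivativeOnUniv.leibniz hY hh]; rfl

/-- The covariant derivative at a point in coordinates. -/
lemma connection_eq (D : Connection F N) {Y : ∀ p : N, TangentSpace 𝓘(ℝ, F) p} {p : N}
    (hY : DiffVectorFieldAt Y p) (v : TangentSpace 𝓘(ℝ, F) p) :
    D Y p v = coordInv p p (mvfderiv 𝓘(ℝ, F) (fun q ↦ chartDeriv p q (Y q)) p v)
      + D (coordField p (chartDeriv p p (Y p))) p v := by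
  -- The difference between `D` and the coordinate derivative is tensorial, so it may be evaluated
  -- on a field with constant coordinates, whose coordinate derivative is zero.
  have hT : TensorialAt 𝓘(ℝ, F) F (fun Y : ∀ p : N, TangentSpace 𝓘(ℝ, F) p ↦ D Y p v
      - coordInv p p (mvfderiv 𝓘(ℝ, F) (fun q ↦ chartDeriv p q (Y q)) p v)) p := by
    refine ⟨fun {h Y} hh hY ↦ ?_, fun {Y Y'} hY hY' ↦ ?_⟩
    · have e1 : (fun q ↦ chartDeriv p q ((h • Y) q)) = h • fun q ↦ chartDeriv p q (Y q) := by
        ext q; simp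
      rw [connection_smul D hY hh, e1, mvfderiv_smul hh (mdifferentiableAt_section_iff'.1 hY)]
      simp only [_root_.add_apply, _root_.smul_apply,
        ContinuousLinearMap.smulRight_apply, map_add, map_smul, coordInv_chartDeriv_self]
      module
    · have e1 : (fun q ↦ chartDeriv p q ((Y + Y') q))
          = (fun q ↦ chartDeriv p q (Y q)) + fun q ↦ chartDeriv p q (Y' q) := by
        ext q; simp
      rw [connection_add D hY hY', e1, mvfderiv_add (mdifferentiableAt_section_iff'.1 hY)
        (mdifferentiableAt_section_iff'.1 hY')]
      simp only [_root_.add_apply, map_add]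
      abel
  have h1 := hT.pointwise hY (smooth_coordField p (chartDeriv p p (Y p))).diff
    (coordField_self p (Y p)).symm
  have e2 : mvfderiv 𝓘(ℝ, F) (fun q ↦ chartDeriv p q (coordField p (chartDeriv p p (Y p)) q)) p
      = 0 := by
    exact (mvfderiv_congr (chartDeriv_fieldOfCoord p fun _ ↦ chartDeriv p p (Y p))).trans
      (mvfderiv_const _)
  simp only [e2] at h1
  rw [sub_eq_iff_eq_add] at h1
  rw [h1]
  simp [add_comm]

end Connection

lemma two_le_infty : (2 : ℕ∞ω) ≤ ∞ := ENat.LEInfty.out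

/-! ### Vector fields along an immersion and local retractions -/

section Along

variable {E : Type*} [NormedAddCommGroup E] [NormedSpace ℝ E]
  {M : Type*} [TopologicalSpace M] [ChartedSpace E M] [IsManifold 𝓘(ℝ, E) ∞ M]
  {F : Type*} [NormedAddCommGroup F] [NormedSpace ℝ F]
  {N : Type*} [TopologicalSpace N] [ChartedSpace F N] [IsManifold 𝓘(ℝ, F) ∞ N]

/-- The vector field `Z` along `f` is differentiable at `x`. -/
def DiffAlong (f : M → N) (Z : ∀ y : M, TangentSpace 𝓘(ℝ, F) (f y)) (x : M) : Prop :=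
  MDifferentiableAt 𝓘(ℝ, E) 𝓘(ℝ, F) (fun y ↦ chartDeriv (f x) (f y) (Z y)) x

/-- The vector field `Z` along `f` is smooth at `x`. -/
def SmoothAlong (f : M → N) (Z : ∀ y : M, TangentSpace 𝓘(ℝ, F) (f y)) (x : M) : Prop :=
  ContMDiffAt 𝓘(ℝ, E) 𝓘(ℝ, F) ∞ (fun y ↦ chartDeriv (f x) (f y) (Z y)) x

variable {f : M → N} {x : M} {Z Z' : ∀ y : M, TangentSpace 𝓘(ℝ, F) (f y)}

omit [IsManifold 𝓘(ℝ, E) ∞ M] [IsManifold 𝓘(ℝ, F) ∞ N] in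
lemma SmoothAlong.diff (h : SmoothAlong (E := E) f Z x) : DiffAlong (E := E) f Z x :=
  ContMDiffAt.mdifferentiableAt h (by simp)

omit [IsManifold 𝓘(ℝ, E) ∞ M] [IsManifold 𝓘(ℝ, F) ∞ N] in
lemma DiffAlong.congr (h : DiffAlong (E := E) f Z x) (hZ : ∀ᶠ y in 𝓝 x, Z' y = Z y) :
    DiffAlong (E := E) f Z' x :=
  h.congr_of_eventuallyEq (hZ.mono fun y hy ↦ by simp [hy])

omit [IsManifold 𝓘(ℝ, E) ∞ M] [IsManifold 𝓘(ℝ, F) ∞ N] in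
lemma SmoothAlong.congr (h : SmoothAlong (E := E) f Z x) (hZ : ∀ᶠ y in 𝓝 x, Z' y = Z y) :
    SmoothAlong (E := E) f Z' x :=
  ContMDiffAt.congr_of_eventuallyEq h (hZ.mono fun y hy ↦ by simp [hy])

omit [IsManifold 𝓘(ℝ, E) ∞ M] in
lemma SmoothVectorFieldAt.comp {Y : ∀ p : N, TangentSpace 𝓘(ℝ, F) p}
    (hf : ContMDiffAt 𝓘(ℝ, E) 𝓘(ℝ, F) ∞ f x) (hY : SmoothVectorFieldAt Y (f x)) :
    SmoothAlong (E := E) f (fun y ↦ Y (f y)) x :=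
  ContMDiffAt.comp x ((smoothVectorFieldAt_iff_of_mem (mem_chart_source F (f x))).1 hY) hf

lemma eventually_mdifferentiableAt (hf : ContMDiffAt 𝓘(ℝ, E) 𝓘(ℝ, F) ∞ f x) :
    ∀ᶠ y in 𝓝 x, MDifferentiableAt 𝓘(ℝ, E) 𝓘(ℝ, F) f y :=
  ((contMDiffAt_iff_contMDiffAt_nhds (n := 1) (by simp)).1
    (hf.of_le (by exact_mod_cast le_top))).mono fun _ hy ↦ hy.mdifferentiableAt one_ne_zero

omit [IsManifold 𝓘(ℝ, E) ∞ M] in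
lemma contMDiffAt_extChartAt_comp {p : N} (hf : ContMDiffAt 𝓘(ℝ, E) 𝓘(ℝ, F) ∞ f x)
    (hp : f x ∈ (chartAt F p).source) :
    ContMDiffAt 𝓘(ℝ, E) 𝓘(ℝ, F) ∞ (extChartAt 𝓘(ℝ, F) p ∘ f) x :=
  ContMDiffAt.comp x (contMDiffAt_extChartAt' hp) hf

lemma chartDeriv_mfderiv (hf : ContMDiffAt 𝓘(ℝ, E) 𝓘(ℝ, F) ∞ f x) :
    ∀ᶠ y in 𝓝 x, ∀ v : TangentSpace 𝓘(ℝ, E) y,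
      chartDeriv (f x) (f y) (mfderiv 𝓘(ℝ, E) 𝓘(ℝ, F) f y v)
        = mvfderiv 𝓘(ℝ, E) (extChartAt 𝓘(ℝ, F) (f x) ∘ f) y v := by
  filter_upwards [eventually_mdifferentiableAt hf,
    hf.continuousAt.eventually (eventually_mem_chart (E := F) (f x))] with y hy hys v
  exact (mvfderiv_comp_eq y (mdifferentiableAt_extChartAt hys) hy v).symm

lemma DiffVectorFieldAt.map (hf : ContMDiffAt 𝓘(ℝ, E) 𝓘(ℝ, F) ∞ f x)
    {X : ∀ y : M, TangentSpace 𝓘(ℝ, E) y} (hX : DiffVectorFieldAt X x) :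
    DiffAlong (E := E) f (fun y ↦ mfderiv 𝓘(ℝ, E) 𝓘(ℝ, F) f y (X y)) x := by
  have h1 := mdifferentiableAt_mvfderiv_apply
    ((contMDiffAt_extChartAt_comp hf (mem_chart_source F (f x))).of_le (m := 2) two_le_infty) hX
  exact h1.congr_of_eventuallyEq ((chartDeriv_mfderiv hf).mono fun y hy ↦ hy _)

lemma SmoothVectorFieldAt.map (hf : ContMDiffAt 𝓘(ℝ, E) 𝓘(ℝ, F) ∞ f x)
    {X : ∀ y : M, TangentSpace 𝓘(ℝ, E) y} (hX : SmoothVectorFieldAt X x) :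
    SmoothAlong (E := E) f (fun y ↦ mfderiv 𝓘(ℝ, E) 𝓘(ℝ, F) f y (X y)) x := by
  have h1 := contMDiffAt_mvfderiv_apply (n := ∞)
    (contMDiffAt_extChartAt_comp hf (mem_chart_source F (f x))) (by simp) hX
  exact h1.congr_of_eventuallyEq ((chartDeriv_mfderiv hf).mono fun y hy ↦ hy _)

/-- A smooth local left inverse of `f` near `x`. -/
structure IsLocalRetraction (f : M → N) (x : M) (r : N → M) : Prop where
  smooth : ContMDiffAt 𝓘(ℝ, F) 𝓘(ℝ, E) ∞ r (f x)
  left_inv : ∀ᶠ y in 𝓝 x, r (f y) = y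

omit [IsManifold 𝓘(ℝ, E) ∞ M] [IsManifold 𝓘(ℝ, F) ∞ N] in
lemma IsLocalRetraction.apply_self {r : N → M} (hr : IsLocalRetraction (E := E) (F := F) f x r) :
    r (f x) = x := hr.left_inv.self_of_nhds

-- In adapted charts an immersion is the inclusion of a factor of a product; the retraction is the
-- projection onto that factor.
omit [IsManifold 𝓘(ℝ, E) ∞ M] [IsManifold 𝓘(ℝ, F) ∞ N] in
lemma exists_localRetraction (hf : Manifold.IsImmersionAt 𝓘(ℝ, E) 𝓘(ℝ, F) ∞ f x) :
    ∃ r : N → M, IsLocalRetraction (E := E) (F := F) f x r := by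
  let c : N → E := fun q ↦ (hf.equiv.symm (hf.codChart q)).1
  have hc : ∀ y ∈ hf.domChart.source, c (f y) = hf.domChart y := fun y hy ↦ by
    have h1 := hf.writtenInCharts (show hf.domChart y ∈ (hf.domChart.extend 𝓘(ℝ, E)).target by
      simpa using hf.domChart.map_source hy)
    simp only [Function.comp_apply, OpenPartialHomeomorph.extend_coe,
      OpenPartialHomeomorph.extend_coe_symm, modelWithCornersSelf_coe,
      modelWithCornersSelf_coe_symm, id, hf.domChart.left_inv hy] at h1
    simp only [c]
    rw [h1, ContinuousLinearEquiv.symm_apply_apply]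
  refine ⟨fun q ↦ hf.domChart.symm (c q), ?_, ?_⟩
  · have h1 : ContMDiffAt 𝓘(ℝ, F) 𝓘(ℝ, F) ∞ hf.codChart (f x) :=
      contMDiffAt_of_mem_maximalAtlas hf.codChart_mem_maximalAtlas hf.mem_codChart_source
    have h2 : ContMDiffAt 𝓘(ℝ, F) 𝓘(ℝ, E) ∞ c (f x) := by
      have h3 : ContMDiff 𝓘(ℝ, F) 𝓘(ℝ, E) ∞ (fun w : F ↦ (hf.equiv.symm w).1) :=
        (contDiff_fst.comp hf.equiv.symm.contDiff).contMDiff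
      exact (h3 _).comp (f x) h1
    have h4 : ContMDiffAt 𝓘(ℝ, E) 𝓘(ℝ, E) ∞ hf.domChart.symm (c (f x)) := by
      refine contMDiffAt_symm_of_mem_maximalAtlas hf.domChart_mem_maximalAtlas ?_
      rw [hc x hf.mem_domChart_source]
      exact hf.domChart.map_source hf.mem_domChart_source
    exact h4.comp (f x) h2
  · filter_upwards [hf.domChart.open_source.mem_nhds hf.mem_domChart_source] with y hy
    rw [hc y hy, hf.domChart.left_inv hy]

/-- The extension of a vector field along `f`, by means of a retraction `r`. -/
noncomputable def extendAlong (f : M → N) (r : N → M) (x : M)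
    (Z : ∀ y : M, TangentSpace 𝓘(ℝ, F) (f y)) : ∀ p : N, TangentSpace 𝓘(ℝ, F) p :=
  fieldOfCoord (f x) fun q ↦ chartDeriv (f x) (f (r q)) (Z (r q))

section Retraction

variable {r : N → M} (hr : IsLocalRetraction (E := E) (F := F) f x r)
include hr

omit [IsManifold 𝓘(ℝ, E) ∞ M] in
lemma extendAlong_apply (hf : ContinuousAt f x) :
    ∀ᶠ y in 𝓝 x, extendAlong f r x Z (f y) = Z y := by
  filter_upwards [hf.eventually (eventually_mem_chart (E := F) (f x)), hr.left_inv] with y hy hry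
  simp only [extendAlong, fieldOfCoord]
  rw [hry, coordInv_chartDeriv hy]

omit [IsManifold 𝓘(ℝ, E) ∞ M] in
lemma smooth_extendAlong (hZ : SmoothAlong (E := E) f Z x) :
    SmoothVectorFieldAt (extendAlong f r x Z) (f x) :=
  smooth_fieldOfCoord (ContMDiffAt.comp_of_eq hZ hr.smooth hr.apply_self)

omit [IsManifold 𝓘(ℝ, E) ∞ M] in
lemma diff_extendAlong (hZ : DiffAlong (E := E) f Z x) :
    DiffVectorFieldAt (extendAlong f r x Z) (f x) :=
  diff_fieldOfCoord (MDifferentiableAt.comp_of_eq (f x) hZ (hr.smooth.mdifferentiableAt (by simp))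
    hr.apply_self)

/-- Differentiating `r ∘ f = id` shows how a tangent vector is recovered from its image. This yields
injectivity of `df` and lets regularity of `df(X)` be pulled back to `X`. -/
lemma chartDeriv_eq_of_retraction (hf : ContMDiffAt 𝓘(ℝ, E) 𝓘(ℝ, F) ∞ f x) :
    ∀ᶠ y in 𝓝 x, ∀ v : TangentSpace 𝓘(ℝ, E) y, chartDeriv x y v
      = mvfderiv 𝓘(ℝ, F) (extChartAt 𝓘(ℝ, E) x ∘ r) (f y) (mfderiv 𝓘(ℝ, E) 𝓘(ℝ, F) f y v) := by
  have h1 := hf.continuousAt.eventually (eventually_mdifferentiableAt hr.smooth)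
  filter_upwards [h1, eventually_mdifferentiableAt hf, eventually_mem_chart (E := E) x,
    eventually_eventually_nhds.2 hr.left_inv, hr.left_inv] with y hy hfy hys hry hry' v
  have h2 : MDifferentiableAt 𝓘(ℝ, F) 𝓘(ℝ, E) (extChartAt 𝓘(ℝ, E) x ∘ r) (f y) :=
    MDifferentiableAt.comp (f y) (mdifferentiableAt_extChartAt (by rw [hry']; exact hys)) hy
  rw [← mvfderiv_comp_eq y h2 hfy, chartDeriv]
  have h3 : extChartAt 𝓘(ℝ, E) x =ᶠ[𝓝 y] (extChartAt 𝓘(ℝ, E) x ∘ r) ∘ f :=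
    hry.mono fun z hz ↦ by simp [hz]
  rw [mvfderiv_congr h3]

lemma smooth_of_smoothAlong_map (hf : ContMDiffAt 𝓘(ℝ, E) 𝓘(ℝ, F) ∞ f x)
    {X : ∀ y : M, TangentSpace 𝓘(ℝ, E) y}
    (hX : SmoothAlong (E := E) f (fun y ↦ mfderiv 𝓘(ℝ, E) 𝓘(ℝ, F) f y (X y)) x) :
    SmoothVectorFieldAt X x := by
  have h1 : ContMDiffAt 𝓘(ℝ, F) 𝓘(ℝ, E) ∞ (extChartAt 𝓘(ℝ, E) x ∘ r) (f x) :=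
    contMDiffAt_extChartAt_comp hr.smooth (by rw [hr.apply_self]; exact mem_chart_source E x)
  have h2 := (contMDiffAt_mvfderiv_apply (n := ∞) h1 (by simp) (smooth_extendAlong hr hX)).comp x hf
  refine (smoothVectorFieldAt_iff_of_mem (mem_chart_source E x)).2 (h2.congr_of_eventuallyEq ?_)
  filter_upwards [chartDeriv_eq_of_retraction hr hf,
    extendAlong_apply (Z := fun y ↦ mfderiv 𝓘(ℝ, E) 𝓘(ℝ, F) f y (X y)) hr hf.continuousAt]
    with y hy hy'
  rw [hy, Function.comp_apply, hy']

lemma diff_of_diffAlong_map (hf : ContMDiffAt 𝓘(ℝ, E) 𝓘(ℝ, F) ∞ f x)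
    {X : ∀ y : M, TangentSpace 𝓘(ℝ, E) y}
    (hX : DiffAlong (E := E) f (fun y ↦ mfderiv 𝓘(ℝ, E) 𝓘(ℝ, F) f y (X y)) x) :
    DiffVectorFieldAt X x := by
  have h1 : ContMDiffAt 𝓘(ℝ, F) 𝓘(ℝ, E) ∞ (extChartAt 𝓘(ℝ, E) x ∘ r) (f x) :=
    contMDiffAt_extChartAt_comp hr.smooth (by rw [hr.apply_self]; exact mem_chart_source E x)
  have h2 := (mdifferentiableAt_mvfderiv_apply (h1.of_le (m := 2) two_le_infty)
    (diff_extendAlong hr hX)).comp x (hf.mdifferentiableAt (by simp))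
  refine mdifferentiableAt_section_iff'.2 (h2.congr_of_eventuallyEq ?_)
  filter_upwards [chartDeriv_eq_of_retraction hr hf,
    extendAlong_apply (Z := fun y ↦ mfderiv 𝓘(ℝ, E) 𝓘(ℝ, F) f y (X y)) hr hf.continuousAt]
    with y hy hy'
  rw [hy, Function.comp_apply, hy']

lemma eventually_mfderiv_injective (hf : ContMDiffAt 𝓘(ℝ, E) 𝓘(ℝ, F) ∞ f x) :
    ∀ᶠ y in 𝓝 x, Function.Injective (mfderiv 𝓘(ℝ, E) 𝓘(ℝ, F) f y) := by
  filter_upwards [chartDeriv_eq_of_retraction hr hf, eventually_mem_chart (E := E) x] with y hy hys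
  intro v w hvw
  exact chartDeriv_injective hys (by rw [hy, hy, hvw])

end Retraction

end Along

/-! ### Covariant derivatives along an immersion -/

section AlongDerivative

variable {E : Type*} [NormedAddCommGroup E] [NormedSpace ℝ E]
  {M : Type*} [TopologicalSpace M] [ChartedSpace E M] [IsManifold 𝓘(ℝ, E) ∞ M]
  {F : Type*} [NormedAddCommGroup F] [NormedSpace ℝ F]
  {N : Type*} [TopologicalSpace N] [ChartedSpace F N] [IsManifold 𝓘(ℝ, F) ∞ N]

/-- The covariant derivative at `x` of a vector field `Z` along `f`. -/
noncomputable def alongDeriv (D : Connection F N) (f : M → N)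
    (Z : ∀ y : M, TangentSpace 𝓘(ℝ, F) (f y)) (x : M) :
    TangentSpace 𝓘(ℝ, E) x →L[ℝ] TangentSpace 𝓘(ℝ, F) (f x) :=
  coordInv (f x) (f x) ∘L mvfderiv 𝓘(ℝ, E) (fun y ↦ chartDeriv (f x) (f y) (Z y)) x
    + D (coordField (f x) (chartDeriv (f x) (f x) (Z x))) (f x) ∘L mfderiv 𝓘(ℝ, E) 𝓘(ℝ, F) f x

variable {D : Connection F N} {f : M → N} {x : M} {Z Z' : ∀ y : M, TangentSpace 𝓘(ℝ, F) (f y)}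

omit [IsManifold 𝓘(ℝ, E) ∞ M] in
lemma alongDeriv_apply (v : TangentSpace 𝓘(ℝ, E) x) : alongDeriv D f Z x v
    = coordInv (f x) (f x) (mvfderiv 𝓘(ℝ, E) (fun y ↦ chartDeriv (f x) (f y) (Z y)) x v)
      + D (coordField (f x) (chartDeriv (f x) (f x) (Z x))) (f x)
          (mfderiv 𝓘(ℝ, E) 𝓘(ℝ, F) f x v) := rfl

omit [IsManifold 𝓘(ℝ, E) ∞ M] in
lemma alongDeriv_congr (h : ∀ᶠ y in 𝓝 x, Z y = Z' y) :
    (alongDeriv D f Z x : TangentSpace 𝓘(ℝ, E) x →L[ℝ] _) = alongDeriv D f Z' x := by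
  have h1 : (fun y ↦ chartDeriv (f x) (f y) (Z y)) =ᶠ[𝓝 x]
      fun y ↦ chartDeriv (f x) (f y) (Z' y) := h.mono fun y hy ↦ by simp [hy]
  rw [alongDeriv, alongDeriv, mvfderiv_congr h1, h.self_of_nhds]

lemma coordField_add (p : N) (w w' : F) : coordField p (w + w') = coordField p w + coordField p w' := by
  ext q; exact map_add (coordInv p q) w w'

lemma coordField_smul (p : N) (c : ℝ) (w : F) : coordField p (c • w) = c • coordField p w := by
  ext q; exact map_smul (coordInv p q) c w

lemma connection_coordField_add (p : N) (w w' : F) :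
    D (coordField p (w + w')) p = D (coordField p w) p + D (coordField p w') p := by
  rw [coordField_add, connection_add D (smooth_coordField p w).diff (smooth_coordField p w').diff]

lemma connection_coordField_smul (p : N) (c : ℝ) (w : F) :
    D (coordField p (c • w)) p = c • D (coordField p w) p := by
  rw [coordField_smul]
  exact D.isCovariantDerivativeOnUniv.smul_const c (smooth_coordField p w).diff

omit [IsManifold 𝓘(ℝ, E) ∞ M] in
lemma alongDeriv_add (hZ : DiffAlong (E := E) f Z x) (hZ' : DiffAlong (E := E) f Z' x)
    (v : TangentSpace 𝓘(ℝ, E) x) :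
    alongDeriv D f (fun y ↦ Z y + Z' y) x v = alongDeriv D f Z x v + alongDeriv D f Z' x v := by
  have e1 : (fun y ↦ chartDeriv (f x) (f y) (Z y + Z' y))
      = (fun y ↦ chartDeriv (f x) (f y) (Z y)) + fun y ↦ chartDeriv (f x) (f y) (Z' y) := by
    ext y; simp
  simp only [alongDeriv_apply]
  rw [e1, mvfderiv_add hZ hZ', map_add, connection_coordField_add]
  simp only [_root_.add_apply, map_add]
  abel

omit [IsManifold 𝓘(ℝ, E) ∞ M] in
lemma alongDeriv_smul {h : M → ℝ} (hh : MDifferentiableAt 𝓘(ℝ, E) 𝓘(ℝ, ℝ) h x)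
    (hZ : DiffAlong (E := E) f Z x) (v : TangentSpace 𝓘(ℝ, E) x) :
    alongDeriv D f (fun y ↦ h y • Z y) x v
      = h x • alongDeriv D f Z x v + mvfderiv 𝓘(ℝ, E) h x v • Z x := by
  have e1 : (fun y ↦ chartDeriv (f x) (f y) (h y • Z y))
      = h • fun y ↦ chartDeriv (f x) (f y) (Z y) := by
    ext y; simp
  simp only [alongDeriv_apply]
  rw [e1, mvfderiv_smul hh hZ, map_smul, connection_coordField_smul]
  simp only [_root_.add_apply, map_add, _root_.smul_apply, ContinuousLinearMap.smulRight_apply,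
    map_smul, coordInv_chartDeriv_self]
  module

variable [FiniteDimensional ℝ F]

-- The chain rule. Combined with extension through a retraction, it transfers properties of `D` to
-- derivatives along `f`.
omit [IsManifold 𝓘(ℝ, E) ∞ M] in
lemma alongDeriv_comp {Y : ∀ p : N, TangentSpace 𝓘(ℝ, F) p}
    (hf : MDifferentiableAt 𝓘(ℝ, E) 𝓘(ℝ, F) f x) (hY : DiffVectorFieldAt Y (f x))
    (h : ∀ᶠ y in 𝓝 x, Z y = Y (f y)) (v : TangentSpace 𝓘(ℝ, E) x) :
    alongDeriv D f Z x v = D Y (f x) (mfderiv 𝓘(ℝ, E) 𝓘(ℝ, F) f x v) := by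
  rw [alongDeriv_congr h, alongDeriv_apply, connection_eq D hY]
  congr 2
  exact mvfderiv_comp_eq x (mdifferentiableAt_section_iff'.1 hY) hf v

-- The connection terms are symmetric because coordinate fields commute and `D` has no torsion; the
-- remaining coordinate derivatives give the bracket by `mvfderiv_mlieBracket`.
omit [FiniteDimensional ℝ F] in
lemma alongDeriv_torsion {g : FormField F N} (hD : IsLeviCivita g D)
    (hf : ContMDiffAt 𝓘(ℝ, E) 𝓘(ℝ, F) ∞ f x) {X Y : ∀ y : M, TangentSpace 𝓘(ℝ, E) y}
    (hX : DiffVectorFieldAt X x) (hY : DiffVectorFieldAt Y x) :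
    alongDeriv D f (fun y ↦ mfderiv 𝓘(ℝ, E) 𝓘(ℝ, F) f y (Y y)) x (X x)
      - alongDeriv D f (fun y ↦ mfderiv 𝓘(ℝ, E) 𝓘(ℝ, F) f y (X y)) x (Y x)
      = mfderiv 𝓘(ℝ, E) 𝓘(ℝ, F) f x (VectorField.mlieBracket 𝓘(ℝ, E) X Y x) := by
  have hc := chartDeriv_mfderiv hf
  have e1 : ∀ Y : ∀ y : M, TangentSpace 𝓘(ℝ, E) y,
      mvfderiv 𝓘(ℝ, E) (fun y ↦ chartDeriv (f x) (f y) (mfderiv 𝓘(ℝ, E) 𝓘(ℝ, F) f y (Y y))) x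
        = mvfderiv 𝓘(ℝ, E) (fun y ↦ mvfderiv 𝓘(ℝ, E) (extChartAt 𝓘(ℝ, F) (f x) ∘ f) y (Y y)) x :=
    fun Y ↦ mvfderiv_congr (hc.mono fun y hy ↦ hy _)
  have e2 : ∀ v w : TangentSpace 𝓘(ℝ, F) (f x),
      D (coordField (f x) (chartDeriv (f x) (f x) v)) (f x) w
        = D (coordField (f x) (chartDeriv (f x) (f x) w)) (f x) v := fun v w ↦ by
    have hv := (smooth_coordField (f x) (chartDeriv (f x) (f x) v)).diff
    have hw := (smooth_coordField (f x) (chartDeriv (f x) (f x) w)).diff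
    have h1 := hD.torsion_free _ _ (f x) hw hv
    have h0 : ∀ u : F, mvfderiv 𝓘(ℝ, F) (fun q ↦ chartDeriv (f x) q (coordField (f x) u q)) (f x)
        = 0 := fun u ↦
      (mvfderiv_congr (chartDeriv_fieldOfCoord (f x) fun _ ↦ u)).trans (mvfderiv_const _)
    have h2 : VectorField.mlieBracket 𝓘(ℝ, F) (coordField (f x) (chartDeriv (f x) (f x) w))
        (coordField (f x) (chartDeriv (f x) (f x) v)) (f x) = 0 := by
      refine chartDeriv_injective (mem_chart_source F (f x)) ?_
      rw [mlieBracket_eq hw hv, h0, h0]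
      simp
    rw [h2, coordField_self, coordField_self] at h1
    exact sub_eq_zero.1 h1
  have h3 := mvfderiv_mlieBracket
    ((contMDiffAt_extChartAt_comp hf (mem_chart_source F (f x))).of_le (m := 2) two_le_infty) hX hY
  simp only [alongDeriv_apply]
  rw [e1, e1, e2, add_sub_add_right_eq_sub, ← map_sub, h3, ← hc.self_of_nhds,
    coordInv_chartDeriv_self]

end AlongDerivative

/-! ### Regularity of the metric and its derivative along an immersion -/

section Metric

variable {F : Type*} [NormedAddCommGroup F] [NormedSpace ℝ F]
  {N : Type*} [TopologicalSpace N] [ChartedSpace F N] [IsManifold 𝓘(ℝ, F) ∞ N]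
  {g : FormField F N} {X Y : ∀ p : N, TangentSpace 𝓘(ℝ, F) p} {p : N}

lemma IsPseudoRiemannianMetric.smooth_apply (hg : IsPseudoRiemannianMetric g)
    (hX : SmoothVectorFieldAt X p) (hY : SmoothVectorFieldAt Y p) :
    ContMDiffAt 𝓘(ℝ, F) 𝓘(ℝ, ℝ) ∞ (fun q ↦ g q (X q) (Y q)) p := by
  have h1 := ContMDiffAt.clm_bundle_apply₂ (F₁ := F) (F₂ := F) (F₃ := ℝ)
    (E₃ := fun _ : N ↦ ℝ) (hg.smooth p) hX hY
  rw [contMDiffAt_section] at h1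
  simpa using h1

lemma IsPseudoRiemannianMetric.diff_apply (hg : IsPseudoRiemannianMetric g)
    (hX : DiffVectorFieldAt X p) (hY : DiffVectorFieldAt Y p) :
    MDifferentiableAt 𝓘(ℝ, F) 𝓘(ℝ, ℝ) (fun q ↦ g q (X q) (Y q)) p := by
  have h1 := MDifferentiableAt.clm_bundle_apply₂ (F₁ := F) (F₂ := F) (F₃ := ℝ)
    (E₃ := fun _ : N ↦ ℝ) ((hg.smooth p).mdifferentiableAt (by simp)) hX hY
  rw [mdifferentiableAt_section] at h1
  simpa using h1

variable {E : Type*} [NormedAddCommGroup E] [NormedSpace ℝ E]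
  {M : Type*} [TopologicalSpace M] [ChartedSpace E M] [IsManifold 𝓘(ℝ, E) ∞ M]
  {f : M → N} {x : M} {Z Z' : ∀ y : M, TangentSpace 𝓘(ℝ, F) (f y)}

omit [IsManifold 𝓘(ℝ, E) ∞ M] in
lemma IsPseudoRiemannianMetric.smooth_along (hg : IsPseudoRiemannianMetric g)
    (hf : ContMDiffAt 𝓘(ℝ, E) 𝓘(ℝ, F) ∞ f x) {r : N → M}
    (hr : IsLocalRetraction (E := E) (F := F) f x r)
    (hZ : SmoothAlong (E := E) f Z x) (hZ' : SmoothAlong (E := E) f Z' x) :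
    ContMDiffAt 𝓘(ℝ, E) 𝓘(ℝ, ℝ) ∞ (fun y ↦ g (f y) (Z y) (Z' y)) x := by
  have h1 := (hg.smooth_apply (smooth_extendAlong hr hZ) (smooth_extendAlong hr hZ')).comp x hf
  refine h1.congr_of_eventuallyEq ?_
  filter_upwards [extendAlong_apply (Z := Z) hr hf.continuousAt,
    extendAlong_apply (Z := Z') hr hf.continuousAt] with y hy hy'
  rw [Function.comp_apply, hy, hy']

omit [IsManifold 𝓘(ℝ, E) ∞ M] in
lemma alongDeriv_metric [FiniteDimensional ℝ F] (hg : IsPseudoRiemannianMetric g)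
    {D : Connection F N} (hD : IsLeviCivita g D)
    (hf : ContMDiffAt 𝓘(ℝ, E) 𝓘(ℝ, F) ∞ f x) {r : N → M}
    (hr : IsLocalRetraction (E := E) (F := F) f x r)
    (hZ : DiffAlong (E := E) f Z x) (hZ' : DiffAlong (E := E) f Z' x)
    (v : TangentSpace 𝓘(ℝ, E) x) :
    mvfderiv 𝓘(ℝ, E) (fun y ↦ g (f y) (Z y) (Z' y)) x v
      = g (f x) (alongDeriv D f Z x v) (Z' x) + g (f x) (Z x) (alongDeriv D f Z' x v) := by
  have hfd : MDifferentiableAt 𝓘(ℝ, E) 𝓘(ℝ, F) f x := hf.mdifferentiableAt (by simp)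
  have h1 := extendAlong_apply (Z := Z) hr hf.continuousAt
  have h2 := extendAlong_apply (Z := Z') hr hf.continuousAt
  have d1 := diff_extendAlong hr hZ
  have d2 := diff_extendAlong hr hZ'
  rw [alongDeriv_comp hfd d1 (h1.mono fun _ h ↦ h.symm),
    alongDeriv_comp hfd d2 (h2.mono fun _ h ↦ h.symm)]
  have h3 : (fun y ↦ g (f y) (Z y) (Z' y)) =ᶠ[𝓝 x]
      (fun q ↦ g q (extendAlong f r x Z q) (extendAlong f r x Z' q)) ∘ f := by
    filter_upwards [h1, h2] with y hy hy'
    rw [Function.comp_apply, hy, hy']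
  rw [mvfderiv_congr h3, mvfderiv_comp_eq x (hg.diff_apply d1 d2) hfd]
  refine (hD.metric _ _ _ _ d1 d2).trans ?_
  rw [h1.self_of_nhds, h2.self_of_nhds]

end Metric

/-! ### Smoothness of operator-valued maps -/

section CLMSmooth

variable {E : Type*} [NormedAddCommGroup E] [NormedSpace ℝ E]
  {M : Type*} [TopologicalSpace M] [ChartedSpace E M]
  {F : Type*} [NormedAddCommGroup F] [NormedSpace ℝ F] [FiniteDimensional ℝ F]
  {G : Type*} [NormedAddCommGroup G] [NormedSpace ℝ G]

lemma contMDiffAt_clm_of_apply {c : M → F →L[ℝ] G} {x : M}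
    (h : ∀ w, ContMDiffAt 𝓘(ℝ, E) 𝓘(ℝ, G) ∞ (fun y ↦ c y w) x) :
    ContMDiffAt 𝓘(ℝ, E) 𝓘(ℝ, F →L[ℝ] G) ∞ c x := by
  let b := Module.finBasis ℝ F
  let l : Fin (Module.finrank ℝ F) → (F →L[ℝ] ℝ) := fun i ↦ (b.coord i).toContinuousLinearMap
  have h1 : c = fun y ↦ ∑ i, (ContinuousLinearMap.smulRightL ℝ F G (l i)) (c y (b i)) := by
    ext y w
    conv_lhs => rw [← b.sum_repr w, map_sum]
    simp [l]
  rw [h1]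
  exact contMDiffAt_finsetSum fun i _ ↦
    (ContinuousLinearMap.contMDiff (ContinuousLinearMap.smulRightL ℝ F G (l i))).contMDiffAt.comp x
      (h (b i))

end CLMSmooth

/-! ### Endomorphism fields along a map -/

section EndAlong

variable {E : Type*} [NormedAddCommGroup E] [NormedSpace ℝ E]
  {M : Type*} [TopologicalSpace M] [ChartedSpace E M]
  {F : Type*} [NormedAddCommGroup F] [NormedSpace ℝ F]
  {N : Type*} [TopologicalSpace N] [ChartedSpace F N] [IsManifold 𝓘(ℝ, F) ∞ N]

/-- A field of endomorphisms along `f`, in the preferred chart at `p`. -/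
noncomputable def endCoord (p q : N) (A : TangentSpace 𝓘(ℝ, F) q →L[ℝ] TangentSpace 𝓘(ℝ, F) q) :
    F →L[ℝ] F :=
  chartDeriv p q ∘L A ∘L coordInv p q

lemma endCoord_apply {p q : N} (hq : q ∈ (chartAt F p).source)
    (A : TangentSpace 𝓘(ℝ, F) q →L[ℝ] TangentSpace 𝓘(ℝ, F) q) (v : TangentSpace 𝓘(ℝ, F) q) :
    endCoord p q A (chartDeriv p q v) = chartDeriv p q (A v) := by
  simp only [endCoord, ContinuousLinearMap.comp_apply, coordInv_chartDeriv hq]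

lemma endCoord_comp {p q : N} (hq : q ∈ (chartAt F p).source)
    (A B : TangentSpace 𝓘(ℝ, F) q →L[ℝ] TangentSpace 𝓘(ℝ, F) q) :
    endCoord p q (A ∘L B) = endCoord p q A ∘L endCoord p q B := by
  ext w
  simp only [endCoord, ContinuousLinearMap.comp_apply, coordInv_chartDeriv hq]

lemma trace_endCoord [FiniteDimensional ℝ F] {p q : N} (hq : q ∈ (chartAt F p).source)
    (A : TangentSpace 𝓘(ℝ, F) q →L[ℝ] TangentSpace 𝓘(ℝ, F) q) :
    LinearMap.trace ℝ F (endCoord p q A).toLinearMap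
      = LinearMap.trace ℝ (TangentSpace 𝓘(ℝ, F) q) A.toLinearMap := by
  let e : TangentSpace 𝓘(ℝ, F) q ≃ₗ[ℝ] F :=
    { (chartDeriv p q).toLinearMap with
      invFun := coordInv p q
      left_inv := coordInv_chartDeriv hq
      right_inv := chartDeriv_coordInv hq }
  exact LinearMap.trace_conj' A.toLinearMap e

/-- The field of endomorphisms `A` along `f` is smooth at `x`. -/
def SmoothEndAlong (f : M → N)
    (A : ∀ y : M, TangentSpace 𝓘(ℝ, F) (f y) →L[ℝ] TangentSpace 𝓘(ℝ, F) (f y)) (x : M) : Prop :=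
  ContMDiffAt 𝓘(ℝ, E) 𝓘(ℝ, F →L[ℝ] F) ∞ (fun y ↦ endCoord (f x) (f y) (A y)) x

lemma contMDiffAt_end_iff {f : M → N}
    {A : ∀ y : M, TangentSpace 𝓘(ℝ, F) (f y) →L[ℝ] TangentSpace 𝓘(ℝ, F) (f y)} {x : M}
    (hf : ContMDiffAt 𝓘(ℝ, E) 𝓘(ℝ, F) ∞ f x) :
    ContMDiffAt 𝓘(ℝ, E) (𝓘(ℝ, F).prod 𝓘(ℝ, F →L[ℝ] F)) ∞
      (fun x ↦ (⟨f x, A x⟩ : TotalSpace (F →L[ℝ] F)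
        (fun z : N ↦ TangentSpace 𝓘(ℝ, F) z →L[ℝ] TangentSpace 𝓘(ℝ, F) z))) x
    ↔ SmoothEndAlong (E := E) f A x := by
  rw [contMDiffAt_hom_bundle]
  simp only [hf, true_and]
  refine Filter.EventuallyEq.contMDiffAt_iff ?_
  filter_upwards [hf.continuousAt.eventually (eventually_mem_chart (E := F) (f x))] with y hy
  ext w
  simp only [ContinuousLinearMap.inCoordinates, endCoord, coordInv,
    ContinuousLinearMap.comp_apply]
  exact congr($(TangentBundle.continuousLinearMapAt_trivializationAt hy) _)

lemma smoothEndFieldAt_iff {A : EndField F N} {p : N} :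
    SmoothEndFieldAt A p ↔ SmoothEndAlong (E := F) id A p :=
  contMDiffAt_end_iff (E := F) (f := id) contMDiffAt_id

section Basic

variable {f : M → N} {x : M}
  {A B : ∀ y : M, TangentSpace 𝓘(ℝ, F) (f y) →L[ℝ] TangentSpace 𝓘(ℝ, F) (f y)}
  {Z : ∀ y : M, TangentSpace 𝓘(ℝ, F) (f y)}

lemma SmoothEndAlong.smooth_apply (h : SmoothEndAlong (E := E) f A x) (hf : ContinuousAt f x)
    (hZ : SmoothAlong (E := E) f Z x) : SmoothAlong (E := E) f (fun y ↦ A y (Z y)) x := by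
  refine (ContMDiffAt.clm_apply h hZ).congr_of_eventuallyEq ?_
  filter_upwards [hf.eventually (eventually_mem_chart (E := F) (f x))] with y hy
  rw [endCoord_apply hy]

lemma SmoothEndAlong.diff_apply (h : SmoothEndAlong (E := E) f A x) (hf : ContinuousAt f x)
    (hZ : DiffAlong (E := E) f Z x) : DiffAlong (E := E) f (fun y ↦ A y (Z y)) x := by
  refine MDifferentiableAt.congr_of_eventuallyEq
    (MDifferentiableAt.clm_apply (ContMDiffAt.mdifferentiableAt h (by simp)) hZ) ?_
  filter_upwards [hf.eventually (eventually_mem_chart (E := F) (f x))] with y hy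
  rw [endCoord_apply hy]

lemma SmoothEndAlong.smooth_trace_comp [FiniteDimensional ℝ F] (hA : SmoothEndAlong (E := E) f A x)
    (hB : SmoothEndAlong (E := E) f B x) (hf : ContinuousAt f x) :
    ContMDiffAt 𝓘(ℝ, E) 𝓘(ℝ, ℝ) ∞ (fun y ↦ LinearMap.trace ℝ (TangentSpace 𝓘(ℝ, F) (f y))
      ((A y).toLinearMap ∘ₗ (B y).toLinearMap)) x := by
  let t : (F →L[ℝ] F) →ₗ[ℝ] ℝ := LinearMap.trace ℝ F ∘ₗ ContinuousLinearMap.coeLM ℝ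
  have h1 := (ContinuousLinearMap.contMDiff t.toContinuousLinearMap (n := ∞)).contMDiffAt.comp x
    (ContMDiffAt.clm_comp hA hB)
  refine h1.congr_of_eventuallyEq ?_
  filter_upwards [hf.eventually (eventually_mem_chart (E := F) (f x))] with y hy
  have h2 := trace_endCoord hy (A y ∘L B y)
  rw [endCoord_comp hy] at h2
  exact h2.symm

lemma SmoothEndFieldAt.comp {A : EndField F N} (hA : SmoothEndFieldAt A (f x))
    (hf : ContMDiffAt 𝓘(ℝ, E) 𝓘(ℝ, F) ∞ f x) :
    SmoothEndAlong (E := E) f (fun y ↦ A (f y)) x :=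
  ContMDiffAt.comp x (smoothEndFieldAt_iff.1 hA) hf

lemma smoothEndAlong_of_apply [FiniteDimensional ℝ F]
    (h : ∀ w, SmoothAlong (E := E) f (fun y ↦ A y (coordField (f x) w (f y))) x) :
    SmoothEndAlong (E := E) f A x :=
  contMDiffAt_clm_of_apply fun w ↦ h w

lemma SmoothEndAlong.add (hA : SmoothEndAlong (E := E) f A x) (hB : SmoothEndAlong (E := E) f B x) :
    SmoothEndAlong (E := E) f (fun y ↦ A y + B y) x := by
  refine (ContMDiffAt.add hA hB).congr_of_eventuallyEq (Eventually.of_forall fun y ↦ ?_)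
  ext w
  exact map_add (chartDeriv (f x) (f y)) _ _

lemma SmoothEndAlong.smul {h : M → ℝ} (hh : ContMDiffAt 𝓘(ℝ, E) 𝓘(ℝ, ℝ) ∞ h x)
    (hA : SmoothEndAlong (E := E) f A x) : SmoothEndAlong (E := E) f (fun y ↦ h y • A y) x := by
  refine (ContMDiffAt.smul hh hA).congr_of_eventuallyEq (Eventually.of_forall fun y ↦ ?_)
  ext w
  exact map_smul (chartDeriv (f x) (f y)) _ _

end Basic

lemma contMDiffAt_formField [FiniteDimensional ℝ F] {g : FormField F N} {p : N}
    (h : ∀ w w', ContMDiffAt 𝓘(ℝ, F) 𝓘(ℝ, ℝ) ∞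
      (fun q ↦ g q (coordField p w q) (coordField p w' q)) p) :
    ContMDiffAt 𝓘(ℝ, F) (𝓘(ℝ, F).prod 𝓘(ℝ, F →L[ℝ] F →L[ℝ] ℝ)) ∞
    (fun y ↦ (⟨y, g y⟩ : TotalSpace (F →L[ℝ] F →L[ℝ] ℝ)
      (fun z : N ↦ TangentSpace 𝓘(ℝ, F) z →L[ℝ] TangentSpace 𝓘(ℝ, F) z →L[ℝ] ℝ))) p := by
  rw [contMDiffAt_hom_bundle]
  refine ⟨contMDiffAt_id, contMDiffAt_clm_of_apply fun w ↦ contMDiffAt_clm_of_apply fun w' ↦ ?_⟩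
  refine (h w w').congr_of_eventuallyEq ?_
  filter_upwards [eventually_mem_chart (E := F) p] with q hq
  rw [ContinuousLinearMap.inCoordinates_eq (by simpa using hq) (by simpa using hq)]
  simp [coordField, coordInv, hom_trivializationAt_apply, ContinuousLinearMap.inCoordinates]
  rw [Trivialization.symmL_apply (R := ℝ) _ (by simpa using hq) w]

end EndAlong

/-! ### Coefficients in a standard triple as traces -/

section TripleTrace

variable {V : Type*} [AddCommGroup V] [Module ℝ V] [FiniteDimensional ℝ V] {I J K : V →ₗ[ℝ] V}

/-- For the trace form, `I, J, K` are orthogonal with squares `-d, d, d`, where `d = dim V`. Hence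
the coefficients of a smooth section of `Q` in a smooth local triple are smooth functions. -/
lemma IsStandardTriple.trace_mul (h : IsStandardTriple I J K) {A : V →ₗ[ℝ] V} {a b c : ℝ}
    (hA : ∀ v, A v = a • I v + b • J v + c • K v) :
    LinearMap.trace ℝ V (A ∘ₗ I) = -(a * Module.finrank ℝ V)
    ∧ LinearMap.trace ℝ V (A ∘ₗ J) = b * Module.finrank ℝ V
    ∧ LinearMap.trace ℝ V (A ∘ₗ K) = c * Module.finrank ℝ V := by
  have tI : LinearMap.trace ℝ V I = 0 := by
    simpa using h.trace_I_comp (B := LinearMap.id) (by simp)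
  have tJ : LinearMap.trace ℝ V J = 0 := by
    simpa using h.trace_J_comp (B := LinearMap.id) (by simp)
  have tK : LinearMap.trace ℝ V K = 0 := by
    simpa using h.trace_K_comp (B := LinearMap.id) (by simp)
  have t1 := LinearMap.trace_one ℝ V
  have e1 : A ∘ₗ I = -(a • (1 : V →ₗ[ℝ] V)) - b • K + c • J := by
    ext v; simp [hA, h.sq_I, h.J_I, h.K_I, ← h.mul_eq]; module
  have e2 : A ∘ₗ J = a • K + b • (1 : V →ₗ[ℝ] V) + c • I := by
    ext v; simp [hA, h.sq_J, ← h.mul_eq, h.K_J]; try module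
  have e3 : A ∘ₗ K = a • (-J) + b • (-I) + c • (1 : V →ₗ[ℝ] V) := by
    ext v; simp [hA, h.sq_K, h.I_K, h.J_K]; try module
  refine ⟨?_, ?_, ?_⟩
  · rw [e1]; simp [tJ, tK, t1]
  · rw [e2]; simp [tI, tK, t1]
  · rw [e3]; simp [tI, tJ, t1]

lemma IsStandardTriple.eq_comb_trace (h : IsStandardTriple I J K) {A : V →ₗ[ℝ] V} {a b c : ℝ}
    (hA : ∀ v, A v = a • I v + b • J v + c • K v) (v : V) :
    A v = (-(LinearMap.trace ℝ V (A ∘ₗ I) / Module.finrank ℝ V)) • I v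
      + (LinearMap.trace ℝ V (A ∘ₗ J) / Module.finrank ℝ V) • J v
      + (LinearMap.trace ℝ V (A ∘ₗ K) / Module.finrank ℝ V) • K v := by
  rcases subsingleton_or_nontrivial V with hV | hV
  · exact Subsingleton.elim _ _
  · have hd : (Module.finrank ℝ V : ℝ) ≠ 0 := by exact_mod_cast Module.finrank_pos.ne'
    obtain ⟨h1, h2, h3⟩ := h.trace_mul hA
    rw [h1, h2, h3, mul_div_cancel_right₀ _ hd, neg_div, mul_div_cancel_right₀ _ hd,
      mul_div_cancel_right₀ _ hd, neg_neg, hA]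

end TripleTrace

/-! ### Local triples and sections of `Q` along an immersion -/

section LocalTriple

variable {F : Type*} [NormedAddCommGroup F] [NormedSpace ℝ F]
  {N : Type*} [TopologicalSpace N] [ChartedSpace F N] [IsManifold 𝓘(ℝ, F) ∞ N]

instance [FiniteDimensional ℝ F] (q : N) : FiniteDimensional ℝ (TangentSpace 𝓘(ℝ, F) q) :=
  inferInstanceAs (FiniteDimensional ℝ F)

/-- A triple of fields of endomorphisms which is smooth at `q`, and at `q` is a standard triple
that generates `Q`. -/
structure IsTripleAt (Q : EndSubspaceField F N) (I J K : EndField F N) (q : N) : Prop where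
  smooth_I : SmoothEndFieldAt I q
  smooth_J : SmoothEndFieldAt J q
  smooth_K : SmoothEndFieldAt K q
  triple : IsStandardTriple (I q).toLinearMap (J q).toLinearMap (K q).toLinearMap
  span_eq : Submodule.span ℝ {I q, J q, K q} = Q q

lemma IsAlmostParaQuaternionic.exists_triple {Q : EndSubspaceField F N}
    (hQ : IsAlmostParaQuaternionic Q) (p : N) :
    ∃ I J K : EndField F N, ∀ᶠ q in 𝓝 p, IsTripleAt Q I J K q := by
  obtain ⟨U, hU, hp, I, J, K, h⟩ := hQ p
  refine ⟨I, J, K, Filter.eventually_of_mem (hU.mem_nhds hp) fun q hq ↦ ?_⟩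
  obtain ⟨h1, h2, h3, h4, -, h5⟩ := h q hq
  exact ⟨h1, h2, h3, h4, h5⟩

variable {Q : EndSubspaceField F N} {I J K : EndField F N} {q : N}

lemma IsTripleAt.mem_iff (h : IsTripleAt Q I J K q)
    {A : TangentSpace 𝓘(ℝ, F) q →L[ℝ] TangentSpace 𝓘(ℝ, F) q} :
    A ∈ Q q ↔ ∃ a b c : ℝ, a • I q + b • J q + c • K q = A := by
  rw [← h.span_eq, Submodule.mem_span_triple]

lemma IsTripleAt.mem_iff_isComb (h : IsTripleAt Q I J K q)
    {A : TangentSpace 𝓘(ℝ, F) q →L[ℝ] TangentSpace 𝓘(ℝ, F) q} :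
    A ∈ Q q ↔ IsComb (I q).toLinearMap (J q).toLinearMap (K q).toLinearMap A := by
  rw [h.mem_iff]
  constructor
  · rintro ⟨a, b, c, rfl⟩; exact ⟨a, b, c, fun v ↦ rfl⟩
  · rintro ⟨a, b, c, h⟩; exact ⟨a, b, c, by ext v; exact (h v).symm⟩

lemma IsTripleAt.fiberMaps_eq (h : IsTripleAt Q I J K q) : fiberMaps Q q
    = {A | IsComb (I q).toLinearMap (J q).toLinearMap (K q).toLinearMap A} := by
  ext A
  constructor
  · rintro ⟨B, hB, rfl⟩; exact h.mem_iff_isComb.1 hB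
  · rintro ⟨a, b, c, hA⟩
    exact ⟨a • I q + b • J q + c • K q, h.mem_iff.2 ⟨a, b, c, rfl⟩, funext hA⟩

lemma IsTripleAt.I_mem (h : IsTripleAt Q I J K q) : I q ∈ Q q :=
  h.mem_iff_isComb.2 (isComb_I _ _ _)

lemma IsTripleAt.J_mem (h : IsTripleAt Q I J K q) : J q ∈ Q q :=
  h.mem_iff_isComb.2 (isComb_J _ _ _)

lemma IsTripleAt.K_mem (h : IsTripleAt Q I J K q) : K q ∈ Q q :=
  h.mem_iff_isComb.2 (isComb_K _ _ _)

variable {E : Type*} [NormedAddCommGroup E] [NormedSpace ℝ E]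
  {M : Type*} [TopologicalSpace M] [ChartedSpace E M]
  {f : M → N} {x : M}
  {A : ∀ y : M, TangentSpace 𝓘(ℝ, F) (f y) →L[ℝ] TangentSpace 𝓘(ℝ, F) (f y)} {r : N → M}

/-- It is the trace coefficients of `A`, not the endomorphisms, that are extended through `r`;
attaching them to the ambient triple keeps the extension inside `Q`. -/
lemma exists_end_extension [FiniteDimensional ℝ F] (hQ : IsAlmostParaQuaternionic Q)
    (hf : ContMDiffAt 𝓘(ℝ, E) 𝓘(ℝ, F) ∞ f x) (hr : IsLocalRetraction (E := E) (F := F) f x r)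
    (hA : SmoothEndAlong (E := E) f A x) (hAQ : ∀ᶠ y in 𝓝 x, A y ∈ Q (f y)) :
    ∃ A' : EndField F N, SmoothEndFieldAt A' (f x) ∧ (∀ᶠ q in 𝓝 (f x), A' q ∈ Q q)
      ∧ ∀ᶠ y in 𝓝 x, A' (f y) = A y := by
  obtain ⟨I, J, K, h⟩ := hQ.exists_triple (f x)
  have hx := h.self_of_nhds
  let t : EndField F N → M → ℝ := fun B y ↦
    LinearMap.trace ℝ (TangentSpace 𝓘(ℝ, F) (f y)) ((A y).toLinearMap ∘ₗ (B (f y)).toLinearMap)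
      / Module.finrank ℝ F
  have ht : ∀ {B : EndField F N}, SmoothEndFieldAt B (f x) →
      ContMDiffAt 𝓘(ℝ, F) 𝓘(ℝ, ℝ) ∞ (fun q ↦ t B (r q)) (f x) := fun hB ↦ by
    have h1 := (hA.smooth_trace_comp (hB.comp hf) hf.continuousAt).mul
      (contMDiffAt_const (c := (Module.finrank ℝ F : ℝ)⁻¹))
    exact ContMDiffAt.comp_of_eq (f := r) (x := f x) h1 hr.smooth hr.apply_self
  refine ⟨fun q ↦ (-t I (r q)) • I q + t J (r q) • J q + t K (r q) • K q, ?_, ?_, ?_⟩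
  · exact smoothEndFieldAt_iff.2 ((((smoothEndFieldAt_iff.1 hx.smooth_I).smul (ht hx.smooth_I).neg).add
      ((smoothEndFieldAt_iff.1 hx.smooth_J).smul (ht hx.smooth_J))).add
      ((smoothEndFieldAt_iff.1 hx.smooth_K).smul (ht hx.smooth_K)))
  · exact h.mono fun q hq ↦ hq.mem_iff.2 ⟨_, _, _, rfl⟩
  · filter_upwards [hf.continuousAt.eventually h, hAQ, hr.left_inv] with y hy hAy hry
    rw [hry]
    obtain ⟨a, b, c, habc⟩ := hy.mem_iff.1 hAy
    ext v
    refine (hy.triple.eq_comb_trace (A := (A y).toLinearMap) (a := a) (b := b) (c := c)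
      (fun w ↦ by rw [← habc]; rfl) v).symm

/-- A connection which preserves `Q` also preserves sections of `Q` along an immersion. -/
lemma PreservesEnd.along [FiniteDimensional ℝ F] {D : Connection F N} (hD : PreservesEnd D Q)
    (hQ : IsAlmostParaQuaternionic Q)
    (hf : ContMDiffAt 𝓘(ℝ, E) 𝓘(ℝ, F) ∞ f x) (hr : IsLocalRetraction (E := E) (F := F) f x r)
    (hA : SmoothEndAlong (E := E) f A x) (hAQ : ∀ᶠ y in 𝓝 x, A y ∈ Q (f y))
    (v : TangentSpace 𝓘(ℝ, E) x) :
    ∃ B ∈ Q (f x), ∀ Z : ∀ y : M, TangentSpace 𝓘(ℝ, F) (f y), DiffAlong (E := E) f Z x →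
      alongDeriv D f (fun y ↦ A y (Z y)) x v - A x (alongDeriv D f Z x v) = B (Z x) := by
  obtain ⟨A', hA', hA'Q, hA'A⟩ := exists_end_extension hQ hf hr hA hAQ
  obtain ⟨B, hB, h⟩ := hD A' (f x) hA' hA'Q (mfderiv 𝓘(ℝ, E) 𝓘(ℝ, F) f x v)
  refine ⟨B, hB, fun Z hZ ↦ ?_⟩
  have hfd : MDifferentiableAt 𝓘(ℝ, E) 𝓘(ℝ, F) f x := hf.mdifferentiableAt (by simp)
  have hZe := extendAlong_apply (Z := Z) hr hf.continuousAt
  have hZd := diff_extendAlong hr hZ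
  have h1 := h _ hZd
  have h2 : DiffVectorFieldAt (fun q ↦ A' q (extendAlong f r x Z q)) (f x) :=
    mdifferentiableAt_section_iff'.2 ((smoothEndFieldAt_iff.1 hA').diff_apply continuousAt_id
      (Z := extendAlong f r x Z) (mdifferentiableAt_section_iff'.1 hZd))
  rw [← alongDeriv_comp hfd hZd (hZe.mono fun _ h ↦ h.symm),
    ← alongDeriv_comp (Z := fun y ↦ A y (Z y)) hfd h2, hA'A.self_of_nhds, hZe.self_of_nhds] at h1
  · exact h1
  · filter_upwards [hZe, hA'A] with y hy hy'
    rw [hy, hy']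

end LocalTriple

/-! ### Covariant derivative of a section of `Q` along an immersion -/

section EndDerivative

variable {E : Type*} [NormedAddCommGroup E] [NormedSpace ℝ E]
  {M : Type*} [TopologicalSpace M] [ChartedSpace E M]
  {F : Type*} [NormedAddCommGroup F] [NormedSpace ℝ F]
  {N : Type*} [TopologicalSpace N] [ChartedSpace F N] [IsManifold 𝓘(ℝ, F) ∞ N]

/-- The covariant derivative at `x` of a field `A` of endomorphisms along `f`. -/
noncomputable def endDeriv (D : Connection F N) (f : M → N)
    (A : ∀ y : M, TangentSpace 𝓘(ℝ, F) (f y) →L[ℝ] TangentSpace 𝓘(ℝ, F) (f y)) (x : M)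
    (v : TangentSpace 𝓘(ℝ, E) x) (w : TangentSpace 𝓘(ℝ, F) (f x)) : TangentSpace 𝓘(ℝ, F) (f x) :=
  alongDeriv D f (fun y ↦ A y (coordField (f x) (chartDeriv (f x) (f x) w) (f y))) x v
    - A x (alongDeriv D f (fun y ↦ coordField (f x) (chartDeriv (f x) (f x) w) (f y)) x v)

variable {D : Connection F N} {Q : EndSubspaceField F N} {f : M → N} {x : M}
  {A : ∀ y : M, TangentSpace 𝓘(ℝ, F) (f y) →L[ℝ] TangentSpace 𝓘(ℝ, F) (f y)} {r : N → M}

lemma endDeriv_add (u v : TangentSpace 𝓘(ℝ, E) x) (w : TangentSpace 𝓘(ℝ, F) (f x)) :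
    endDeriv D f A x (u + v) w = endDeriv D f A x u w + endDeriv D f A x v w := by
  simp only [endDeriv, map_add]
  abel

lemma endDeriv_smul (c : ℝ) (v : TangentSpace 𝓘(ℝ, E) x) (w : TangentSpace 𝓘(ℝ, F) (f x)) :
    endDeriv D f A x (c • v) w = c • endDeriv D f A x v w := by
  simp only [endDeriv, map_smul, smul_sub]

variable [FiniteDimensional ℝ F]

lemma PreservesEnd.endDeriv_mem (hD : PreservesEnd D Q) (hQ : IsAlmostParaQuaternionic Q)
    (hf : ContMDiffAt 𝓘(ℝ, E) 𝓘(ℝ, F) ∞ f x) (hr : IsLocalRetraction (E := E) (F := F) f x r)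
    (hA : SmoothEndAlong (E := E) f A x) (hAQ : ∀ᶠ y in 𝓝 x, A y ∈ Q (f y))
    (v : TangentSpace 𝓘(ℝ, E) x) : endDeriv D f A x v ∈ fiberMaps Q (f x) := by
  obtain ⟨B, hB, h⟩ := hD.along hQ hf hr hA hAQ v
  refine ⟨B, hB, funext fun w ↦ ?_⟩
  have h1 := h _ ((smooth_coordField (f x) (chartDeriv (f x) (f x) w)).comp hf).diff
  rw [coordField_self] at h1
  exact h1

lemma PreservesEnd.alongDeriv_apply (hD : PreservesEnd D Q) (hQ : IsAlmostParaQuaternionic Q)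
    (hf : ContMDiffAt 𝓘(ℝ, E) 𝓘(ℝ, F) ∞ f x) (hr : IsLocalRetraction (E := E) (F := F) f x r)
    (hA : SmoothEndAlong (E := E) f A x) (hAQ : ∀ᶠ y in 𝓝 x, A y ∈ Q (f y))
    (v : TangentSpace 𝓘(ℝ, E) x) {Z : ∀ y : M, TangentSpace 𝓘(ℝ, F) (f y)}
    (hZ : DiffAlong (E := E) f Z x) :
    alongDeriv D f (fun y ↦ A y (Z y)) x v
      = A x (alongDeriv D f Z x v) + endDeriv D f A x v (Z x) := by
  obtain ⟨B, hB, h⟩ := hD.along hQ hf hr hA hAQ v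
  have h1 := h _ ((smooth_coordField (f x) (chartDeriv (f x) (f x) (Z x))).comp hf).diff
  rw [coordField_self] at h1
  rw [endDeriv, h1, ← h Z hZ]
  abel

/-- The derivative of `A² = ε`, by two applications of the Leibniz rule. -/
lemma PreservesEnd.endDeriv_anticomm (hD : PreservesEnd D Q) (hQ : IsAlmostParaQuaternionic Q)
    (hf : ContMDiffAt 𝓘(ℝ, E) 𝓘(ℝ, F) ∞ f x) (hr : IsLocalRetraction (E := E) (F := F) f x r)
    (hA : SmoothEndAlong (E := E) f A x) (hAQ : ∀ᶠ y in 𝓝 x, A y ∈ Q (f y))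
    {ε : ℝ} (hsq : ∀ y v, A y (A y v) = ε • v)
    (v : TangentSpace 𝓘(ℝ, E) x) (w : TangentSpace 𝓘(ℝ, F) (f x)) :
    endDeriv D f A x v (A x w) = -A x (endDeriv D f A x v w) := by
  let Z : ∀ y : M, TangentSpace 𝓘(ℝ, F) (f y) :=
    fun y ↦ coordField (f x) (chartDeriv (f x) (f x) w) (f y)
  have hZ : DiffAlong (E := E) f Z x :=
    ((smooth_coordField (f x) (chartDeriv (f x) (f x) w)).comp hf).diff
  have hZx : Z x = w := coordField_self _ _
  have h1 := hD.alongDeriv_apply hQ hf hr hA hAQ v (hA.diff_apply hf.continuousAt hZ)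
  rw [hD.alongDeriv_apply hQ hf hr hA hAQ v hZ, map_add, hsq] at h1
  simp only [hsq] at h1
  rw [alongDeriv_smul (h := fun _ ↦ ε) mdifferentiableAt_const hZ, mvfderiv_const, hZx] at h1
  rw [eq_neg_iff_add_eq_zero, add_comm]
  simpa [add_assoc] using h1.symm

end EndDerivative

/-! ### The Nijenhuis tensor and pointwise invariance -/

section Invariance

variable {E : Type*} [NormedAddCommGroup E] [NormedSpace ℝ E]
  {M : Type*} [TopologicalSpace M] [ChartedSpace E M] [IsManifold 𝓘(ℝ, E) ∞ M]
  {F : Type*} [NormedAddCommGroup F] [NormedSpace ℝ F] [FiniteDimensional ℝ F]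
  {N : Type*} [TopologicalSpace N] [ChartedSpace F N] [IsManifold 𝓘(ℝ, F) ∞ N]
  {g : FormField F N} {Q : EndSubspaceField F N} {D : Connection F N} {ε : ℝ} {f : M → N}
  {J : ∀ x : M, TangentSpace 𝓘(ℝ, F) (f x) →L[ℝ] TangentSpace 𝓘(ℝ, F) (f x)}
  {𝓙 : EndField E M} {x : M}

namespace IsAlmostEpsHermitian

omit [IsManifold 𝓘(ℝ, E) ∞ M] [FiniteDimensional ℝ F] in
lemma contMDiffAt (hM : IsAlmostEpsHermitian ε g Q f J 𝓙) (x : M) :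
    ContMDiffAt 𝓘(ℝ, E) 𝓘(ℝ, F) ∞ f x := (hM.immersion.isImmersionAt x).contMDiffAt

omit [IsManifold 𝓘(ℝ, E) ∞ M] [FiniteDimensional ℝ F] in
lemma exists_retraction (hM : IsAlmostEpsHermitian ε g Q f J 𝓙) (x : M) :
    ∃ r : N → M, IsLocalRetraction (E := E) (F := F) f x r :=
  exists_localRetraction (hM.immersion.isImmersionAt x)

omit [FiniteDimensional ℝ F] in
lemma injective (hM : IsAlmostEpsHermitian ε g Q f J 𝓙) (x : M) :
    Function.Injective (mfderiv 𝓘(ℝ, E) 𝓘(ℝ, F) f x) := by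
  obtain ⟨r, hr⟩ := hM.exists_retraction x
  exact (eventually_mfderiv_injective hr (hM.contMDiffAt x)).self_of_nhds

omit [IsManifold 𝓘(ℝ, E) ∞ M] [FiniteDimensional ℝ F] in
lemma smoothEndAlong (hM : IsAlmostEpsHermitian ε g Q f J 𝓙) (x : M) :
    SmoothEndAlong (E := E) f J x := (contMDiffAt_end_iff (hM.contMDiffAt x)).1 (hM.smooth x)

omit [FiniteDimensional ℝ F] in
lemma diff_apply (hM : IsAlmostEpsHermitian ε g Q f J 𝓙)
    {X : ∀ y : M, TangentSpace 𝓘(ℝ, E) y} (hX : DiffVectorFieldAt X x) :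
    DiffVectorFieldAt (fun y ↦ 𝓙 y (X y)) x := by
  obtain ⟨r, hr⟩ := hM.exists_retraction x
  refine diff_of_diffAlong_map hr (hM.contMDiffAt x) ?_
  simp only [hM.tangent]
  exact (hM.smoothEndAlong x).diff_apply (hM.contMDiffAt x).continuousAt
    (hX.map (hM.contMDiffAt x))

/-- The Nijenhuis tensor in terms of the covariant derivative of the section `J` of `Q`. -/
lemma mfderiv_nijenhuis (hM : IsAlmostEpsHermitian ε g Q f J 𝓙) (hLC : IsLeviCivita g D)
    (hDQ : PreservesEnd D Q) (hQ : IsAlmostParaQuaternionic Q)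
    {X Y : ∀ y : M, TangentSpace 𝓘(ℝ, E) y}
    (hX : DiffVectorFieldAt X x) (hY : DiffVectorFieldAt Y x) :
    mfderiv 𝓘(ℝ, E) 𝓘(ℝ, F) f x (nijenhuis ε 𝓙 X Y x)
      = (endDeriv D f J x (𝓙 x (X x)) (mfderiv 𝓘(ℝ, E) 𝓘(ℝ, F) f x (Y x))
        - J x (endDeriv D f J x (X x) (mfderiv 𝓘(ℝ, E) 𝓘(ℝ, F) f x (Y x))))
      - (endDeriv D f J x (𝓙 x (Y x)) (mfderiv 𝓘(ℝ, E) 𝓘(ℝ, F) f x (X x))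
        - J x (endDeriv D f J x (Y x) (mfderiv 𝓘(ℝ, E) 𝓘(ℝ, F) f x (X x)))) := by
  obtain ⟨r, hr⟩ := hM.exists_retraction x
  have hf := hM.contMDiffAt x
  have hJX := hM.diff_apply hX
  have hJY := hM.diff_apply hY
  have hmem : ∀ᶠ y in 𝓝 x, J y ∈ Q (f y) := Eventually.of_forall hM.mem
  simp only [nijenhuis, map_add, map_sub, map_smul, hM.tangent]
  -- Each bracket becomes a difference of covariant derivatives along `f`. After the Leibniz rule
  -- for `J` and `J² = ε`, all derivatives of `X` and `Y` cancel and only derivatives of `J` remain.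
  rw [← alongDeriv_torsion hLC hf hJX hJY, ← alongDeriv_torsion hLC hf hJX hY,
    ← alongDeriv_torsion hLC hf hX hJY, ← alongDeriv_torsion hLC hf hX hY]
  simp only [hM.tangent]
  have key := fun v {Z : ∀ y : M, TangentSpace 𝓘(ℝ, F) (f y)} (hZ : DiffAlong (E := E) f Z x) ↦
    hDQ.alongDeriv_apply hQ hf hr (hM.smoothEndAlong x) hmem v hZ
  simp only [key _ (hX.map hf), key _ (hY.map hf), map_sub, map_add, hM.sq]
  module

end IsAlmostEpsHermitian

variable (g) in
/-- The value of `g` at `p` as a bilinear form. -/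
noncomputable def FormField.toBilin (p : N) :
    TangentSpace 𝓘(ℝ, F) p →ₗ[ℝ] TangentSpace 𝓘(ℝ, F) p →ₗ[ℝ] ℝ :=
  LinearMap.mk₂ ℝ (fun u v ↦ g p u v) (by simp) (by simp) (by simp) (by simp)

omit [FiniteDimensional ℝ F] [IsManifold 𝓘(ℝ, F) ∞ N] in
@[simp] lemma FormField.toBilin_apply (p : N) (u v : TangentSpace 𝓘(ℝ, F) p) :
    g.toBilin p u v = g p u v := rfl

omit [IsManifold 𝓘(ℝ, E) ∞ M] [FiniteDimensional ℝ F] [IsManifold 𝓘(ℝ, F) ∞ N] in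
lemma finrank_tangentImage [FiniteDimensional ℝ E]
    (h : Function.Injective (mfderiv 𝓘(ℝ, E) 𝓘(ℝ, F) f x)) :
    Module.finrank ℝ (tangentImage E F f x) = Module.finrank ℝ E :=
  LinearMap.finrank_range_of_inj h

/-- At a point where the Nijenhuis tensor does not vanish and the metric is non-degenerate on the
maximal `Q`-invariant subspace, the tangent space is `Q`-invariant. -/
lemma IsAlmostEpsHermitian.invariant_of_nijenhuisNeZeroAt [FiniteDimensional ℝ E]
    (hM : IsAlmostEpsHermitian ε g Q f J 𝓙) (hN : IsParaQuaternionicKahler g Q)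
    (hε : ε = 1 ∨ ε = -1) (hE : 4 ∣ Module.finrank ℝ E) (hne : NijenhuisNeZeroAt ε 𝓙 x)
    (hnd : IsNondegenerateOn (fun u v ↦ g (f x) u v)
      (maximalInvariant (fiberMaps Q (f x)) (tangentImage E F f x))) :
    IsInvariantUnder (fiberMaps Q (f x)) (tangentImage E F f x) := by
  obtain ⟨D, hLC, hDQ, -⟩ := hN.parallel
  obtain ⟨I, J', K, hQ⟩ := hN.almost.exists_triple (f x)
  have hQ := hQ.self_of_nhds
  obtain ⟨r, hr⟩ := hM.exists_retraction x
  have hf := hM.contMDiffAt x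
  have hinj := hM.injective x
  have hmem : ∀ᶠ y in 𝓝 x, J y ∈ Q (f y) := Eventually.of_forall hM.mem
  let df : TangentSpace 𝓘(ℝ, E) x →ₗ[ℝ] TangentSpace 𝓘(ℝ, F) (f x) :=
    (mfderiv 𝓘(ℝ, E) 𝓘(ℝ, F) f x).toLinearMap
  -- A left inverse of `df` makes the derivative of `J` a function of ambient vectors, as the
  -- algebraic theorem requires; only its values on tangent vectors matter.
  obtain ⟨L, hL⟩ := LinearMap.exists_leftInverse_of_injective df (LinearMap.ker_eq_bot.2 hinj)
  have hL : ∀ v, L (df v) = v := fun v ↦ congr($hL v)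
  have hLJ : ∀ v, L (J x (df v)) = 𝓙 x v := fun v ↦ by
    rw [← hL (𝓙 x v)]; exact congr(L $(hM.tangent x v)).symm
  have hdfJ : ∀ v, df (𝓙 x v) = J x (df v) := hM.tangent x
  have hext : ∀ u v, df (nijenhuis ε 𝓙 (coordField x (chartDeriv x x u))
      (coordField x (chartDeriv x x v)) x)
      = (endDeriv D f J x (𝓙 x u) (df v) - J x (endDeriv D f J x u (df v)))
        - (endDeriv D f J x (𝓙 x v) (df u) - J x (endDeriv D f J x v (df u))) := fun u v ↦ by
    have h1 := hM.mfderiv_nijenhuis hLC hDQ hN.almost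
      (smooth_coordField x (chartDeriv x x u)).diff (smooth_coordField x (chartDeriv x x v)).diff
    rw [coordField_self, coordField_self] at h1
    exact h1
  have hskew : ∀ A : TangentSpace 𝓘(ℝ, F) (f x) →ₗ[ℝ] TangentSpace 𝓘(ℝ, F) (f x),
      IsComb (I (f x)).toLinearMap (J' (f x)).toLinearMap (K (f x)).toLinearMap A →
      ∀ u v, g.toBilin (f x) (A u) v = -g.toBilin (f x) u (A v) := fun A hA u v ↦ by
    obtain ⟨B, hB, hAB⟩ : ⇑A ∈ fiberMaps Q (f x) := by rw [hQ.fiberMaps_eq]; exact hA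
    rw [hAB]
    exact hN.skew (f x) B hB u v
  rw [hQ.fiberMaps_eq]
  rw [hQ.fiberMaps_eq] at hnd
  refine fun A hA w hw ↦ invariant_of_nijenhuis_ne_zero (g.toBilin (f x)) (hN.metric.symm (f x))
    hQ.triple hskew
    (J₀ := (J x).toLinearMap) (hQ.mem_iff_isComb.1 (hM.mem x)) hε (hM.sq x)
    (tangentImage E F f x) ?_ (hM.nondegenerate x) ?_ hnd
    (fun u w ↦ endDeriv D f J x (L u) w)
    (fun u v w ↦ by simp only [map_add, endDeriv_add])
    (fun c u w ↦ by simp only [map_smul, endDeriv_smul])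
    ?_ (fun u _ w ↦ hDQ.endDeriv_anticomm hN.almost hf hr (hM.smoothEndAlong x) hmem hM.sq _ w)
    ?_ ?_ A hA w hw
  · rintro _ ⟨v, rfl⟩
    exact ⟨𝓙 x v, hdfJ v⟩
  · rwa [finrank_tangentImage hinj]
  · intro v _
    have h1 := hDQ.endDeriv_mem hN.almost hf hr (hM.smoothEndAlong x) hmem (L v)
    rwa [hQ.fiberMaps_eq] at h1
  · rintro _ ⟨u, rfl⟩ _ ⟨v, rfl⟩
    refine ⟨_, (hext u v).trans ?_⟩
    rw [← hLJ u, ← hLJ v]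
    nth_rewrite 2 [← hL u]
    nth_rewrite 4 [← hL v]
    rfl
  · obtain ⟨X, Y, hX, hY, hXY⟩ := hne
    refine ⟨df (X x), ⟨X x, rfl⟩, df (Y x), ⟨Y x, rfl⟩, fun h0 ↦ hXY (hinj ?_)⟩
    rw [hM.mfderiv_nijenhuis hLC hDQ hN.almost hX.diff hY.diff, map_zero, ← h0]
    simp only [ContinuousLinearMap.coe_coe, hL, hLJ]
    rfl

end Invariance

/-! ### Invariance is a closed condition -/

section Density

variable {E : Type*} [NormedAddCommGroup E] [NormedSpace ℝ E]
  {M : Type*} [TopologicalSpace M] [ChartedSpace E M] [IsManifold 𝓘(ℝ, E) ∞ M]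
  {F : Type*} [NormedAddCommGroup F] [NormedSpace ℝ F]
  {N : Type*} [TopologicalSpace N] [ChartedSpace F N] [IsManifold 𝓘(ℝ, F) ∞ N]
  {f : M → N} {x : M} {r : N → M}

/-- A map that vanishes on the image of `f` near `x`, and whose derivative at `f x` has the tangent
space of the image as its kernel. -/
noncomputable def imageDefect (f : M → N) (r : N → M) (x : M) : N → F :=
  extChartAt 𝓘(ℝ, F) (f x) ∘ f ∘ r - extChartAt 𝓘(ℝ, F) (f x)

omit [IsManifold 𝓘(ℝ, E) ∞ M] in
lemma contMDiffAt_extChartAt_retraction (hf : ContMDiffAt 𝓘(ℝ, E) 𝓘(ℝ, F) ∞ f x)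
    (hr : IsLocalRetraction (E := E) (F := F) f x r) :
    ContMDiffAt 𝓘(ℝ, F) 𝓘(ℝ, F) ∞ (extChartAt 𝓘(ℝ, F) (f x) ∘ f ∘ r) (f x) :=
  ContMDiffAt.comp_of_eq (g := extChartAt 𝓘(ℝ, F) (f x) ∘ f) (f := r)
    (contMDiffAt_extChartAt_comp hf (mem_chart_source F (f x))) hr.smooth hr.apply_self

omit [IsManifold 𝓘(ℝ, E) ∞ M] in
lemma contMDiffAt_imageDefect (hf : ContMDiffAt 𝓘(ℝ, E) 𝓘(ℝ, F) ∞ f x)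
    (hr : IsLocalRetraction (E := E) (F := F) f x r) :
    ContMDiffAt 𝓘(ℝ, F) 𝓘(ℝ, F) ∞ (imageDefect (F := F) f r x) (f x) :=
  (contMDiffAt_extChartAt_retraction hf hr).sub contMDiffAt_extChartAt

lemma mvfderiv_imageDefect_mfderiv (hf : ContMDiffAt 𝓘(ℝ, E) 𝓘(ℝ, F) ∞ f x)
    (hr : IsLocalRetraction (E := E) (F := F) f x r) :
    ∀ᶠ y in 𝓝 x, ∀ v : TangentSpace 𝓘(ℝ, E) y,
      mvfderiv 𝓘(ℝ, F) (imageDefect (F := F) f r x) (f y) (mfderiv 𝓘(ℝ, E) 𝓘(ℝ, F) f y v) = 0 := by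
  filter_upwards [hf.continuousAt.eventually
    (eventually_mdifferentiableAt (contMDiffAt_imageDefect hf hr)),
    eventually_mdifferentiableAt hf, eventually_eventually_nhds.2 hr.left_inv] with y hy hfy hry v
  rw [← mvfderiv_comp_eq y hy hfy]
  have h1 : imageDefect (F := F) f r x ∘ f =ᶠ[𝓝 y] fun _ ↦ (0 : F) :=
    hry.mono fun z hz ↦ by simp [imageDefect, hz]
  rw [mvfderiv_congr h1, mvfderiv_const]
  rfl

/-- At `f x` the derivative of the defect is, in the chart, `df ∘ dr - id`, so a vector it kills
equals `df(dr(w))`. -/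
lemma mem_tangentImage_of_mvfderiv_eq_zero (hf : ContMDiffAt 𝓘(ℝ, E) 𝓘(ℝ, F) ∞ f x)
    (hr : IsLocalRetraction (E := E) (F := F) f x r) {w : TangentSpace 𝓘(ℝ, F) (f x)}
    (hw : mvfderiv 𝓘(ℝ, F) (imageDefect (F := F) f r x) (f x) w = 0) :
    w ∈ tangentImage E F f x := by
  have h1 : mvfderiv 𝓘(ℝ, F) (imageDefect (F := F) f r x) (f x) w
      = mvfderiv 𝓘(ℝ, F) (extChartAt 𝓘(ℝ, F) (f x) ∘ f ∘ r) (f x) w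
        - chartDeriv (f x) (f x) w := by
    rw [imageDefect, mvfderiv_sub
      ((contMDiffAt_extChartAt_retraction hf hr).mdifferentiableAt (by simp))
      (mdifferentiableAt_extChartAt (mem_chart_source F (f x)))]
    rfl
  have h2 : MDifferentiableAt 𝓘(ℝ, E) 𝓘(ℝ, F) (extChartAt 𝓘(ℝ, F) (f x) ∘ f) (r (f x)) := by
    rw [hr.apply_self]
    exact (contMDiffAt_extChartAt_comp hf (mem_chart_source F (f x))).mdifferentiableAt (by simp)
  have h3 : ∀ x', x' = x → ∀ u : TangentSpace 𝓘(ℝ, E) x', ∃ v : TangentSpace 𝓘(ℝ, E) x,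
      mvfderiv 𝓘(ℝ, E) (extChartAt 𝓘(ℝ, F) (f x) ∘ f) x' u
        = mvfderiv 𝓘(ℝ, E) (extChartAt 𝓘(ℝ, F) (f x) ∘ f) x v := by
    rintro _ rfl u
    exact ⟨u, rfl⟩
  obtain ⟨v, hv⟩ := h3 _ hr.apply_self (mfderiv 𝓘(ℝ, F) 𝓘(ℝ, E) r (f x) w)
  rw [← mvfderiv_comp_eq (f x) h2 (hr.smooth.mdifferentiableAt (by simp)),
    ← (chartDeriv_mfderiv hf).self_of_nhds] at hv
  refine ⟨v, chartDeriv_injective (mem_chart_source F (f x)) ?_⟩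
  rw [hw] at h1
  exact hv.symm.trans (sub_eq_zero.1 h1.symm)

/-- Invariance of the tangent spaces under a smooth field of endomorphisms is a closed
condition. -/
lemma apply_mem_tangentImage_of_frequently (hf : ContMDiffAt 𝓘(ℝ, E) 𝓘(ℝ, F) ∞ f x)
    (hr : IsLocalRetraction (E := E) (F := F) f x r) {A : EndField F N}
    (hA : SmoothEndFieldAt A (f x))
    (h : ∃ᶠ y in 𝓝 x, ∀ w ∈ tangentImage E F f y, A (f y) w ∈ tangentImage E F f y) :
    ∀ w ∈ tangentImage E F f x, A (f x) w ∈ tangentImage E F f x := by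
  rintro _ ⟨v, rfl⟩
  let Z : ∀ y : M, TangentSpace 𝓘(ℝ, F) (f y) := fun y ↦
    A (f y) (mfderiv 𝓘(ℝ, E) 𝓘(ℝ, F) f y (coordField x (chartDeriv x x v) y))
  have hZ : SmoothAlong (E := E) f Z x :=
    (hA.comp hf).smooth_apply hf.continuousAt ((smooth_coordField x _).map hf)
  have h1 := ((contMDiffAt_mvfderiv_apply (n := ∞) (contMDiffAt_imageDefect hf hr) (by simp)
    (smooth_extendAlong hr hZ)).comp x hf).continuousAt
  have h2 : ContinuousAt (fun y ↦ mvfderiv 𝓘(ℝ, F) (imageDefect (F := F) f r x) (f y) (Z y)) x := by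
    refine h1.congr ?_
    filter_upwards [extendAlong_apply (Z := Z) hr hf.continuousAt] with y hy
    rw [Function.comp_apply, hy]
  refine mem_tangentImage_of_mvfderiv_eq_zero hf hr ?_
  -- Tangency of `Z` is now the vanishing of a continuous function of the base point, and it holds
  -- frequently near `x`.
  have h3 : mvfderiv 𝓘(ℝ, F) (imageDefect (F := F) f r x) (f x) (Z x) ∈ ({0} : Set F) := by
    refine isClosed_singleton.mem_of_frequently_of_tendsto ?_ h2
    refine (h.and_eventually (mvfderiv_imageDefect_mfderiv hf hr)).mono fun y hy ↦ ?_
    obtain ⟨u, hu⟩ := hy.1 _ ⟨coordField x (chartDeriv x x v) y, rfl⟩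
    exact (congrArg _ hu.symm).trans (hy.2 u)
  have h4 : Z x = A (f x) (mfderiv 𝓘(ℝ, E) 𝓘(ℝ, F) f x v) := by
    simp only [Z, coordField_self]
  rw [h4] at h3
  exact h3

/-- An element of `Q` at `f x` is a combination of a smooth local triple, and each member of the
triple preserves the tangent spaces at points of the dense set. -/
lemma invariant_of_dense {Q : EndSubspaceField F N} (hQ : IsAlmostParaQuaternionic Q)
    (hf : ContMDiffAt 𝓘(ℝ, E) 𝓘(ℝ, F) ∞ f x) (hr : IsLocalRetraction (E := E) (F := F) f x r)
    {U : Set M} (hU : Dense U)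
    (h : ∀ y ∈ U, IsInvariantUnder (fiberMaps Q (f y)) (tangentImage E F f y)) :
    IsInvariantUnder (fiberMaps Q (f x)) (tangentImage E F f x) := by
  obtain ⟨I, J, K, hIJK⟩ := hQ.exists_triple (f x)
  have hx := hIJK.self_of_nhds
  have key : ∀ A : EndField F N, SmoothEndFieldAt A (f x) → (∀ᶠ q in 𝓝 (f x), A q ∈ Q q) →
      ∀ w ∈ tangentImage E F f x, A (f x) w ∈ tangentImage E F f x := fun A hA hAQ ↦ by
    refine apply_mem_tangentImage_of_frequently hf hr hA ?_
    have h1 : ∃ᶠ y in 𝓝 x, y ∈ U := mem_closure_iff_frequently.1 (hU x)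
    exact (h1.and_eventually (hf.continuousAt.eventually hAQ)).mono
      fun y hy w hw ↦ h y hy.1 _ ⟨A (f y), hy.2, rfl⟩ w hw
  rintro _ ⟨A, hA, rfl⟩ w hw
  obtain ⟨a, b, c, rfl⟩ := hx.mem_iff.1 hA
  exact add_mem (add_mem
    (Submodule.smul_mem _ a (key I hx.smooth_I (hIJK.mono fun q hq ↦ hq.I_mem) w hw))
    (Submodule.smul_mem _ b (key J hx.smooth_J (hIJK.mono fun q hq ↦ hq.J_mem) w hw)))
    (Submodule.smul_mem _ c (key K hx.smooth_K (hIJK.mono fun q hq ↦ hq.K_mem) w hw))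

end Density

/-! ### Invariant tangent spaces imply totally geodesic -/

section TotallyGeodesic

/-- Modulo `T`, symmetry lets `I` and `J` be pulled out of either argument. Pulling `I` out of the
first argument and `J` out of the second, in both orders, gives `I J s = J I s = -I J s`, so `2 I J
s` lies in `T`. -/
lemma mem_of_symmetric_mod {V T₀ : Type*} [AddCommGroup V] [Module ℝ V] {I J K : V →ₗ[ℝ] V}
    (h : IsStandardTriple I J K) (T : Submodule ℝ V) (hI : ∀ w ∈ T, I w ∈ T)
    (hJ : ∀ w ∈ T, J w ∈ T) (s : T₀ → T₀ → V) (i j : T₀ → T₀)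
    (hs : ∀ u v, s u v - s v u ∈ T) (hi : ∀ u v, s u (i v) - I (s u v) ∈ T)
    (hj : ∀ u v, s u (j v) - J (s u v) ∈ T) (u v : T₀) : s u v ∈ T := by
  have h1 : ∀ u v, s (i u) v - I (s u v) ∈ T := fun u v ↦ by
    have := add_mem (add_mem (hs (i u) v) (hi v u)) (hI _ (hs v u))
    rw [map_sub] at this
    convert this using 1
    abel
  have h2 : I (J (s u v)) + I (J (s u v)) ∈ T := by
    have := add_mem (sub_mem (hj (i u) v) (h1 u (j v))) (sub_mem (hJ _ (h1 u v)) (hI _ (hj u v)))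
    rw [map_sub, map_sub, h.J_I] at this
    convert this using 1
    abel
  have h3 := hJ _ (hI _ (T.smul_mem (2⁻¹ : ℝ) h2))
  have h4 : J (I ((2⁻¹ : ℝ) • (I (J (s u v)) + I (J (s u v))))) = -s u v := by
    rw [← two_smul ℝ, smul_smul]
    simp [h.sq_I, h.sq_J]
  rw [h4] at h3
  exact neg_mem_iff.1 h3

variable {E : Type*} [NormedAddCommGroup E] [NormedSpace ℝ E]
  {M : Type*} [TopologicalSpace M] [ChartedSpace E M] [IsManifold 𝓘(ℝ, E) ∞ M]
  {F : Type*} [NormedAddCommGroup F] [NormedSpace ℝ F]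
  {N : Type*} [TopologicalSpace N] [ChartedSpace F N] [IsManifold 𝓘(ℝ, F) ∞ N]
  {g : FormField F N} {Q : EndSubspaceField F N} {D : Connection F N}
  {f : M → N} {x : M} {r : N → M}

variable (E) in
/-- The vector field on the domain of `f` whose image is the tangential vector field `Z`
along `f`. -/
noncomputable def tangentLift (f : M → N) (y : M) :
    TangentSpace 𝓘(ℝ, F) (f y) →ₗ[ℝ] TangentSpace 𝓘(ℝ, E) y :=
  (mfderiv 𝓘(ℝ, E) 𝓘(ℝ, F) f y).toLinearMap.leftInverse

omit [IsManifold 𝓘(ℝ, E) ∞ M] [IsManifold 𝓘(ℝ, F) ∞ N] in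
lemma tangentLift_mfderiv {y : M} (h : Function.Injective (mfderiv 𝓘(ℝ, E) 𝓘(ℝ, F) f y))
    (v : TangentSpace 𝓘(ℝ, E) y) : tangentLift E f y (mfderiv 𝓘(ℝ, E) 𝓘(ℝ, F) f y v) = v :=
  LinearMap.leftInverse_apply_of_inj (f := (mfderiv 𝓘(ℝ, E) 𝓘(ℝ, F) f y).toLinearMap)
    (LinearMap.ker_eq_bot.2 h) v

omit [IsManifold 𝓘(ℝ, E) ∞ M] [IsManifold 𝓘(ℝ, F) ∞ N] in
lemma mfderiv_tangentLift {y : M} (h : Function.Injective (mfderiv 𝓘(ℝ, E) 𝓘(ℝ, F) f y))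
    {w : TangentSpace 𝓘(ℝ, F) (f y)} (hw : w ∈ tangentImage E F f y) :
    mfderiv 𝓘(ℝ, E) 𝓘(ℝ, F) f y (tangentLift E f y w) = w := by
  obtain ⟨v, rfl⟩ := hw
  exact congrArg _ (tangentLift_mfderiv h v)

/-- Modulo the tangent space, the derivative of a tangential field depends only on its value. -/
lemma alongDeriv_map_sub_mem (hLC : IsLeviCivita g D)
    (hf : ContMDiffAt 𝓘(ℝ, E) 𝓘(ℝ, F) ∞ f x) {X Y : ∀ y : M, TangentSpace 𝓘(ℝ, E) y}
    (hX : DiffVectorFieldAt X x) (hY : DiffVectorFieldAt Y x) (h : X x = Y x)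
    (u : TangentSpace 𝓘(ℝ, E) x) :
    alongDeriv D f (fun y ↦ mfderiv 𝓘(ℝ, E) 𝓘(ℝ, F) f y (X y)) x u
      - alongDeriv D f (fun y ↦ mfderiv 𝓘(ℝ, E) 𝓘(ℝ, F) f y (Y y)) x u
      ∈ tangentImage E F f x := by
  have hU := (smooth_coordField x (chartDeriv x x u)).diff
  have h1 := alongDeriv_torsion hLC hf hU hX
  have h2 := alongDeriv_torsion hLC hf hU hY
  rw [coordField_self] at h1 h2
  rw [h] at h1
  rw [sub_eq_iff_eq_add] at h1 h2
  rw [h1, h2, add_sub_add_right_eq_sub]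
  exact sub_mem ⟨_, rfl⟩ ⟨_, rfl⟩

variable [FiniteDimensional ℝ F]

/-- A submanifold with `Q`-invariant tangent spaces is totally geodesic. -/
lemma alongDeriv_map_mem (hLC : IsLeviCivita g D) (hDQ : PreservesEnd D Q)
    (hQ : IsAlmostParaQuaternionic Q)
    (hf : ContMDiffAt 𝓘(ℝ, E) 𝓘(ℝ, F) ∞ f x) (hr : IsLocalRetraction (E := E) (F := F) f x r)
    (hT : ∀ᶠ y in 𝓝 x, IsInvariantUnder (fiberMaps Q (f y)) (tangentImage E F f y))
    {X : ∀ y : M, TangentSpace 𝓘(ℝ, E) y} (hX : DiffVectorFieldAt X x)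
    (u : TangentSpace 𝓘(ℝ, E) x) :
    alongDeriv D f (fun y ↦ mfderiv 𝓘(ℝ, E) 𝓘(ℝ, F) f y (X y)) x u ∈ tangentImage E F f x := by
  obtain ⟨I, J, K, hIJK⟩ := hQ.exists_triple (f x)
  have hx := hIJK.self_of_nhds
  have hTx := hT.self_of_nhds
  have hsm := fun v : TangentSpace 𝓘(ℝ, E) x ↦ (smooth_coordField x (chartDeriv x x v)).diff
  -- Modulo tangent vectors this is the second fundamental form, computed with fields of constant
  -- coordinates.
  let s : TangentSpace 𝓘(ℝ, E) x → TangentSpace 𝓘(ℝ, E) x → TangentSpace 𝓘(ℝ, F) (f x) :=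
    fun u v ↦ alongDeriv D f
      (fun y ↦ mfderiv 𝓘(ℝ, E) 𝓘(ℝ, F) f y (coordField x (chartDeriv x x v) y)) x u
  -- The Leibniz error term is the derivative of `A`, an element of `Q`, applied to a tangent
  -- vector; by invariance it is tangent.
  have key : ∀ A : EndField F N, SmoothEndFieldAt A (f x) → (∀ᶠ q in 𝓝 (f x), A q ∈ Q q) →
      ∀ u v, s u (tangentLift E f x (A (f x) (mfderiv 𝓘(ℝ, E) 𝓘(ℝ, F) f x v))) - A (f x) (s u v)
        ∈ tangentImage E F f x := fun A hA hAQ u v ↦ by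
    have hAQ' := hf.continuousAt.eventually hAQ
    let X : ∀ y : M, TangentSpace 𝓘(ℝ, E) y := fun y ↦ tangentLift E f y
      (A (f y) (mfderiv 𝓘(ℝ, E) 𝓘(ℝ, F) f y (coordField x (chartDeriv x x v) y)))
    have hZ : DiffAlong (E := E) f (fun y ↦ A (f y)
        (mfderiv 𝓘(ℝ, E) 𝓘(ℝ, F) f y (coordField x (chartDeriv x x v) y))) x :=
      (hA.comp hf).diff_apply hf.continuousAt ((hsm v).map hf)
    have hXZ : ∀ᶠ y in 𝓝 x, mfderiv 𝓘(ℝ, E) 𝓘(ℝ, F) f y (X y) = A (f y)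
        (mfderiv 𝓘(ℝ, E) 𝓘(ℝ, F) f y (coordField x (chartDeriv x x v) y)) := by
      filter_upwards [hT, hAQ', eventually_mfderiv_injective hr hf] with y hy hAy hinj
      exact mfderiv_tangentLift hinj (hy _ ⟨A (f y), hAy, rfl⟩ _ ⟨_, rfl⟩)
    have hXd : DiffVectorFieldAt X x := diff_of_diffAlong_map hr hf (hZ.congr hXZ)
    have h1 := alongDeriv_map_sub_mem hLC hf (hsm (X x)) hXd (coordField_self x (X x)) u
    rw [alongDeriv_congr hXZ] at h1
    have h2 := hDQ.alongDeriv_apply hQ hf hr (hA.comp hf) hAQ' u ((hsm v).map hf)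
    have h3 := hTx _ (hDQ.endDeriv_mem hQ hf hr (hA.comp hf) hAQ' u) _
      ⟨coordField x (chartDeriv x x v) x, rfl⟩
    rw [h2] at h1
    have h4 := add_mem h1 h3
    have hXx : X x = tangentLift E f x (A (f x) (mfderiv 𝓘(ℝ, E) 𝓘(ℝ, F) f x v)) := by
      simp only [X, coordField_self]
    rw [hXx] at h4
    convert h4 using 1
    simp only [s, ContinuousLinearMap.coe_coe]
    abel
  have hI := hIJK.mono fun q hq ↦ hq.I_mem
  have hJ := hIJK.mono fun q hq ↦ hq.J_mem
  have h1 : s u (X x) ∈ tangentImage E F f x :=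
    mem_of_symmetric_mod hx.triple _ (hTx _ ⟨_, hx.I_mem, rfl⟩) (hTx _ ⟨_, hx.J_mem, rfl⟩) s _ _
      (fun u v ↦ by
        have h := alongDeriv_torsion hLC hf (hsm u) (hsm v)
        rw [coordField_self, coordField_self] at h
        exact ⟨_, h.symm⟩)
      (key I hx.smooth_I hI) (key J hx.smooth_J hJ) u (X x)
  have h2 := alongDeriv_map_sub_mem hLC hf hX (hsm (X x)) (coordField_self x (X x)).symm u
  have h3 := add_mem h2 h1
  rwa [sub_add_cancel] at h3

lemma isTotallyGeodesic_of_invariant (hLC : IsLeviCivita g D) (hDQ : PreservesEnd D Q)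
    (hQ : IsAlmostParaQuaternionic Q) (hf : ∀ x, ContMDiffAt 𝓘(ℝ, E) 𝓘(ℝ, F) ∞ f x)
    (hr : ∀ x, ∃ r : N → M, IsLocalRetraction (E := E) (F := F) f x r)
    (hT : ∀ x, IsInvariantUnder (fiberMaps Q (f x)) (tangentImage E F f x)) :
    IsTotallyGeodesic (E := E) g f := by
  refine ⟨D, hLC, fun x Y hY hYT v hv ↦ ?_⟩
  obtain ⟨v, rfl⟩ := hv
  obtain ⟨r, hr⟩ := hr x
  have hYX : ∀ᶠ y in 𝓝 x,
      mfderiv 𝓘(ℝ, E) 𝓘(ℝ, F) f y (tangentLift E f y (Y (f y))) = Y (f y) := by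
    filter_upwards [hYT, eventually_mfderiv_injective hr (hf x)] with y hy hinj
    exact mfderiv_tangentLift hinj hy
  have hX : DiffVectorFieldAt (fun y ↦ tangentLift E f y (Y (f y))) x :=
    diff_of_diffAlong_map hr (hf x) ((hY.comp (hf x)).diff.congr hYX)
  have h1 := alongDeriv_map_mem hLC hDQ hQ (hf x) hr (Eventually.of_forall hT) hX v
  rw [alongDeriv_comp ((hf x).mdifferentiableAt (by simp)) hY.diff hYX] at h1
  exact h1

end TotallyGeodesic

/-! ### The induced metric and para-quaternionic structure -/

section Induced

variable {E : Type*} [NormedAddCommGroup E] [NormedSpace ℝ E]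
  {M : Type*} [TopologicalSpace M] [ChartedSpace E M] [IsManifold 𝓘(ℝ, E) ∞ M]
  {F : Type*} [NormedAddCommGroup F] [NormedSpace ℝ F]
  {N : Type*} [TopologicalSpace N] [ChartedSpace F N] [IsManifold 𝓘(ℝ, F) ∞ N]
  {g : FormField F N} {Q : EndSubspaceField F N} {f : M → N} {x : M}

instance (x : M) : T2Space (TangentSpace 𝓘(ℝ, E) x) := inferInstanceAs (T2Space E)

variable (E) in
/-- A non-degenerate immersed submanifold with `Q`-invariant tangent spaces. -/
structure IsParaQuaternionicImmersion (g : FormField F N) (Q : EndSubspaceField F N)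
    (f : M → N) : Prop where
  smooth : ∀ x, ContMDiffAt 𝓘(ℝ, E) 𝓘(ℝ, F) ∞ f x
  retraction : ∀ x, ∃ r : N → M, IsLocalRetraction (E := E) (F := F) f x r
  nondegenerate : ∀ x, IsNondegenerateOn (fun u v ↦ g (f x) u v) (tangentImage E F f x)
  invariant : ∀ x, IsInvariantUnder (fiberMaps Q (f x)) (tangentImage E F f x)

omit [IsManifold 𝓘(ℝ, E) ∞ M] [IsManifold 𝓘(ℝ, F) ∞ N] in
lemma inducedMetric_apply (u v : TangentSpace 𝓘(ℝ, E) x) :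
    inducedMetric (E := E) f g x u v
      = g (f x) (mfderiv 𝓘(ℝ, E) 𝓘(ℝ, F) f x u) (mfderiv 𝓘(ℝ, E) 𝓘(ℝ, F) f x v) := rfl

namespace IsParaQuaternionicImmersion

variable (hM : IsParaQuaternionicImmersion E g Q f)
include hM

lemma injective (x : M) : Function.Injective (mfderiv 𝓘(ℝ, E) 𝓘(ℝ, F) f x) := by
  obtain ⟨r, hr⟩ := hM.retraction x
  exact (eventually_mfderiv_injective hr (hM.smooth x)).self_of_nhds

lemma tangentLift_mfderiv (v : TangentSpace 𝓘(ℝ, E) x) :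
    tangentLift E f x (mfderiv 𝓘(ℝ, E) 𝓘(ℝ, F) f x v) = v :=
  ParaQuat.tangentLift_mfderiv (hM.injective x) v

lemma mfderiv_tangentLift {w : TangentSpace 𝓘(ℝ, F) (f x)} (hw : w ∈ tangentImage E F f x) :
    mfderiv 𝓘(ℝ, E) 𝓘(ℝ, F) f x (tangentLift E f x w) = w :=
  ParaQuat.mfderiv_tangentLift (hM.injective x) hw

variable [FiniteDimensional ℝ E]

lemma inducedMetric (hg : IsPseudoRiemannianMetric g) :
    IsPseudoRiemannianMetric (inducedMetric (E := E) f g) where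
  smooth x := by
    obtain ⟨r, hr⟩ := hM.retraction x
    exact contMDiffAt_formField fun w w' ↦ hg.smooth_along (hM.smooth x) hr
      ((smooth_coordField x w).map (hM.smooth x)) ((smooth_coordField x w').map (hM.smooth x))
  symm x u v := hg.symm _ _ _
  nondegenerate x u hu := by
    refine hM.injective x (Eq.trans ?_ (map_zero _).symm)
    refine hM.nondegenerate x _ ⟨u, rfl⟩ ?_
    rintro _ ⟨v, rfl⟩
    exact hu v

end IsParaQuaternionicImmersion

variable [FiniteDimensional ℝ E]

variable (E) in
/-- The field of endomorphisms of the tangent spaces of a submanifold induced by a field of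
endomorphisms which preserves these tangent spaces. -/
noncomputable def restrictEnd (f : M → N) (A : EndField F N) : EndField E M := fun y ↦
  LinearMap.toContinuousLinearMap (tangentLift E f y ∘ₗ (A (f y)).toLinearMap ∘ₗ
    (mfderiv 𝓘(ℝ, E) 𝓘(ℝ, F) f y).toLinearMap)

namespace IsParaQuaternionicImmersion

variable (hM : IsParaQuaternionicImmersion E g Q f)
include hM

lemma mfderiv_restrictEnd {A : EndField F N} (hA : A (f x) ∈ Q (f x))
    (v : TangentSpace 𝓘(ℝ, E) x) :
    mfderiv 𝓘(ℝ, E) 𝓘(ℝ, F) f x (restrictEnd E f A x v)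
      = A (f x) (mfderiv 𝓘(ℝ, E) 𝓘(ℝ, F) f x v) :=
  hM.mfderiv_tangentLift (hM.invariant x _ ⟨A (f x), hA, rfl⟩ _ ⟨v, rfl⟩)

lemma smooth_restrictEnd {A : EndField F N} (hA : SmoothEndFieldAt A (f x))
    (hAQ : ∀ᶠ q in 𝓝 (f x), A q ∈ Q q) : SmoothEndFieldAt (restrictEnd E f A) x := by
  obtain ⟨r, hr⟩ := hM.retraction x
  have hf := hM.smooth x
  refine smoothEndFieldAt_iff.2 (smoothEndAlong_of_apply fun w ↦ ?_)
  refine (smoothVectorFieldAt_iff_of_mem (mem_chart_source E x)).1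
    (smooth_of_smoothAlong_map hr hf ?_)
  refine SmoothAlong.congr ((hA.comp hf).smooth_apply hf.continuousAt
    ((smooth_coordField x w).map hf)) ?_
  filter_upwards [hf.continuousAt.eventually hAQ] with y hy
  exact hM.mfderiv_restrictEnd hy _

lemma mem_inducedStructure_iff {I J K : EndField F N} (hI : IsTripleAt Q I J K (f x))
    {B : TangentSpace 𝓘(ℝ, E) x →L[ℝ] TangentSpace 𝓘(ℝ, E) x} :
    B ∈ inducedStructure f Q x ↔ ∃ a b c : ℝ, a • restrictEnd E f I x + b • restrictEnd E f J x
      + c • restrictEnd E f K x = B := by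
  constructor
  · rintro ⟨A, hA, h⟩
    obtain ⟨a, b, c, rfl⟩ := hI.mem_iff.1 hA
    refine ⟨a, b, c, ?_⟩
    ext v
    refine hM.injective x ?_
    rw [h]
    simp only [_root_.add_apply, _root_.smul_apply, map_add, map_smul,
      hM.mfderiv_restrictEnd hI.I_mem, hM.mfderiv_restrictEnd hI.J_mem,
      hM.mfderiv_restrictEnd hI.K_mem]
  · rintro ⟨a, b, c, rfl⟩
    refine ⟨a • I (f x) + b • J (f x) + c • K (f x), hI.mem_iff.2 ⟨a, b, c, rfl⟩, fun v ↦ ?_⟩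
    simp only [_root_.add_apply, _root_.smul_apply, map_add, map_smul,
      hM.mfderiv_restrictEnd hI.I_mem, hM.mfderiv_restrictEnd hI.J_mem,
      hM.mfderiv_restrictEnd hI.K_mem]

lemma isTripleAt {I J K : EndField F N} (hI : ∀ᶠ q in 𝓝 (f x), IsTripleAt Q I J K q) :
    IsTripleAt (inducedStructure (E := E) f Q) (restrictEnd E f I) (restrictEnd E f J)
      (restrictEnd E f K) x where
  smooth_I := hM.smooth_restrictEnd hI.self_of_nhds.smooth_I (hI.mono fun _ h ↦ h.I_mem)
  smooth_J := hM.smooth_restrictEnd hI.self_of_nhds.smooth_J (hI.mono fun _ h ↦ h.J_mem)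
  smooth_K := hM.smooth_restrictEnd hI.self_of_nhds.smooth_K (hI.mono fun _ h ↦ h.K_mem)
  triple := by
    have h := hI.self_of_nhds
    have hI' := hM.mfderiv_restrictEnd h.I_mem
    have hJ' := hM.mfderiv_restrictEnd h.J_mem
    have hK' := hM.mfderiv_restrictEnd h.K_mem
    refine ⟨fun v ↦ hM.injective x ?_, fun v ↦ hM.injective x ?_, fun v ↦ hM.injective x ?_,
      fun v ↦ hM.injective x ?_⟩
    · simp only [ContinuousLinearMap.coe_coe, hI', map_neg]
      exact h.triple.sq_I _
    · simp only [ContinuousLinearMap.coe_coe, hJ']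
      exact h.triple.sq_J _
    · simp only [ContinuousLinearMap.coe_coe, hI', hJ', map_neg]
      exact h.triple.anticomm _
    · simp only [ContinuousLinearMap.coe_coe, hI', hJ', hK']
      exact h.triple.mul_eq _
  span_eq := by
    ext B
    rw [Submodule.mem_span_triple, hM.mem_inducedStructure_iff hI.self_of_nhds]

lemma inducedStructure (hQ : IsAlmostParaQuaternionic Q) (hE : M → Nontrivial E) :
    IsAlmostParaQuaternionic (inducedStructure (E := E) f Q) := by
  intro x₀
  obtain ⟨I, J, K, h⟩ := hQ.exists_triple (f x₀)
  obtain ⟨U, hU, hUo, hx₀⟩ := eventually_nhds_iff.1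
    ((hM.smooth x₀).continuousAt.eventually (eventually_eventually_nhds.2 h))
  refine ⟨U, hUo, hx₀, restrictEnd E f I, restrictEnd E f J, restrictEnd E f K, fun x hx ↦ ?_⟩
  have h := hM.isTripleAt (hU x hx)
  refine ⟨h.smooth_I, h.smooth_J, h.smooth_K, h.triple, ?_, h.span_eq⟩
  -- On a zero tangent space the restricted triple would be linearly dependent.
  have : Nontrivial (TangentSpace 𝓘(ℝ, E) x) := hE x₀
  refine LinearIndependent.of_comp (ContinuousLinearMap.coeLM ℝ) ?_
  convert h.triple.linearIndependent using 1
  ext i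
  fin_cases i <;> rfl

end IsParaQuaternionicImmersion

omit [IsManifold 𝓘(ℝ, E) ∞ M] [IsManifold 𝓘(ℝ, F) ∞ N] [FiniteDimensional ℝ E] in
lemma inducedStructure_skew (hskew : ∀ x, ∀ A ∈ Q x, ∀ u v, g x (A u) v = -g x u (A v)) (x : M) :
    ∀ B ∈ ParaQuat.inducedStructure (E := E) f Q x, ∀ u v,
      ParaQuat.inducedMetric (E := E) f g x (B u) v
        = -ParaQuat.inducedMetric (E := E) f g x u (B v) := by
  rintro B ⟨A, hA, h⟩ u v
  rw [inducedMetric_apply, inducedMetric_apply, h, h]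
  exact hskew _ A hA _ _

end Induced

/-! ### The induced connection -/

section InducedConnection

variable {E : Type*} [NormedAddCommGroup E] [NormedSpace ℝ E] [FiniteDimensional ℝ E]
  {M : Type*} [TopologicalSpace M] [ChartedSpace E M] [IsManifold 𝓘(ℝ, E) ∞ M]
  {F : Type*} [NormedAddCommGroup F] [NormedSpace ℝ F]
  {N : Type*} [TopologicalSpace N] [ChartedSpace F N] [IsManifold 𝓘(ℝ, F) ∞ N]
  {g : FormField F N} {Q : EndSubspaceField F N} {f : M → N} {x : M}

/-- The tangential component of the covariant derivative along `f`, as a connection. -/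
noncomputable def inducedConnection (D : Connection F N) (f : M → N)
    (hM : IsParaQuaternionicImmersion E g Q f) : Connection E M where
  toFun Y x := LinearMap.toContinuousLinearMap (tangentLift E f x ∘ₗ
    (alongDeriv D f (fun y ↦ mfderiv 𝓘(ℝ, E) 𝓘(ℝ, F) f y (Y y)) x).toLinearMap)
  isCovariantDerivativeOnUniv := by
    refine ⟨fun {Y Y' x} hY hY' _ ↦ ?_, fun {Y h x} hY hh _ ↦ ?_⟩
    · ext v
      have h1 := alongDeriv_add (D := D) (DiffVectorFieldAt.map (hM.smooth x) hY)
        (DiffVectorFieldAt.map (hM.smooth x) hY') v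
      simp only [← map_add] at h1
      exact (congrArg (tangentLift E f x) h1).trans (map_add _ _ _)
    · ext v
      have h1 := alongDeriv_smul (D := D) hh (DiffVectorFieldAt.map (hM.smooth x) hY) v
      have e1 : (fun y ↦ mfderiv 𝓘(ℝ, E) 𝓘(ℝ, F) f y ((h • Y) y))
          = fun y ↦ h y • mfderiv 𝓘(ℝ, E) 𝓘(ℝ, F) f y (Y y) := funext fun y ↦ map_smul _ _ _
      rw [← e1] at h1
      refine (congrArg (tangentLift E f x) h1).trans ?_
      rw [map_add, map_smul, map_smul, hM.tangentLift_mfderiv]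
      rfl

variable [FiniteDimensional ℝ F] {D : Connection F N} (hM : IsParaQuaternionicImmersion E g Q f)

lemma mfderiv_inducedConnection (hLC : IsLeviCivita g D) (hDQ : PreservesEnd D Q)
    (hQ : IsAlmostParaQuaternionic Q) {Y : ∀ y : M, TangentSpace 𝓘(ℝ, E) y}
    (hY : DiffVectorFieldAt Y x) (v : TangentSpace 𝓘(ℝ, E) x) :
    mfderiv 𝓘(ℝ, E) 𝓘(ℝ, F) f x (inducedConnection D f hM Y x v)
      = alongDeriv D f (fun y ↦ mfderiv 𝓘(ℝ, E) 𝓘(ℝ, F) f y (Y y)) x v := by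
  obtain ⟨r, hr⟩ := hM.retraction x
  exact hM.mfderiv_tangentLift (alongDeriv_map_mem hLC hDQ hQ (hM.smooth x) hr
    (Eventually.of_forall hM.invariant) hY v)

lemma isLeviCivita_inducedConnection (hg : IsPseudoRiemannianMetric g) (hLC : IsLeviCivita g D)
    (hDQ : PreservesEnd D Q) (hQ : IsAlmostParaQuaternionic Q) :
    IsLeviCivita (inducedMetric (E := E) f g) (inducedConnection D f hM) where
  torsion_free X Y x hX hY := by
    refine hM.injective x ?_
    rw [map_sub, mfderiv_inducedConnection hM hLC hDQ hQ hX,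
      mfderiv_inducedConnection hM hLC hDQ hQ hY]
    exact alongDeriv_torsion hLC (hM.smooth x) hX hY
  metric Y Z x v hY hZ := by
    obtain ⟨r, hr⟩ := hM.retraction x
    refine (alongDeriv_metric hg hLC (hM.smooth x) hr (hY.map (hM.smooth x))
      (hZ.map (hM.smooth x)) v).trans ?_
    rw [inducedMetric_apply, inducedMetric_apply, mfderiv_inducedConnection hM hLC hDQ hQ hY,
      mfderiv_inducedConnection hM hLC hDQ hQ hZ]

/-- A section of the induced structure is the restriction of the section of `Q` along `f` with the
same, smooth, coefficients. The derivative of the latter lies in `Q` and preserves the tangent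
space, so its restriction is the required endomorphism. -/
lemma preservesEnd_inducedConnection (hLC : IsLeviCivita g D)
    (hDQ : PreservesEnd D Q) (hQ : IsAlmostParaQuaternionic Q) :
    PreservesEnd (inducedConnection D f hM) (inducedStructure f Q) := by
  intro B x hB hBQ v
  obtain ⟨r, hr⟩ := hM.retraction x
  have hf := hM.smooth x
  obtain ⟨I, J, K, h⟩ := hQ.exists_triple (f x)
  have hM3 : ∀ᶠ y in 𝓝 x, IsTripleAt (inducedStructure (E := E) f Q) (restrictEnd E f I)
      (restrictEnd E f J) (restrictEnd E f K) y :=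
    (hf.continuousAt.eventually (eventually_eventually_nhds.2 h)).mono fun y hy ↦ hM.isTripleAt hy
  have hMx := hM3.self_of_nhds
  have hx := h.self_of_nhds
  let t : EndField F N → M → ℝ := fun C y ↦
    LinearMap.trace ℝ (TangentSpace 𝓘(ℝ, E) y)
      ((B y).toLinearMap ∘ₗ (restrictEnd E f C y).toLinearMap) / Module.finrank ℝ E
  have ht : ∀ {C : EndField F N}, SmoothEndFieldAt (restrictEnd E f C) x →
      ContMDiffAt 𝓘(ℝ, E) 𝓘(ℝ, ℝ) ∞ (t C) x := fun hC ↦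
    ((smoothEndFieldAt_iff.1 hB).smooth_trace_comp (smoothEndFieldAt_iff.1 hC)
      continuousAt_id).mul (contMDiffAt_const (c := (Module.finrank ℝ E : ℝ)⁻¹))
  let A : ∀ y : M, TangentSpace 𝓘(ℝ, F) (f y) →L[ℝ] TangentSpace 𝓘(ℝ, F) (f y) := fun y ↦
    (-t I y) • I (f y) + t J y • J (f y) + t K y • K (f y)
  have hA : SmoothEndAlong (E := E) f A x :=
    (((hx.smooth_I.comp hf).smul (ht hMx.smooth_I).neg).add
      ((hx.smooth_J.comp hf).smul (ht hMx.smooth_J))).add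
      ((hx.smooth_K.comp hf).smul (ht hMx.smooth_K))
  have hAQ : ∀ᶠ y in 𝓝 x, A y ∈ Q (f y) := (hf.continuousAt.eventually h).mono fun y hy ↦
    hy.mem_iff.2 ⟨_, _, _, rfl⟩
  have hAB : ∀ᶠ y in 𝓝 x, ∀ w, mfderiv 𝓘(ℝ, E) 𝓘(ℝ, F) f y (B y w)
      = A y (mfderiv 𝓘(ℝ, E) 𝓘(ℝ, F) f y w) := by
    filter_upwards [hM3, hBQ, hf.continuousAt.eventually h] with y hy hBy hhy w
    obtain ⟨a, b, c, habc⟩ := hy.mem_iff.1 hBy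
    have h1 := hy.triple.eq_comb_trace (A := (B y).toLinearMap) (a := a) (b := b) (c := c)
      (fun w ↦ by rw [← habc]; rfl) w
    refine (congrArg (mfderiv 𝓘(ℝ, E) 𝓘(ℝ, F) f y) h1).trans ?_
    simp only [map_add, map_smul, ContinuousLinearMap.coe_coe, hM.mfderiv_restrictEnd hhy.I_mem,
      hM.mfderiv_restrictEnd hhy.J_mem, hM.mfderiv_restrictEnd hhy.K_mem]
    rfl
  obtain ⟨C, hC, hCeq⟩ := hDQ.along hQ hf hr hA hAQ v
  have hCT : ∀ w : TangentSpace 𝓘(ℝ, E) x, C (mfderiv 𝓘(ℝ, E) 𝓘(ℝ, F) f x w)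
      ∈ tangentImage E F f x := fun w ↦ hM.invariant x _ ⟨C, hC, rfl⟩ _ ⟨w, rfl⟩
  refine ⟨LinearMap.toContinuousLinearMap (tangentLift E f x ∘ₗ C.toLinearMap ∘ₗ
    (mfderiv 𝓘(ℝ, E) 𝓘(ℝ, F) f x).toLinearMap), ⟨C, hC, fun w ↦ hM.mfderiv_tangentLift (hCT w)⟩,
    fun Y hY ↦ hM.injective x ?_⟩
  have hBY : DiffVectorFieldAt (fun y ↦ B y (Y y)) x :=
    mdifferentiableAt_section_iff'.2 ((smoothEndFieldAt_iff.1 hB).diff_apply continuousAt_id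
      (Z := Y) (mdifferentiableAt_section_iff'.1 hY))
  rw [map_sub, mfderiv_inducedConnection hM hLC hDQ hQ hBY, hAB.self_of_nhds,
    mfderiv_inducedConnection hM hLC hDQ hQ hY, alongDeriv_congr (hAB.mono fun y hy ↦ hy (Y y)),
    hCeq _ (hY.map hf)]
  exact (hM.mfderiv_tangentLift (hCT _)).symm

end InducedConnection

/-! ### Smoothness of the Levi-Civita connection -/

section SmoothConnection

variable {F : Type*} [NormedAddCommGroup F] [NormedSpace ℝ F] [FiniteDimensional ℝ F]
  {N : Type*} [TopologicalSpace N] [ChartedSpace F N] [IsManifold 𝓘(ℝ, F) ∞ N]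
  {g : FormField F N} {D : Connection F N} {p : N} {X Y Z : ∀ q : N, TangentSpace 𝓘(ℝ, F) q}

lemma smooth_mlieBracket (hX : SmoothVectorFieldAt X p) (hY : SmoothVectorFieldAt Y p) :
    SmoothVectorFieldAt (VectorField.mlieBracket 𝓘(ℝ, F) X Y) p := by
  have h1 : IsManifold 𝓘(ℝ, F) (minSmoothness ℝ 2) N :=
    IsManifold.of_le (n := ∞) (by simpa using two_le_infty)
  have h2 : IsManifold 𝓘(ℝ, F) (((⊤ : ℕ∞) : ℕ∞ω) + 1) N :=
    inferInstanceAs (IsManifold 𝓘(ℝ, F) ∞ N)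
  exact ContMDiffAt.mlieBracket_vectorField (m := ⊤) (n := ⊤) hX hY (by simp)

/-- The coordinates of `X` are obtained by applying the inverse of the coordinate operator of `g` to
a smooth covector; inversion of operators is smooth at invertible ones. -/
lemma IsPseudoRiemannianMetric.smooth_of_apply (hg : IsPseudoRiemannianMetric g)
    (h : ∀ w, ContMDiffAt 𝓘(ℝ, F) 𝓘(ℝ, ℝ) ∞ (fun q ↦ g q (X q) (coordField p w q)) p) :
    SmoothVectorFieldAt X p := by
  let H : N → F →L[ℝ] F →L[ℝ] ℝ := fun q ↦
    ContinuousLinearMap.precomp ℝ (coordInv p q) ∘L (g q ∘L coordInv p q)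
  have hH : ContMDiffAt 𝓘(ℝ, F) 𝓘(ℝ, F →L[ℝ] F →L[ℝ] ℝ) ∞ H p :=
    contMDiffAt_clm_of_apply fun w ↦ contMDiffAt_clm_of_apply fun w' ↦
      hg.smooth_apply (smooth_coordField p w) (smooth_coordField p w')
  have hinj : ∀ q ∈ (chartAt F p).source, Function.Injective (H q) := fun q hq ↦ by
    refine (injective_iff_map_eq_zero _).2 fun w hw ↦ ?_
    have h1 : coordInv p q w = 0 := hg.nondegenerate q _ fun v ↦ by
      have h2 := congr($hw (chartDeriv p q v))
      simp only [H, ContinuousLinearMap.comp_apply, ContinuousLinearMap.precomp_apply,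
        coordInv_chartDeriv hq] at h2
      exact h2
    rw [← chartDeriv_coordInv hq w, h1, map_zero]
  have hrank : Module.finrank ℝ F = Module.finrank ℝ (F →L[ℝ] ℝ) := by
    rw [← Subspace.dual_finrank_eq]
    exact (LinearMap.toContinuousLinearMap (𝕜 := ℝ) (E := F) (F' := ℝ)).finrank_eq
  let e : ∀ q ∈ (chartAt F p).source, F ≃L[ℝ] (F →L[ℝ] ℝ) := fun q hq ↦
    (LinearMap.linearEquivOfInjective (H q).toLinearMap (hinj q hq) hrank).toContinuousLinearEquiv
  have he : ∀ q hq, (e q hq : F →L[ℝ] F →L[ℝ] ℝ) = H q := fun q hq ↦ by ext; rfl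
  have hinv : ContMDiffAt 𝓘(ℝ, F) 𝓘(ℝ, (F →L[ℝ] ℝ) →L[ℝ] F) ∞ (fun q ↦ (H q).inverse) p := by
    have h1 := contDiffAt_map_inverse (𝕜 := ℝ) (n := ∞) (e p (mem_chart_source F p))
    rw [he p (mem_chart_source F p)] at h1
    exact h1.contMDiffAt.comp p hH
  have hβ : ContMDiffAt 𝓘(ℝ, F) 𝓘(ℝ, F →L[ℝ] ℝ) ∞ (fun q ↦ H q (chartDeriv p q (X q))) p := by
    refine contMDiffAt_clm_of_apply fun w ↦ (h w).congr_of_eventuallyEq ?_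
    filter_upwards [eventually_mem_chart (E := F) p] with q hq
    simp only [H, ContinuousLinearMap.comp_apply, ContinuousLinearMap.precomp_apply,
      coordInv_chartDeriv hq]
    rfl
  refine (smoothVectorFieldAt_iff_of_mem (mem_chart_source F p)).2
    ((hinv.clm_apply hβ).congr_of_eventuallyEq ?_)
  filter_upwards [eventually_mem_chart (E := F) p] with q hq
  rw [← he q hq, ContinuousLinearMap.inverse_equiv]
  exact ((e q hq).symm_apply_apply _).symm

omit [FiniteDimensional ℝ F] in
lemma IsLeviCivita.mvfderiv_apply (hLC : IsLeviCivita g D) (hY : DiffVectorFieldAt Y p)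
    (hZ : DiffVectorFieldAt Z p) (v : TangentSpace 𝓘(ℝ, F) p) :
    mvfderiv 𝓘(ℝ, F) (fun q ↦ g q (Y q) (Z q)) p v
      = g p (D Y p v) (Z p) + g p (Y p) (D Z p v) := hLC.metric Y Z p v hY hZ

omit [FiniteDimensional ℝ F] in
/-- The Koszul formula. -/
lemma IsLeviCivita.koszul (hg : IsPseudoRiemannianMetric g) (hLC : IsLeviCivita g D)
    (hX : DiffVectorFieldAt X p) (hY : DiffVectorFieldAt Y p) (hZ : DiffVectorFieldAt Z p) :
    2 * g p (D Y p (X p)) (Z p)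
      = mvfderiv 𝓘(ℝ, F) (fun q ↦ g q (Y q) (Z q)) p (X p)
        + mvfderiv 𝓘(ℝ, F) (fun q ↦ g q (X q) (Z q)) p (Y p)
        - mvfderiv 𝓘(ℝ, F) (fun q ↦ g q (X q) (Y q)) p (Z p)
        + g p (VectorField.mlieBracket 𝓘(ℝ, F) X Y p) (Z p)
        - g p (VectorField.mlieBracket 𝓘(ℝ, F) X Z p) (Y p)
        - g p (VectorField.mlieBracket 𝓘(ℝ, F) Y Z p) (X p) := by
  rw [hLC.mvfderiv_apply hY hZ, hLC.mvfderiv_apply hX hZ, hLC.mvfderiv_apply hX hY,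
    ← hLC.torsion_free X Y p hX hY, ← hLC.torsion_free X Z p hX hZ,
    ← hLC.torsion_free Y Z p hY hZ]
  simp only [map_sub, _root_.sub_apply]
  linarith [hg.symm p (Y p) (D Z p (X p)), hg.symm p (X p) (D Z p (Y p)),
    hg.symm p (X p) (D Y p (Z p)), hg.symm p (D X p (Z p)) (Y p)]

/-- The Levi-Civita connection is smooth. -/
lemma IsLeviCivita.smooth (hg : IsPseudoRiemannianMetric g) (hLC : IsLeviCivita g D)
    (hX : SmoothVectorFieldAt X p) (hY : SmoothVectorFieldAt Y p) :
    SmoothVectorFieldAt (fun q ↦ D Y q (X q)) p := by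
  refine hg.smooth_of_apply fun w ↦ ?_
  have hw := smooth_coordField p w
  have d := fun {X Y Z : ∀ q : N, TangentSpace 𝓘(ℝ, F) q} (hX : SmoothVectorFieldAt X p)
    (hY : SmoothVectorFieldAt Y p) (hZ : SmoothVectorFieldAt Z p) ↦
    contMDiffAt_mvfderiv_apply (n := ∞) (hg.smooth_apply hX hY) (by simp) hZ
  have b := fun {X Y Z : ∀ q : N, TangentSpace 𝓘(ℝ, F) q} (hX : SmoothVectorFieldAt X p)
    (hY : SmoothVectorFieldAt Y p) (hZ : SmoothVectorFieldAt Z p) ↦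
    hg.smooth_apply (smooth_mlieBracket hX hY) hZ
  have h1 := ((((((d hY hw hX).add (d hX hw hY)).sub (d hX hY hw)).add (b hX hY hw)).sub
    (b hX hw hY)).sub (b hY hw hX)).mul (contMDiffAt_const (c := (2⁻¹ : ℝ)))
  refine h1.congr_of_eventuallyEq ?_
  filter_upwards [hX.eventually_diff, hY.eventually_diff, hw.eventually_diff] with q hXq hYq hwq
  have h2 := hLC.koszul hg hXq hYq hwq
  simp only [Pi.add_apply, Pi.mul_apply]
  rw [← h2]
  ring

end SmoothConnection

/-! ### The curvature as an algebraic curvature tensor -/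

section CurvatureTensor

variable {F : Type*} [NormedAddCommGroup F] [NormedSpace ℝ F] [FiniteDimensional ℝ F]
  {N : Type*} [TopologicalSpace N] [ChartedSpace F N] [IsManifold 𝓘(ℝ, F) ∞ N]
  {g : FormField F N} {D : Connection F N} {p : N} {X Y Z W : ∀ q : N, TangentSpace 𝓘(ℝ, F) q}

omit [FiniteDimensional ℝ F] in
lemma IsPseudoRiemannianMetric.ext (hg : IsPseudoRiemannianMetric g) {u v : TangentSpace 𝓘(ℝ, F) p}
    (h : ∀ w, g p u w = g p v w) : u = v :=
  sub_eq_zero.1 (hg.nondegenerate p _ fun w ↦ by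
    rw [map_sub, _root_.sub_apply, h, sub_self])

omit [FiniteDimensional ℝ F] in
lemma curvatureOn_swap : curvatureOn D X Y Z p = -curvatureOn D Y X Z p := by
  rw [curvatureOn, curvatureOn, VectorField.mlieBracket_swap_apply, map_neg]
  abel

/-- The bracket of `X` and `Y` applied to the function `g(Z, W)` is computed in two ways with the
metric property; the mixed first-order terms cancel. -/
lemma curvatureOn_skew (hg : IsPseudoRiemannianMetric g) (hLC : IsLeviCivita g D)
    (hX : SmoothVectorFieldAt X p) (hY : SmoothVectorFieldAt Y p)
    (hZ : SmoothVectorFieldAt Z p) (hW : SmoothVectorFieldAt W p) :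
    g p (curvatureOn D X Y Z p) (W p) = -g p (curvatureOn D X Y W p) (Z p) := by
  have h1 := mvfderiv_mlieBracket ((hg.smooth_apply hZ hW).of_le two_le_infty) hX.diff hY.diff
  have h2 : ∀ {X Y : ∀ q : N, TangentSpace 𝓘(ℝ, F) q}, SmoothVectorFieldAt X p →
      SmoothVectorFieldAt Y p →
      mvfderiv 𝓘(ℝ, F) (fun q ↦ mvfderiv 𝓘(ℝ, F) (fun q ↦ g q (Z q) (W q)) q (Y q)) p (X p)
        = g p (D (fun q ↦ D Z q (Y q)) p (X p)) (W p) + g p (D Z p (Y p)) (D W p (X p))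
          + (g p (D Z p (X p)) (D W p (Y p)) + g p (Z p) (D (fun q ↦ D W q (Y q)) p (X p))) := by
    intro X Y hX hY
    have dZ := hLC.smooth hg hY hZ
    have dW := hLC.smooth hg hY hW
    have e : (fun q ↦ mvfderiv 𝓘(ℝ, F) (fun q ↦ g q (Z q) (W q)) q (Y q))
        =ᶠ[𝓝 p] (fun q ↦ g q (D Z q (Y q)) (W q)) + fun q ↦ g q (Z q) (D W q (Y q)) := by
      filter_upwards [hZ.eventually_diff, hW.eventually_diff] with q hZq hWq
      exact hLC.mvfderiv_apply hZq hWq _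
    rw [mvfderiv_congr e, mvfderiv_add (hg.diff_apply dZ.diff hW.diff)
      (hg.diff_apply hZ.diff dW.diff), _root_.add_apply, hLC.mvfderiv_apply dZ.diff hW.diff,
      hLC.mvfderiv_apply hZ.diff dW.diff]
  rw [h2 hX hY, h2 hY hX, hLC.mvfderiv_apply hZ.diff hW.diff] at h1
  simp only [curvatureOn, map_sub, _root_.sub_apply]
  rw [hg.symm p (D (fun q ↦ D W q (Y q)) p (X p)), hg.symm p (D (fun q ↦ D W q (X q)) p (Y p)),
    hg.symm p (D W p _) (Z p)]
  linarith

/-- Torsion-freeness turns the cyclic sum into the sum of iterated brackets, which is zero by the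
Jacobi identity. -/
lemma curvatureOn_bianchi (hg : IsPseudoRiemannianMetric g) (hLC : IsLeviCivita g D)
    (hX : SmoothVectorFieldAt X p) (hY : SmoothVectorFieldAt Y p) (hZ : SmoothVectorFieldAt Z p) :
    curvatureOn D X Y Z p + curvatureOn D Y Z X p + curvatureOn D Z X Y p = 0 := by
  have h1 : ∀ {X Y Z : ∀ q : N, TangentSpace 𝓘(ℝ, F) q}, SmoothVectorFieldAt X p →
      SmoothVectorFieldAt Y p → SmoothVectorFieldAt Z p →
      D (fun q ↦ D Z q (Y q)) p (X p) - D (fun q ↦ D Y q (Z q)) p (X p)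
        - D X p (VectorField.mlieBracket 𝓘(ℝ, F) Y Z p)
      = VectorField.mlieBracket 𝓘(ℝ, F) X (VectorField.mlieBracket 𝓘(ℝ, F) Y Z) p := by
    intro X Y Z hX hY hZ
    have hb := smooth_mlieBracket hY hZ
    have e : ∀ᶠ q in 𝓝 p, D Z q (Y q)
        = ((fun q ↦ D Y q (Z q)) + VectorField.mlieBracket 𝓘(ℝ, F) Y Z) q := by
      filter_upwards [hY.eventually_diff, hZ.eventually_diff] with q hYq hZq
      rw [Pi.add_apply, ← hLC.torsion_free Y Z q hYq hZq]
      abel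
    rw [← hLC.torsion_free _ _ p hX.diff hb.diff,
      connection_congr D (hLC.smooth hg hY hZ).diff e,
      connection_add D (hLC.smooth hg hZ hY).diff hb.diff, _root_.add_apply]
    abel
  have hi : IsManifold 𝓘(ℝ, F) (minSmoothness ℝ 3) N :=
    IsManifold.of_le (n := ∞) (by simpa using ENat.LEInfty.out)
  have hs : ∀ {X : ∀ q : N, TangentSpace 𝓘(ℝ, F) q}, SmoothVectorFieldAt X p → ContMDiffAt 𝓘(ℝ, F)
      (𝓘(ℝ, F).prod 𝓘(ℝ, F)) (minSmoothness ℝ 2)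
      (fun y ↦ (⟨y, X y⟩ : TotalSpace F (fun z : N ↦ TangentSpace 𝓘(ℝ, F) z))) p := fun hX ↦
    ContMDiffAt.of_le (n := ∞) hX (by simpa using two_le_infty)
  have h2 := VectorField.leibniz_identity_mlieBracket_apply (hs hX) (hs hY) (hs hZ)
  rw [VectorField.mlieBracket_swap_apply (V := VectorField.mlieBracket 𝓘(ℝ, F) X Y),
    VectorField.mlieBracket_swap (V := X) (W := Z), ← neg_one_smul ℝ (VectorField.mlieBracket _ Z X),
    VectorField.mlieBracket_const_smul_right (smooth_mlieBracket hZ hX).diff, neg_one_smul] at h2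
  have h3 := h1 hX hY hZ
  have h4 := h1 hY hZ hX
  have h5 := h1 hZ hX hY
  have h6 : curvatureOn D X Y Z p + curvatureOn D Y Z X p + curvatureOn D Z X Y p
      = VectorField.mlieBracket 𝓘(ℝ, F) X (VectorField.mlieBracket 𝓘(ℝ, F) Y Z) p
        + VectorField.mlieBracket 𝓘(ℝ, F) Y (VectorField.mlieBracket 𝓘(ℝ, F) Z X) p
        + VectorField.mlieBracket 𝓘(ℝ, F) Z (VectorField.mlieBracket 𝓘(ℝ, F) X Y) p := by
    rw [← h3, ← h4, ← h5]
    simp only [curvatureOn]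
    abel
  rw [h6, h2]
  simp

/-- Tensoriality comes from the symmetries. Paired with `g`, the expression sees its last argument
only through the value at `p`, and skewness, pair symmetry and antisymmetry bring each field in turn
into that position. Linearity follows in the same way. -/
lemma exists_curvatureTensor (hg : IsPseudoRiemannianMetric g) (hLC : IsLeviCivita g D) (p : N) :
    ∃ R : TangentSpace 𝓘(ℝ, F) p →ₗ[ℝ] TangentSpace 𝓘(ℝ, F) p →ₗ[ℝ]
        TangentSpace 𝓘(ℝ, F) p →ₗ[ℝ] TangentSpace 𝓘(ℝ, F) p,
      IsAlgebraicCurvature (fun u v ↦ g p u v) R ∧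
      ∀ X Y Z : ∀ q : N, TangentSpace 𝓘(ℝ, F) q, SmoothVectorFieldAt X p →
        SmoothVectorFieldAt Y p → SmoothVectorFieldAt Z p →
        curvatureOn D X Y Z p = R (X p) (Y p) (Z p) := by
  let S := {X : ∀ q : N, TangentSpace 𝓘(ℝ, F) q // SmoothVectorFieldAt X p}
  let c : S → S → S → TangentSpace 𝓘(ℝ, F) p := fun X Y Z ↦ curvatureOn D X.1 Y.1 Z.1 p
  let e : TangentSpace 𝓘(ℝ, F) p → S := fun u ↦
    ⟨coordField p (chartDeriv p p u), smooth_coordField p _⟩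
  have he : ∀ u, (e u).1 p = u := coordField_self p
  have hc : ∀ X Y Z W : S, g p (c X Y Z) (W.1 p) = g p (c Z W X) (Y.1 p) := by
    refine pair_symm_of_symmetries (ρ := fun X Y Z W : S ↦ g p (c X Y Z) (W.1 p))
      (fun X Y Z W ↦ ?_) (fun X Y Z W ↦ ?_)
      (fun X Y Z W ↦ curvatureOn_skew hg hLC X.2 Y.2 Z.2 W.2)
    · simp only [c, ← _root_.add_apply, ← map_add]
      rw [curvatureOn_bianchi hg hLC X.2 Y.2 Z.2, map_zero, _root_.zero_apply]
    · simp only [c]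
      rw [curvatureOn_swap, map_neg, _root_.neg_apply]
  have h3 : ∀ (X Y Z : S) w, g p (c X Y Z) w = -g p (Z.1 p) (c X Y (e w)) := fun X Y Z w ↦ by
    conv_lhs => rw [← he w]
    rw [hg.symm p (Z.1 p)]
    exact curvatureOn_skew hg hLC X.2 Y.2 Z.2 (e w).2
  have h2 : ∀ (X Y Z : S) w, g p (c X Y Z) w = g p (Y.1 p) (c Z (e w) X) := fun X Y Z w ↦ by
    conv_lhs => rw [← he w]
    rw [hg.symm p (Y.1 p), hc]
  have h1 : ∀ (X Y Z : S) w, g p (c X Y Z) w = -g p (X.1 p) (c Z (e w) Y) := fun X Y Z w ↦ by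
    rw [← h2, ← _root_.neg_apply, ← map_neg]
    exact congr(g p $curvatureOn_swap w)
  have hcongr : ∀ X Y Z : S, c X Y Z = c (e (X.1 p)) (e (Y.1 p)) (e (Z.1 p)) := fun X Y Z ↦
    hg.ext fun w ↦ by
      have a1 : g p (c X Y Z) w = g p (c (e (X.1 p)) Y Z) w := by rw [h1, h1, he]
      have a2 : g p (c (e (X.1 p)) Y Z) w = g p (c (e (X.1 p)) (e (Y.1 p)) Z) w := by
        rw [h2, h2, he]
      have a3 : g p (c (e (X.1 p)) (e (Y.1 p)) Z) w
          = g p (c (e (X.1 p)) (e (Y.1 p)) (e (Z.1 p))) w := by rw [h3, h3, he]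
      exact a1.trans (a2.trans a3)
  let R : TangentSpace 𝓘(ℝ, F) p →ₗ[ℝ] TangentSpace 𝓘(ℝ, F) p →ₗ[ℝ]
      TangentSpace 𝓘(ℝ, F) p →ₗ[ℝ] TangentSpace 𝓘(ℝ, F) p :=
    LinearMap.mk₂ ℝ (fun u v ↦
      { toFun := fun w ↦ c (e u) (e v) (e w)
        map_add' := fun w w' ↦ hg.ext fun z ↦ by
          simp only [h3, map_add, _root_.add_apply, he]; ring
        map_smul' := fun t w ↦ hg.ext fun z ↦ by
          simp only [h3, map_smul, _root_.smul_apply, he, RingHom.id_apply, smul_neg] })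
      (fun u u' v ↦ LinearMap.ext fun w ↦ hg.ext fun z ↦ by
        simp only [LinearMap.coe_mk, AddHom.coe_mk, LinearMap.add_apply]
        simp only [h1, map_add, _root_.add_apply, he]; ring)
      (fun t u v ↦ LinearMap.ext fun w ↦ hg.ext fun z ↦ by
        simp only [LinearMap.coe_mk, AddHom.coe_mk, LinearMap.smul_apply]
        simp only [h1, map_smul, _root_.smul_apply, he, smul_neg])
      (fun u v v' ↦ LinearMap.ext fun w ↦ hg.ext fun z ↦ by
        simp only [LinearMap.coe_mk, AddHom.coe_mk, LinearMap.add_apply]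
        simp only [h2, map_add, _root_.add_apply, he])
      (fun t u v ↦ LinearMap.ext fun w ↦ hg.ext fun z ↦ by
        simp only [LinearMap.coe_mk, AddHom.coe_mk, LinearMap.smul_apply]
        simp only [h2, map_smul, _root_.smul_apply, he])
  refine ⟨R, ⟨fun u v w ↦ curvatureOn_swap, fun u v w z ↦ ?_,
    fun u v w ↦ curvatureOn_bianchi hg hLC (e u).2 (e v).2 (e w).2⟩,
    fun X Y Z hX hY hZ ↦ hcongr ⟨X, hX⟩ ⟨Y, hY⟩ ⟨Z, hZ⟩⟩
  have h := h3 (e u) (e v) (e w) z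
  rw [he] at h
  exact h

end CurvatureTensor

/-! ### Curvature operators normalize `Q` -/

section CurvatureEnd

variable {F : Type*} [NormedAddCommGroup F] [NormedSpace ℝ F] [FiniteDimensional ℝ F]
  {N : Type*} [TopologicalSpace N] [ChartedSpace F N] [IsManifold 𝓘(ℝ, F) ∞ N]
  {g : FormField F N} {Q : EndSubspaceField F N} {D : Connection F N} {p : N}
  {X Y Z : ∀ q : N, TangentSpace 𝓘(ℝ, F) q} {A : EndField F N}

omit [FiniteDimensional ℝ F] in
lemma SmoothEndFieldAt.smooth_apply (hA : SmoothEndFieldAt A p) (hZ : SmoothVectorFieldAt Z p) :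
    SmoothVectorFieldAt (fun q ↦ A q (Z q)) p :=
  (smoothVectorFieldAt_iff_of_mem (mem_chart_source F p)).2
    ((smoothEndFieldAt_iff.1 hA).smooth_apply continuousAt_id (Z := Z)
      ((smoothVectorFieldAt_iff_of_mem (mem_chart_source F p)).1 hZ))

/-- The covariant derivative of a section of `Q` along a vector field is a section of `Q`. -/
lemma PreservesEnd.exists_deriv (hg : IsPseudoRiemannianMetric g) (hLC : IsLeviCivita g D)
    (hDQ : PreservesEnd D Q) (hA : ∀ᶠ q in 𝓝 p, SmoothEndFieldAt A q)
    (hAQ : ∀ᶠ q in 𝓝 p, A q ∈ Q q) (hX : SmoothVectorFieldAt X p) :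
    ∃ B : EndField F N, SmoothEndFieldAt B p ∧ (∀ᶠ q in 𝓝 p, B q ∈ Q q) ∧
      ∀ᶠ q in 𝓝 p, ∀ Z : ∀ q : N, TangentSpace 𝓘(ℝ, F) q, DiffVectorFieldAt Z q →
        D (fun q ↦ A q (Z q)) q (X q) = A q (D Z q (X q)) + B q (Z q) := by
  classical
  -- The default value 0 is taken where `A` is not a smooth local section. Smoothness of the chosen
  -- `B` is checked afterwards on coordinate fields, from its defining equation.
  have h : ∀ q, ∃ B : TangentSpace 𝓘(ℝ, F) q →L[ℝ] TangentSpace 𝓘(ℝ, F) q,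
      SmoothEndFieldAt A q → (∀ᶠ q' in 𝓝 q, A q' ∈ Q q') → B ∈ Q q ∧
        ∀ Z : ∀ q : N, TangentSpace 𝓘(ℝ, F) q, DiffVectorFieldAt Z q →
          D (fun q ↦ A q (Z q)) q (X q) = A q (D Z q (X q)) + B (Z q) := fun q ↦ by
    by_cases hq : SmoothEndFieldAt A q ∧ ∀ᶠ q' in 𝓝 q, A q' ∈ Q q'
    · obtain ⟨B, hB, hBe⟩ := hDQ A q hq.1 hq.2 (X q)
      refine ⟨B, fun _ _ ↦ ⟨hB, fun Z hZ ↦ ?_⟩⟩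
      rw [← hBe Z hZ]
      abel
    · exact ⟨0, fun h1 h2 ↦ absurd ⟨h1, h2⟩ hq⟩
  choose B hB using h
  have hB' : ∀ᶠ q in 𝓝 p, B q ∈ Q q ∧
      ∀ Z : ∀ q : N, TangentSpace 𝓘(ℝ, F) q, DiffVectorFieldAt Z q →
        D (fun q ↦ A q (Z q)) q (X q) = A q (D Z q (X q)) + B q (Z q) := by
    filter_upwards [hA, eventually_eventually_nhds.2 hAQ] with q h1 h2 using hB q h1 h2
  refine ⟨B, smoothEndFieldAt_iff.2 (smoothEndAlong_of_apply fun w ↦ ?_),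
    hB'.mono fun _ h ↦ h.1, hB'.mono fun _ h ↦ h.2⟩
  have hw := smooth_coordField p w
  have h1 := (hLC.smooth hg hX (hA.self_of_nhds.smooth_apply hw)).add
    ((hA.self_of_nhds.smooth_apply (hLC.smooth hg hX hw)).smul (contMDiffAt_const (c := (-1 : ℝ))))
  refine SmoothAlong.congr ((smoothVectorFieldAt_iff_of_mem (mem_chart_source F p)).1 h1) ?_
  filter_upwards [hB', hw.eventually_diff] with q hq hwq
  have h2 := hq.2 _ hwq
  simp only [Pi.add_apply, Pi.smul_apply', h2]
  simp

/-- The curvature operators of a connection which preserves `Q` normalize `Q`. -/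
lemma curvatureOn_end (hg : IsPseudoRiemannianMetric g) (hLC : IsLeviCivita g D)
    (hDQ : PreservesEnd D Q) (hA : ∀ᶠ q in 𝓝 p, SmoothEndFieldAt A q)
    (hAQ : ∀ᶠ q in 𝓝 p, A q ∈ Q q) (hX : SmoothVectorFieldAt X p) (hY : SmoothVectorFieldAt Y p) :
    ∃ C ∈ Q p, ∀ Z : ∀ q : N, TangentSpace 𝓘(ℝ, F) q, SmoothVectorFieldAt Z p →
      curvatureOn D X Y (fun q ↦ A q (Z q)) p - A p (curvatureOn D X Y Z p) = C (Z p) := by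
  obtain ⟨B, hB, hBQ, hBA⟩ := hDQ.exists_deriv hg hLC hA hAQ hX
  obtain ⟨B', hB', hBQ', hBA'⟩ := hDQ.exists_deriv hg hLC hA hAQ hY
  obtain ⟨C, hC, hCe⟩ := hDQ B' p hB' hBQ' (X p)
  obtain ⟨C', hC', hCe'⟩ := hDQ B p hB hBQ (Y p)
  obtain ⟨C₀, hC₀, hCe₀⟩ := hDQ A p hA.self_of_nhds hAQ (VectorField.mlieBracket 𝓘(ℝ, F) X Y p)
  -- This is the curvature of the induced connection on `Q`, namely `∇_X ∇_Y A - ∇_Y ∇_X A - ∇_[X,Y]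
  -- A`.
  refine ⟨C - C' - C₀, sub_mem (sub_mem hC hC') hC₀, fun Z hZ ↦ ?_⟩
  have key : ∀ {X Y : ∀ q : N, TangentSpace 𝓘(ℝ, F) q} {B : EndField F N},
      SmoothVectorFieldAt X p → SmoothVectorFieldAt Y p → SmoothEndFieldAt B p →
      (∀ᶠ q in 𝓝 p, ∀ Z : ∀ q : N, TangentSpace 𝓘(ℝ, F) q, DiffVectorFieldAt Z q →
        D (fun q ↦ A q (Z q)) q (Y q) = A q (D Z q (Y q)) + B q (Z q)) →
      D (fun q ↦ D (fun q ↦ A q (Z q)) q (Y q)) p (X p)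
        = D (fun q ↦ A q (D Z q (Y q))) p (X p) + D (fun q ↦ B q (Z q)) p (X p) := by
    intro X Y B hX hY hB hBA
    have e : ∀ᶠ q in 𝓝 p, D (fun q ↦ A q (Z q)) q (Y q)
        = ((fun q ↦ A q (D Z q (Y q))) + fun q ↦ B q (Z q)) q := by
      filter_upwards [hBA, hZ.eventually_diff] with q hq hZq
      exact hq _ hZq
    rw [connection_congr D (hLC.smooth hg hY (hA.self_of_nhds.smooth_apply hZ)).diff e,
      connection_add D (hA.self_of_nhds.smooth_apply (hLC.smooth hg hY hZ)).diff
      (hB.smooth_apply hZ).diff]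
    rfl
  have h1 := hBA.self_of_nhds _ (hLC.smooth hg hY hZ).diff
  have h2 := hBA'.self_of_nhds _ (hLC.smooth hg hX hZ).diff
  have h3 := hCe _ hZ.diff
  have h4 := hCe' _ hZ.diff
  have h5 := hCe₀ _ hZ.diff
  simp only [_root_.sub_apply]
  rw [← h3, ← h4, ← h5]
  simp only [curvatureOn, map_sub]
  rw [key hX hY hB' hBA', key hY hX hB hBA, h1, h2]
  abel

omit [FiniteDimensional ℝ F] in
lemma IsTripleAt.isHermitianTriple {I J K : EndField F N} (h : IsTripleAt Q I J K p)
    (hg : IsPseudoRiemannianMetric g) (hskew : ∀ A ∈ Q p, ∀ u v, g p (A u) v = -g p u (A v)) :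
    IsHermitianTriple (g.toBilin p) (I p).toLinearMap (J p).toLinearMap (K p).toLinearMap where
  toIsStandardTriple := h.triple
  symm := hg.symm p
  nondeg := hg.nondegenerate p
  skew B hB u v := by
    obtain ⟨A, hA, rfl⟩ : B ∈ fiberMaps Q p := by rw [h.fiberMaps_eq]; exact hB
    exact hskew A hA u v

lemma curvatureTensor_normalizes (hg : IsPseudoRiemannianMetric g) (hLC : IsLeviCivita g D)
    (hDQ : PreservesEnd D Q) {I J K : EndField F N} (h : ∀ᶠ q in 𝓝 p, IsTripleAt Q I J K q)
    {R : TangentSpace 𝓘(ℝ, F) p →ₗ[ℝ] TangentSpace 𝓘(ℝ, F) p →ₗ[ℝ]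
      TangentSpace 𝓘(ℝ, F) p →ₗ[ℝ] TangentSpace 𝓘(ℝ, F) p}
    (hR : ∀ X Y Z : ∀ q : N, TangentSpace 𝓘(ℝ, F) q, SmoothVectorFieldAt X p →
      SmoothVectorFieldAt Y p → SmoothVectorFieldAt Z p →
      curvatureOn D X Y Z p = R (X p) (Y p) (Z p))
    {A : TangentSpace 𝓘(ℝ, F) p → TangentSpace 𝓘(ℝ, F) p}
    (hA : IsComb (I p).toLinearMap (J p).toLinearMap (K p).toLinearMap A)
    (u v : TangentSpace 𝓘(ℝ, F) p) :
    IsComb (I p).toLinearMap (J p).toLinearMap (K p).toLinearMap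
      (fun w ↦ R u v (A w) - A (R u v w)) := by
  obtain ⟨a, b, c, hA⟩ := hA
  let A' : EndField F N := fun q ↦ a • I q + b • J q + c • K q
  have hAA' : ∀ w, A w = A' p w := hA
  have hsm : ∀ (t : ℝ) {B : EndField F N} {q : N}, SmoothEndFieldAt B q →
      SmoothEndAlong (E := F) id (fun q ↦ t • B q) q := fun t B q hB ↦
    (smoothEndFieldAt_iff.1 hB).smul contMDiffAt_const
  have hs : ∀ᶠ q in 𝓝 p, SmoothEndFieldAt A' q := h.mono fun q hq ↦ smoothEndFieldAt_iff.2
    (((hsm a hq.smooth_I).add (hsm b hq.smooth_J)).add (hsm c hq.smooth_K))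
  have hu := fun u : TangentSpace 𝓘(ℝ, F) p ↦ smooth_coordField p (chartDeriv p p u)
  obtain ⟨C, hC, hCe⟩ := curvatureOn_end hg hLC hDQ hs
    (h.mono fun q hq ↦ hq.mem_iff.2 ⟨a, b, c, rfl⟩) (hu u) (hu v)
  have h1 : (fun w ↦ R u v (A w) - A (R u v w)) = C := funext fun w ↦ by
    have h2 := hCe _ (hu w)
    rw [hR _ _ _ (hu u) (hu v) (hs.self_of_nhds.smooth_apply (hu w)), hR _ _ _ (hu u) (hu v) (hu w),
      coordField_self, coordField_self, coordField_self] at h2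
    rw [hAA', hAA', h2]
  rw [h1]
  exact h.self_of_nhds.mem_iff_isComb.1 hC

end CurvatureEnd

/-! ### The Gauss equation -/

section Gauss

variable {E : Type*} [NormedAddCommGroup E] [NormedSpace ℝ E] [FiniteDimensional ℝ E]
  {M : Type*} [TopologicalSpace M] [ChartedSpace E M] [IsManifold 𝓘(ℝ, E) ∞ M]
  {F : Type*} [NormedAddCommGroup F] [NormedSpace ℝ F] [FiniteDimensional ℝ F]
  {N : Type*} [TopologicalSpace N] [ChartedSpace F N] [IsManifold 𝓘(ℝ, F) ∞ N]
  {g : FormField F N} {Q : EndSubspaceField F N} {f : M → N} {x : M} {r : N → M}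
  {D : Connection F N} {X Y Z : ∀ y : M, TangentSpace 𝓘(ℝ, E) y}

/-- The image of a vector field `X`, extended to a neighbourhood of `f x`. -/
noncomputable def extendMap (f : M → N) (r : N → M) (x : M)
    (X : ∀ y : M, TangentSpace 𝓘(ℝ, E) y) : ∀ q : N, TangentSpace 𝓘(ℝ, F) q :=
  extendAlong f r x fun y ↦ mfderiv 𝓘(ℝ, E) 𝓘(ℝ, F) f y (X y)

omit [FiniteDimensional ℝ E] [IsManifold 𝓘(ℝ, E) ∞ M] [FiniteDimensional ℝ F] in
lemma extendMap_apply (hf : ContMDiffAt 𝓘(ℝ, E) 𝓘(ℝ, F) ∞ f x)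
    (hr : IsLocalRetraction (E := E) (F := F) f x r) (X : ∀ y : M, TangentSpace 𝓘(ℝ, E) y) :
    ∀ᶠ y in 𝓝 x, extendMap (F := F) f r x X (f y) = mfderiv 𝓘(ℝ, E) 𝓘(ℝ, F) f y (X y) :=
  extendAlong_apply hr hf.continuousAt

omit [FiniteDimensional ℝ E] [FiniteDimensional ℝ F] in
lemma smooth_extendMap (hf : ContMDiffAt 𝓘(ℝ, E) 𝓘(ℝ, F) ∞ f x)
    (hr : IsLocalRetraction (E := E) (F := F) f x r) (hX : SmoothVectorFieldAt X x) :
    SmoothVectorFieldAt (extendMap (F := F) f r x X) (f x) :=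
  smooth_extendAlong hr (hX.map hf)

/-- The Gauss equation of a totally geodesic submanifold. -/
lemma mfderiv_curvatureOn (hM : IsParaQuaternionicImmersion E g Q f)
    (hg : IsPseudoRiemannianMetric g) (hLC : IsLeviCivita g D) (hDQ : PreservesEnd D Q)
    (hQ : IsAlmostParaQuaternionic Q) (hr : IsLocalRetraction (E := E) (F := F) f x r)
    (hX : SmoothVectorFieldAt X x) (hY : SmoothVectorFieldAt Y x) (hZ : SmoothVectorFieldAt Z x) :
    mfderiv 𝓘(ℝ, E) 𝓘(ℝ, F) f x (curvatureOn (inducedConnection D f hM) X Y Z x)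
      = curvatureOn D (extendMap (F := F) f r x X) (extendMap (F := F) f r x Y)
        (extendMap (F := F) f r x Z) (f x) := by
  have hf := hM.smooth x
  have hfd : ∀ y, MDifferentiableAt 𝓘(ℝ, E) 𝓘(ℝ, F) f y := fun y ↦
    (hM.smooth y).mdifferentiableAt (by simp)
  have hs : ∀ {X : ∀ y : M, TangentSpace 𝓘(ℝ, E) y}, SmoothVectorFieldAt X x →
      SmoothVectorFieldAt (extendMap (F := F) f r x X) (f x) := fun hX ↦
    smooth_extendMap hf hr hX
  have he : ∀ X : ∀ y : M, TangentSpace 𝓘(ℝ, E) y, ∀ᶠ y in 𝓝 x,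
      mfderiv 𝓘(ℝ, E) 𝓘(ℝ, F) f y (X y) = extendMap (F := F) f r x X (f y) := fun X ↦
    (extendMap_apply hf hr X).mono fun _ h ↦ h.symm
  have hex := fun X ↦ (he X).self_of_nhds
  set D' := inducedConnection D f hM with hD'
  have h1 : ∀ {Z : ∀ y : M, TangentSpace 𝓘(ℝ, E) y}, SmoothVectorFieldAt Z x →
      ∀ᶠ y in 𝓝 x, ∀ v : TangentSpace 𝓘(ℝ, E) y, mfderiv 𝓘(ℝ, E) 𝓘(ℝ, F) f y (D' Z y v)
        = D (extendMap (F := F) f r x Z) (f y) (mfderiv 𝓘(ℝ, E) 𝓘(ℝ, F) f y v) := by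
    intro Z hZ
    filter_upwards [hZ.eventually_diff, eventually_eventually_nhds.2 (he Z),
      hf.continuousAt.eventually (hs hZ).eventually_diff] with y hy hey hsy v
    rw [hD', mfderiv_inducedConnection hM hLC hDQ hQ hy]
    exact alongDeriv_comp (hfd y) hsy hey v
  have h2 : ∀ {X Y Z : ∀ y : M, TangentSpace 𝓘(ℝ, E) y}, SmoothVectorFieldAt X x →
      SmoothVectorFieldAt Y x → SmoothVectorFieldAt Z x →
      mfderiv 𝓘(ℝ, E) 𝓘(ℝ, F) f x (D' (fun y ↦ D' Z y (Y y)) x (X x))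
        = D (fun q ↦ D (extendMap (F := F) f r x Z) q (extendMap (F := F) f r x Y q)) (f x)
          (extendMap (F := F) f r x X (f x)) := by
    intro X Y Z hX hY hZ
    have hV := hLC.smooth hg (hs hY) (hs hZ)
    have e : ∀ᶠ y in 𝓝 x, mfderiv 𝓘(ℝ, E) 𝓘(ℝ, F) f y (D' Z y (Y y))
        = D (extendMap (F := F) f r x Z) (f y) (extendMap (F := F) f r x Y (f y)) := by
      filter_upwards [h1 hZ, he Y] with y hy hey
      rw [hy, hey]
    have hVd : DiffVectorFieldAt (fun y ↦ D' Z y (Y y)) x :=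
      diff_of_diffAlong_map hr hf ((hV.comp hf).diff.congr e)
    rw [← hex X]
    refine (mfderiv_inducedConnection hM hLC hDQ hQ hVd _).trans ?_
    exact alongDeriv_comp (hfd x) hV.diff e _
  have h3 : mfderiv 𝓘(ℝ, E) 𝓘(ℝ, F) f x (VectorField.mlieBracket 𝓘(ℝ, E) X Y x)
      = VectorField.mlieBracket 𝓘(ℝ, F) (extendMap (F := F) f r x X)
        (extendMap (F := F) f r x Y) (f x) := by
    rw [← alongDeriv_torsion hLC hf hX.diff hY.diff, ← hLC.torsion_free _ _ _ (hs hX).diff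
      (hs hY).diff, alongDeriv_comp (hfd x) (hs hX).diff (he X),
      alongDeriv_comp (hfd x) (hs hY).diff (he Y), hex, hex]
  simp only [curvatureOn, map_sub]
  rw [h2 hX hY hZ, h2 hY hX hZ, (h1 hZ).self_of_nhds, h3]

end Gauss

/-! ### Curvature of the submanifold -/

section InducedCurvature

variable {E : Type*} [NormedAddCommGroup E] [NormedSpace ℝ E] [FiniteDimensional ℝ E]
  {M : Type*} [TopologicalSpace M] [ChartedSpace E M] [IsManifold 𝓘(ℝ, E) ∞ M]
  {F : Type*} [NormedAddCommGroup F] [NormedSpace ℝ F] [FiniteDimensional ℝ F]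
  {N : Type*} [TopologicalSpace N] [ChartedSpace F N] [IsManifold 𝓘(ℝ, F) ∞ N]
  {g : FormField F N} {Q : EndSubspaceField F N} {f : M → N} {x : M}
  {D : Connection F N} (hM : IsParaQuaternionicImmersion E g Q f)
include hM

/-- A para-quaternionic submanifold of a para-quaternionic Kähler manifold of dimension greater
than four has curvature `ν R₀ + W`. -/
lemma hasParaQuaternionicCurvatureAt_of_four_lt (hg : IsPseudoRiemannianMetric g)
    (hskew : ∀ x, ∀ A ∈ Q x, ∀ u v, g x (A u) v = -g x u (A v))
    (hLC : IsLeviCivita g D) (hDQ : PreservesEnd D Q) (hQ : IsAlmostParaQuaternionic Q)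
    (hF : 4 < Module.finrank ℝ F) (x : M) :
    HasParaQuaternionicCurvatureAt (inducedMetric (E := E) f g) (inducedStructure f Q)
      (inducedConnection D f hM) x := by
  obtain ⟨r, hr⟩ := hM.retraction x
  obtain ⟨I, J, K, h⟩ := hQ.exists_triple (f x)
  have hx := h.self_of_nhds
  obtain ⟨R, hRa, hR⟩ := exists_curvatureTensor hg hLC (f x)
  obtain ⟨b, hb⟩ := (hx.isHermitianTriple hg (hskew (f x))).exists_reduced_scalar_curvature hRa
    (fun A hA ↦ curvatureTensor_normalizes hg hLC hDQ h hR hA) hF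
  have h' := hM.isTripleAt h
  have hg' := hM.inducedMetric hg
  have hLC' := isLeviCivita_inducedConnection hM hg hLC hDQ hQ
  obtain ⟨R', hRa', hR'⟩ := exists_curvatureTensor hg' hLC' x
  have hG : ∀ u v w, mfderiv 𝓘(ℝ, E) 𝓘(ℝ, F) f x (R' u v w)
      = R (mfderiv 𝓘(ℝ, E) 𝓘(ℝ, F) f x u) (mfderiv 𝓘(ℝ, E) 𝓘(ℝ, F) f x v)
        (mfderiv 𝓘(ℝ, E) 𝓘(ℝ, F) f x w) := fun u v w ↦ by
    have hs := fun u : TangentSpace 𝓘(ℝ, E) x ↦ smooth_coordField x (chartDeriv x x u)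
    have hs' := fun u : TangentSpace 𝓘(ℝ, E) x ↦ smooth_extendMap (hM.smooth x) hr (hs u)
    have he := fun X ↦ (extendMap_apply (hM.smooth x) hr X).self_of_nhds
    have h1 := mfderiv_curvatureOn hM hg hLC hDQ hQ hr (hs u) (hs v) (hs w)
    rw [hR' _ _ _ (hs u) (hs v) (hs w), coordField_self, coordField_self, coordField_self] at h1
    refine h1.trans ((hR _ _ _ (hs' u) (hs' v) (hs' w)).trans ?_)
    rw [he, he, he, coordField_self, coordField_self, coordField_self]
  have hI' := hM.mfderiv_restrictEnd hx.I_mem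
  have hJ' := hM.mfderiv_restrictEnd hx.J_mem
  have hK' := hM.mfderiv_restrictEnd hx.K_mem
  -- The constant `b` of the ambient space serves for the submanifold: `df` is injective and
  -- intertwines curvatures, metrics and triples.
  obtain ⟨ν, W, hW, hW0, hWQ, hWe⟩ :=
    (h'.isHermitianTriple hg' (inducedStructure_skew hskew x)).exists_curvature_decomposition
      hRa' (b := b) (Q := fiberMaps (inducedStructure (E := E) f Q) x)
      (fun X Y v ↦ hM.injective x (by
        have h1 := (hb (mfderiv 𝓘(ℝ, E) 𝓘(ℝ, F) f x X) (mfderiv 𝓘(ℝ, E) 𝓘(ℝ, F) f x Y)).1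
          (mfderiv 𝓘(ℝ, E) 𝓘(ℝ, F) f x v)
        simp only [FormField.toBilin_apply, inducedMetric_apply, ContinuousLinearMap.coe_coe,
          map_sub, map_smul, hI', hJ', hK', hG] at h1 ⊢
        exact h1))
      (fun X Y v ↦ hM.injective x (by
        have h1 := (hb (mfderiv 𝓘(ℝ, E) 𝓘(ℝ, F) f x X) (mfderiv 𝓘(ℝ, E) 𝓘(ℝ, F) f x Y)).2
          (mfderiv 𝓘(ℝ, E) 𝓘(ℝ, F) f x v)
        simp only [FormField.toBilin_apply, inducedMetric_apply, ContinuousLinearMap.coe_coe,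
          map_sub, map_smul, hI', hJ', hK', hG] at h1 ⊢
        exact h1))
      (fun A hA ↦ by rwa [h'.fiberMaps_eq] at hA)
  exact ⟨ν, _, _, _, W, h'.triple, h'.span_eq, hW, hW0, hWQ, fun X Y Z hX hY hZ ↦
    (hR' X Y Z hX hY hZ).trans (hWe _ _ _)⟩

/-- An open para-quaternionic submanifold inherits the form `ν R₀ + W` of the curvature. -/
lemma hasParaQuaternionicCurvatureAt_of_finrank_eq (hg : IsPseudoRiemannianMetric g)
    (hLC : IsLeviCivita g D) (hDQ : PreservesEnd D Q) (hQ : IsAlmostParaQuaternionic Q)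
    (hEF : Module.finrank ℝ E = Module.finrank ℝ F) (x : M)
    (hx : HasParaQuaternionicCurvatureAt g Q D (f x)) :
    HasParaQuaternionicCurvatureAt (inducedMetric (E := E) f g) (inducedStructure f Q)
      (inducedConnection D f hM) x := by
  obtain ⟨r, hr⟩ := hM.retraction x
  obtain ⟨ν, I, J, K, W, h, hspan, hW, hW0, hWQ, hWe⟩ := hx
  -- In equal dimensions `df` is an isomorphism, and all the data of the decomposition are
  -- conjugated by it with the same `ν`.
  let e : TangentSpace 𝓘(ℝ, E) x ≃ₗ[ℝ] TangentSpace 𝓘(ℝ, F) (f x) :=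
    LinearMap.linearEquivOfInjective (mfderiv 𝓘(ℝ, E) 𝓘(ℝ, F) f x).toLinearMap (hM.injective x) hEF
  have he : ∀ v, mfderiv 𝓘(ℝ, E) 𝓘(ℝ, F) f x v = e v := fun v ↦ rfl
  let c : (TangentSpace 𝓘(ℝ, F) (f x) →L[ℝ] TangentSpace 𝓘(ℝ, F) (f x)) →
      (TangentSpace 𝓘(ℝ, E) x →L[ℝ] TangentSpace 𝓘(ℝ, E) x) := fun A ↦
    LinearMap.toContinuousLinearMap (e.symm.toLinearMap ∘ₗ A.toLinearMap ∘ₗ e.toLinearMap)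
  have hc : ∀ A v, e (c A v) = A (e v) := fun A v ↦ e.apply_symm_apply _
  let W' : TangentSpace 𝓘(ℝ, E) x →ₗ[ℝ] TangentSpace 𝓘(ℝ, E) x →ₗ[ℝ]
      TangentSpace 𝓘(ℝ, E) x →ₗ[ℝ] TangentSpace 𝓘(ℝ, E) x :=
    LinearMap.mk₂ ℝ (fun u v ↦ e.symm.toLinearMap ∘ₗ W (e u) (e v) ∘ₗ e.toLinearMap)
      (fun u u' v ↦ by ext w; simp) (fun t u v ↦ by ext w; simp)
      (fun u v v' ↦ by ext w; simp) (fun t u v ↦ by ext w; simp)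
  have hW' : ∀ u v w, e (W' u v w) = W (e u) (e v) (e w) := fun u v w ↦ e.apply_symm_apply _
  have hmetric : ∀ u v, inducedMetric (E := E) f g x u v = g (f x) (e u) (e v) := fun u v ↦ rfl
  refine ⟨ν, c I, c J, c K, W', ⟨fun v ↦ e.injective ?_, fun v ↦ e.injective ?_,
    fun v ↦ e.injective ?_, fun v ↦ e.injective ?_⟩, ?_,
    ⟨fun u v w ↦ e.injective ?_, fun u v w z ↦ ?_, fun u v w ↦ e.injective ?_⟩, fun v w ↦ ?_,
    ?_, fun X Y Z hX hY hZ ↦ e.injective ?_⟩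
  · simp only [ContinuousLinearMap.coe_coe, hc, map_neg]
    exact h.sq_I _
  · simp only [ContinuousLinearMap.coe_coe, hc]
    exact h.sq_J _
  · simp only [ContinuousLinearMap.coe_coe, hc, map_neg]
    exact h.anticomm _
  · simp only [ContinuousLinearMap.coe_coe, hc]
    exact h.mul_eq _
  · ext B
    rw [Submodule.mem_span_triple]
    constructor
    · rintro ⟨s, t, u, rfl⟩
      refine ⟨s • I + t • J + u • K, ?_, fun v ↦ ?_⟩
      · rw [← hspan, Submodule.mem_span_triple]
        exact ⟨s, t, u, rfl⟩
      · simp only [he, _root_.add_apply, _root_.smul_apply, map_add, map_smul, hc]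
    · rintro ⟨A, hA, hAB⟩
      rw [← hspan, Submodule.mem_span_triple] at hA
      obtain ⟨s, t, u, rfl⟩ := hA
      refine ⟨s, t, u, ?_⟩
      ext v
      refine e.injective ((he _).symm.trans (Eq.trans ?_ (hAB v).symm))
      simp only [he, _root_.add_apply, _root_.smul_apply, map_add, map_smul, hc]
  · rw [map_neg, hW', hW', hW.antisymm]
  · rw [hmetric, hmetric, hW', hW']
    exact hW.skew _ _ _ _
  · simp only [map_add, hW', map_zero]
    exact hW.bianchi _ _ _
  · have h1 := LinearMap.trace_conj' ((W.flip (e v)).flip (e w)) e.symm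
    rw [hW0] at h1
    rw [← h1]
    congr 1
  · rintro _ ⟨B, ⟨A, hA, hAB⟩, rfl⟩ u v w
    refine e.injective ?_
    simp only [he] at hAB
    simp only [map_sub, hW', hAB, map_zero]
    exact hWQ A ⟨A, hA, rfl⟩ _ _ _
  · have hs := fun {X} (hX : SmoothVectorFieldAt X x) ↦
      smooth_extendMap (hM.smooth x) hr hX
    have hex := fun X ↦ (extendMap_apply (hM.smooth x) hr X).self_of_nhds
    have h1 := (mfderiv_curvatureOn hM hg hLC hDQ hQ hr hX hY hZ).trans
      (hWe _ _ _ (hs hX) (hs hY) (hs hZ))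
    refine h1.trans ?_
    rw [hex, hex, hex]
    simp only [modelCurvature, wedgeEnd, map_add, map_sub, map_smul, map_neg, hW',
      ContinuousLinearMap.coe_coe, hc, hmetric, he]

end InducedCurvature

end ParaQuat

/-! ### The theorem -/

theorem corollary3p9
    {E : Type*} [NormedAddCommGroup E] [NormedSpace ℝ E] [FiniteDimensional ℝ E]
    {M : Type*} [TopologicalSpace M] [T2Space M] [ChartedSpace E M] [IsManifold 𝓘(ℝ, E) ∞ M]
    {F : Type*} [NormedAddCommGroup F] [NormedSpace ℝ F] [FiniteDimensional ℝ F]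
    {N : Type*} [TopologicalSpace N] [T2Space N] [ChartedSpace F N] [IsManifold 𝓘(ℝ, F) ∞ N]
    (k n : ℕ) (hk : Module.finrank ℝ E = 4 * k) (hn : Module.finrank ℝ F = 4 * n)
    (g : ParaQuat.FormField F N) (Q : ParaQuat.EndSubspaceField F N)
    (hN : ParaQuat.IsParaQuaternionicKahler g Q)
    (ε : ℝ) (hε : ε = 1 ∨ ε = -1) (f : M → N)
    (J : ∀ x : M, TangentSpace 𝓘(ℝ, F) (f x) →L[ℝ] TangentSpace 𝓘(ℝ, F) (f x))
    (𝓙 : ParaQuat.EndField E M)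
    (hM : ParaQuat.IsAlmostEpsHermitian ε g Q f J 𝓙)
    (U : Set M) (hUo : IsOpen U) (hUd : Dense U)
    (hUN : ∀ x ∈ U, ParaQuat.NijenhuisNeZeroAt ε 𝓙 x)
    (hU : ∀ x ∈ U, ParaQuat.IsNondegenerateOn (fun u v ↦ g (f x) u v)
      (ParaQuat.maximalInvariant (ParaQuat.fiberMaps Q (f x)) (ParaQuat.tangentImage E F f x))) :
    ParaQuat.IsTotallyGeodesicParaQuaternionicKahler (E := E) g Q f := by
  obtain ⟨D, hLC, hDQ, hcurv⟩ := hN.parallel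
  have hinv : ∀ x ∈ U, ParaQuat.IsInvariantUnder (ParaQuat.fiberMaps Q (f x)) (ParaQuat.tangentImage E F f x) :=
    fun x hx ↦ hM.invariant_of_nijenhuisNeZeroAt hN hε ⟨k, hk⟩ (hUN x hx) (hU x hx)
  have hMI : ParaQuat.IsParaQuaternionicImmersion E g Q f :=
    { smooth := hM.contMDiffAt
      retraction := hM.exists_retraction
      nondegenerate := hM.nondegenerate
      invariant := fun x ↦ by
        obtain ⟨r, hr⟩ := hM.exists_retraction x
        exact ParaQuat.invariant_of_dense hN.almost (hM.contMDiffAt x) hr hUd hinv }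
  -- A nonzero value of the Nijenhuis tensor is a nonzero tangent vector, and the dense set is
  -- nonempty when `M` is.
  have hE : M → Nontrivial E := fun x ↦ by
    obtain ⟨y, hy⟩ := hUd.nonempty_iff.2 ⟨x⟩
    obtain ⟨X, Y, -, -, hXY⟩ := hUN y hy
    exact ⟨_, _, hXY⟩
  refine ⟨hMI.invariant, ParaQuat.isTotallyGeodesic_of_invariant hLC hDQ hN.almost hMI.smooth
    hMI.retraction hMI.invariant, hMI.inducedMetric hN.metric, hMI.inducedStructure hN.almost hE,
    ParaQuat.inducedStructure_skew hN.skew, ParaQuat.inducedConnection D f hMI,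
    ParaQuat.isLeviCivita_inducedConnection hMI hN.metric hLC hDQ hN.almost,
    ParaQuat.preservesEnd_inducedConnection hMI hLC hDQ hN.almost, fun hE4 x ↦ ?_⟩
  have hle : Module.finrank ℝ E ≤ Module.finrank ℝ F :=
    LinearMap.finrank_le_finrank_of_injective
      (f := (mfderiv 𝓘(ℝ, E) 𝓘(ℝ, F) f x).toLinearMap) (hM.injective x)
  -- The submanifold has dimension 4 here. In ambient dimension 4 the decomposition is part of the
  -- hypothesis; otherwise `hle` gives ambient dimension above 4, where it follows from the algebra.
  by_cases hF : Module.finrank ℝ F = 4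
  · exact ParaQuat.hasParaQuaternionicCurvatureAt_of_finrank_eq hMI hN.metric hLC hDQ hN.almost
      (hE4.trans hF.symm) x (hcurv hF (f x))
  · exact ParaQuat.hasParaQuaternionicCurvatureAt_of_four_lt hMI hN.metric hN.skew hLC hDQ hN.almost
      (by omega) x
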